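/- Let $n\ge 0$ and $k\ge 1$ be integers, let $E$ be a (Hausdorff, second countable) smooth manifold of dimension $n+1$ and let $\pi\colon E\to\mathbb R$ be a smooth surjective submersion (for example a smooth fibre bundle). For $m\ge 0$ let $J^m\pi$ be the manifold of $m$-jets of local smooth sections of $\pi$, with projection $\bar\pi^m\colon J^m\pi\to\mathbb R$; coordinates $(t,q^A)$ of $E$, $1\le A\le n$, adapted to $\pi$ induce natural coordinates $(t,q_0^A,\dots,q_m^A)$ of $J^m\pi$. For a section $\phi$, $j^m\phi\colon\mathbb R\to J^m\pi$ is its prolongation. Let $L\in C^\infty(J^k\pi)$ (the Lagrangian density is $\mathcal L=L\,dt$), and let $d_T=\partial_t+\sum_i q_{i+1}^A\,\partial/\partial q_i^A$ be the total time derivative. The Poincaré–Cartan form of $\mathcal L$ is the 2-form $\Omega_{\mathcal L}=-d\Theta_{\mathcal L}$ on $J^{2k-1}\pi$, where in natural coordinates $$\Theta_{\mathcal L}=\sum_{r=1}^{k}\sum_{i=0}^{k-r}(-1)^i d_T^i\Big(\frac{\partial L}{\partial q^A_{r+i}}\Big)\,(dq^A_{r-1}-q^A_r\,dt)+L\,dt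 .$$ A smooth vector field $X$ on $J^{2k-1}\pi$ is *transverse* if $dt(X)$ vanishes nowhere. It is a *semispray of type 1* if every section $\psi$ of $\bar\pi^{2k-1}$ over an open interval whose velocity is at each time proportional to $X$ is of the form $\psi=j^{2k-1}\chi$ with $\chi$ a smooth local section of $\pi$. Let $\phi\colon\mathbb R\to E$ be a smooth section of $\pi$ and put $\psi_{\mathcal L}=j^{2k-1}\phi$. The following four assertions are equivalent. 1. $\psi_{\mathcal L}^*\, i(Y)\Omega_{\mathcal L}=0$ for every smooth vector field $Y$ on $J^{2k-1}\pi$. 2. In all natural coordinates $\phi$ satisfies the $k$-th order Euler–Lagrange equations $$\sum_{i=0}^{k}(-1)^i\frac{d^i}{dt^i}\Big(\frac{\partial L}{\partial q_i^A}\circ j^k\phi\Big)=0,\qquad 1\le A\le n .$$ 3. $i(\psi_{\mathcal L}')(\Omega_{\mathcal L}\circ\psi_{\mathcal L})=0$, where $\psi_{\mathcal L}'\colon\mathbb R\to T(J^{2k-1}\pi)$ is the canonical lifting of $\psi_{\mathcal L}$. 4. $\psi_{\mathcal L}$ is an integral curve of a transverse semispray of type 1, $X_{\mathcal L}$, on $J^{2k-1}\pi$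 such that $i(X_{\mathcal L})\Omega_{\mathcal L}=0$ at all points of the curve $\psi_{\mathcal L}(\mathbb R)$. If moreover $L$ is regular, that is, $\det\big(\partial^2L/\partial q_k^B\partial q_k^A\big)\ne 0$ at every point of $J^k\pi$ in natural coordinates, then these assertions are also equivalent to: 4'. $\psi_{\mathcal L}$ is an integral curve of a transverse semispray of type 1, $X_{\mathcal L}$, on $J^{2k-1}\pi$ such that $i(X_{\mathcal L})\Omega_{\mathcal L}=0$ on the whole of $J^{2k-1}\pi$. -/

import Mathlib

open Set Filter Topology Manifold
open scoped ContDiff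

set_option linter.unusedSectionVars false

noncomputable section

namespace JetBundle

/-! ### Fibred manifolds over the real line and adapted coordinates -/

/-- The space in which adapted coordinates `(t, q^A)`, `1 ≤ A ≤ n`, take their values. -/
abbrev BaseModel (n : ℕ) := ℝ × (Fin n → ℝ)
/-- The space in which natural coordinates `(t, q_0^A, …, q_m^A)` of `m`-jets take their values. -/
abbrev JetModel (n m : ℕ) := ℝ × (Fin (m + 1) → Fin n → ℝ)

/-- A smooth fibred manifold `E → ℝ` with `dim E = n + 1`: the projection is a surjective smooth
submersion. Every smooth (locally trivial) fibre bundle over `ℝ` is of this kind. -/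
structure FibredManifold (n : ℕ) (E : Type*) [TopologicalSpace E]
    [ChartedSpace (EuclideanSpace ℝ (Fin (n + 1))) E] where
  proj : E → ℝ
  surjective : Function.Surjective proj
  isSubmersion : IsSubmersion (𝓡 (n + 1)) 𝓘(ℝ, ℝ) ∞ proj

variable {n : ℕ} {E : Type*} [TopologicalSpace E]
  [ChartedSpace (EuclideanSpace ℝ (Fin (n + 1))) E]

/-- Local coordinates `(t, q^A)` of the smooth manifold `E` adapted to the projection: an open
partial homeomorphism, smooth together with its inverse, whose first component is the
projection. -/
structure AdaptedChart (π : FibredManifold n E) where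
  chart : OpenPartialHomeomorph E (BaseModel n)
  smooth : ContMDiffOn (𝓡 (n + 1)) 𝓘(ℝ, BaseModel n) ∞ chart chart.source
  smooth_symm : ContMDiffOn 𝓘(ℝ, BaseModel n) (𝓡 (n + 1)) ∞ chart.symm chart.target
  fst_eq : ∀ e ∈ chart.source, (chart e).1 = π.proj e

/-- Every point lies in the domain of an adapted chart. -/
theorem exists_adaptedChart [IsManifold (𝓡 (n + 1)) ∞ E] (π : FibredManifold n E) (e : E) :
    ∃ c : AdaptedChart π, e ∈ c.chart.source := by
  obtain ⟨F, _, _, h⟩ := π.isSubmersion.isSubmersionAt e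
  have hd := h.domChart_mem_maximalAtlas
  have hc := h.codChart_mem_maximalAtlas
  have hfin : Module.Finite ℝ F :=
    Module.Finite.of_surjective ((LinearMap.snd ℝ ℝ F).comp h.equiv.toLinearMap)
      (Prod.snd_surjective.comp h.equiv.surjective)
  have hrank : Module.finrank ℝ F = Module.finrank ℝ (Fin n → ℝ) := by
    have := h.equiv.toLinearEquiv.finrank_eq
    simp at this
    simp; omega
  let L : F ≃L[ℝ] (Fin n → ℝ) := ContinuousLinearEquiv.ofFinrankEq hrank
  let c : OpenPartialHomeomorph E (BaseModel n) :=
    (h.domChart.trans h.equiv.toHomeomorph.toOpenPartialHomeomorph).trans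
      (h.codChart.symm.prod L.toHomeomorph.toOpenPartialHomeomorph)
  have hproj : ∀ x ∈ h.domChart.source, h.codChart (π.proj x) = (h.equiv (h.domChart x)).1 := by
    intro x hx
    have hx' : h.domChart x ∈ (h.domChart.extend (𝓡 (n + 1))).target := by simp [hx]
    have := h.writtenInCharts hx'
    simpa [hx] using this
  have hsrc : ∀ x ∈ h.domChart.source, π.proj x ∈ h.codChart.source :=
    fun x hx => h.source_subset_preimage_source hx
  refine ⟨⟨c, ?_, ?_, ?_⟩, ?_⟩
  · have h1 : ContMDiffOn (𝓡 (n + 1)) (𝓡 (n + 1)) ∞ h.domChart h.domChart.source :=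
      contMDiffOn_of_mem_maximalAtlas hd
    have h2 : ContMDiffOn 𝓘(ℝ, ℝ) 𝓘(ℝ, ℝ) ∞ h.codChart.symm h.codChart.target :=
      contMDiffOn_symm_of_mem_maximalAtlas hc
    rw [contMDiffOn_iff_contDiffOn] at h2
    have h3 : ContDiffOn ℝ ∞ (fun y : EuclideanSpace ℝ (Fin (n + 1)) =>
        ((h.codChart.symm (h.equiv y).1, L (h.equiv y).2) : BaseModel n))
        {y | (h.equiv y).1 ∈ h.codChart.target} := by
      refine ContDiffOn.prodMk ?_ ?_
      · exact h2.comp (contDiff_fst.comp h.equiv.contDiff).contDiffOn (fun y hy => hy)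
      · exact (L.contDiff.comp (contDiff_snd.comp h.equiv.contDiff)).contDiffOn
    refine (h3.contMDiffOn.comp (h1.mono ?_) ?_).congr ?_
    · intro x hx; simp [c] at hx; exact hx.1
    · intro x hx; simp [c] at hx; exact hx.2
    · intro x hx; simp [c]
  · have h1 : ContMDiffOn (𝓡 (n + 1)) (𝓡 (n + 1)) ∞ h.domChart.symm h.domChart.target :=
      contMDiffOn_symm_of_mem_maximalAtlas hd
    have h2 : ContMDiffOn 𝓘(ℝ, ℝ) 𝓘(ℝ, ℝ) ∞ h.codChart h.codChart.source :=
      contMDiffOn_of_mem_maximalAtlas hc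
    rw [contMDiffOn_iff_contDiffOn] at h2
    have h3 : ContDiffOn ℝ ∞ (fun y : BaseModel n =>
        h.equiv.symm ((h.codChart y.1, L.symm y.2)))
        {y | y.1 ∈ h.codChart.source} := by
      refine h.equiv.symm.contDiff.comp_contDiffOn (ContDiffOn.prodMk ?_ ?_)
      · exact h2.comp contDiff_fst.contDiffOn (fun y hy => hy)
      · exact (L.symm.contDiff.comp contDiff_snd).contDiffOn
    refine (h1.comp (h3.contMDiffOn.mono ?_) ?_).congr ?_
    · intro x hx; simp [c] at hx; exact hx.1
    · intro x hx; simp [c] at hx; exact hx.2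
    · intro x hx; simp [c]
  · intro x hx
    simp [c] at hx
    have : (c x).1 = h.codChart.symm (h.equiv (h.domChart x)).1 := by simp [c]
    rw [this, ← hproj x hx.1, h.codChart.left_inv (hsrc x hx.1)]
  · have he := h.mem_domChart_source
    simp [c, he, ← hproj e he]
    exact h.codChart.map_source (hsrc e he)

/-! ### Calculus lemmas for the smooth structure of the jet spaces -/

/-- The derivatives up to order `m` of `g ∘ x` only depend on those of `x`. -/
theorem iteratedDeriv_comp_congr {W W' : Type*} [NormedAddCommGroup W] [NormedSpace ℝ W]
    [NormedAddCommGroup W'] [NormedSpace ℝ W'] {m : ℕ} {x y : ℝ → W} {g : W → W'} {t : ℝ}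
    (hx : ContDiffAt ℝ m x t) (hy : ContDiffAt ℝ m y t) (hg : ContDiffAt ℝ m g (x t))
    (h : ∀ i ≤ m, iteratedDeriv i x t = iteratedDeriv i y t) :
    ∀ i ≤ m, iteratedDeriv i (g ∘ x) t = iteratedDeriv i (g ∘ y) t := by
  intro i hi
  have h0 : x t = y t := by simpa using h 0 (Nat.zero_le _)
  have hi' : (i : ℕ∞ω) ≤ m := by exact_mod_cast hi
  rw [iteratedDeriv_vcomp_eq_sum_orderedFinpartition hg hx hi',
    iteratedDeriv_vcomp_eq_sum_orderedFinpartition (h0 ▸ hg) hy hi', h0]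
  refine Finset.sum_congr rfl fun c _ => ?_
  congr 1
  funext j
  exact h _ ((c.partSize_le j).trans hi)

theorem iteratedDeriv_poly {n m : ℕ} (t : ℝ) (q : Fin (m + 1) → Fin n → ℝ) (i : Fin (m + 1)) :
    iteratedDeriv i (fun s : ℝ => ∑ j : Fin (m + 1), ((s - t) ^ (j : ℕ) / (j : ℕ).factorial) • q j) t
      = q i := by
  have h1 : ∀ j : Fin (m + 1), iteratedDeriv (i : ℕ)
      (fun s : ℝ => ((s - t) ^ (j : ℕ) / (j : ℕ).factorial) • q j) t = if j = i then q j else 0 := by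
    intro j
    rw [iteratedDeriv_smul_const (by fun_prop)]
    have : iteratedDeriv (i : ℕ) (fun s : ℝ => (s - t) ^ (j : ℕ) / (j : ℕ).factorial) t
        = if j = i then 1 else 0 := by
      have e1 : (fun s : ℝ => (s - t) ^ (j : ℕ) / ((j : ℕ).factorial : ℝ)) =
        fun s => ((j : ℕ).factorial : ℝ)⁻¹ * (fun u : ℝ => u ^ (j : ℕ)) (s - t) := by
        funext s; simp; ring
      rw [e1, iteratedDeriv_const_mul_field,
        iteratedDeriv_comp_sub_const (n := (i : ℕ)) (f := fun u : ℝ => u ^ (j : ℕ)) (s := t)]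
      simp only [sub_self]
      have := iteratedDeriv_pow (𝕜 := ℝ) (x := 0) (j : ℕ) (i : ℕ)
      rw [iteratedDeriv_pow]
      by_cases hji : j = i
      · subst hji
        simp [Nat.descFactorial_self, Nat.factorial_ne_zero]
      · rw [if_neg hji]
        have hne : (j : ℕ) ≠ i := fun h => hji (Fin.ext h)
        rcases lt_or_gt_of_ne hne with h | h
        · simp [Nat.descFactorial_of_lt h]
        · simp [Nat.sub_ne_zero_of_lt h]
    rw [this]; split_ifs <;> simp
  rw [iteratedDeriv_fun_sum (fun j _ => by fun_prop)]
  simp [h1]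

theorem contDiffOn_iteratedDeriv_param {Z W : Type*} [NormedAddCommGroup Z] [NormedSpace ℝ Z]
    [NormedAddCommGroup W] [NormedSpace ℝ W] {G : Z × ℝ → W} {U : Set (Z × ℝ)} (hU : IsOpen U)
    (hG : ContDiffOn ℝ ∞ G U) (i : ℕ) :
    ContDiffOn ℝ ∞ (fun p : Z × ℝ => iteratedDeriv i (fun s => G (p.1, s)) p.2) U := by
  induction i with
  | zero => simpa using hG
  | succ i ih =>
    have hf := ih.fderiv_of_isOpen (m := ∞) hU (by simp)
    have : ContDiffOn ℝ ∞ (fun p : Z × ℝ =>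
      fderiv ℝ (fun p : Z × ℝ => iteratedDeriv i (fun s => G (p.1, s)) p.2) p ((0, 1) : Z × ℝ)) U :=
      hf.clm_apply contDiffOn_const
    refine this.congr fun p hp => ?_
    rw [iteratedDeriv_succ]
    have hd := ((ih.contDiffAt (hU.mem_nhds hp)).differentiableAt (by simp)).hasFDerivAt
    have h2 : HasDerivAt (fun s : ℝ => ((p.1, s) : Z × ℝ)) (0, 1) p.2 :=
      (hasDerivAt_const _ _).prodMk (hasDerivAt_id _)
    exact (HasFDerivAt.comp_hasDerivAt p.2 (f := fun s : ℝ => ((p.1, s) : Z × ℝ)) hd h2).deriv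

/-! ### Jets of sections -/

variable (π : FibredManifold n E)

/-- `φ` is, in a neighbourhood of `t`, a smooth section of the projection. -/
def IsLocalSection (φ : ℝ → E) (t : ℝ) : Prop :=
  ∀ᶠ s in 𝓝 t, π.proj (φ s) = s ∧ ContMDiffAt 𝓘(ℝ, ℝ) (𝓡 (n + 1)) ∞ φ s

/-- A base point together with a section which is smooth near it. -/
structure GermRep where
  t : ℝ
  φ : ℝ → E
  isLocalSection : IsLocalSection π φ t

/-- Two local sections have the same `m`-jet: they have the same base point, the same value there,
and the same derivatives up to order `m` in a chart around that value. -/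
def SameJet (m : ℕ) (a b : GermRep π) : Prop :=
  a.t = b.t ∧ a.φ a.t = b.φ b.t ∧ ∀ i ≤ m,
    iteratedDeriv i (chartAt (EuclideanSpace ℝ (Fin (n + 1))) (a.φ a.t) ∘ a.φ) a.t =
      iteratedDeriv i (chartAt (EuclideanSpace ℝ (Fin (n + 1))) (a.φ a.t) ∘ b.φ) a.t

/-- Equality of `m`-jets is an equivalence relation. -/
def jetSetoid (m : ℕ) : Setoid (GermRep π) where
  r := SameJet π m
  iseqv :=
    { refl := fun _ => ⟨rfl, rfl, fun _ _ => rfl⟩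
      symm := by
        rintro a b ⟨h1, h2, h3⟩
        refine ⟨h1.symm, h2.symm, fun i hi => ?_⟩
        have := h3 i hi
        rw [h2, h1] at this
        exact this.symm
      trans := by
        rintro a b c ⟨h1, h2, h3⟩ ⟨h1', h2', h3'⟩
        refine ⟨h1.trans h1', h2.trans h2', fun i hi => ?_⟩
        have := h3' i hi
        rw [← h2, ← h1] at this
        exact (h3 i hi).trans this }

/-- The set `J^m π` of `m`-jets of local sections. -/
def Jet (m : ℕ) : Type _ := Quotient (jetSetoid π m)

variable {π}

namespace Jet
variable {m : ℕ}

/-- The `m`-jet `j^m_t φ`. -/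
def mk (m : ℕ) (φ : ℝ → E) (t : ℝ) (h : IsLocalSection π φ t) : Jet π m :=
  Quotient.mk (jetSetoid π m) ⟨t, φ, h⟩

/-- The projection of `J^m π` onto `ℝ`. -/
def time : Jet π m → ℝ := Quotient.lift (fun a : GermRep π => a.t) fun _ _ h => h.1

/-- The projection of `J^m π` onto `E`. -/
def toTotal : Jet π m → E := Quotient.lift (fun a : GermRep π => a.φ a.t) fun _ _ h => h.2.1

theorem exists_rep (j : Jet π m) : ∃ (φ : ℝ → E) (t : ℝ) (h : IsLocalSection π φ t),
    j = mk m φ t h := by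
  obtain ⟨a, rfl⟩ := Quotient.exists_rep j
  exact ⟨a.φ, a.t, a.isLocalSection, rfl⟩

end Jet

theorem IsLocalSection.contMDiffAt {φ : ℝ → E} {t : ℝ} (h : IsLocalSection π φ t) :
    ContMDiffAt 𝓘(ℝ, ℝ) (𝓡 (n + 1)) ∞ φ t := h.self_of_nhds.2

theorem IsLocalSection.proj_eq {φ : ℝ → E} {t : ℝ} (h : IsLocalSection π φ t) :
    π.proj (φ t) = t := h.self_of_nhds.1

theorem AdaptedChart.contDiffAt_comp (c : AdaptedChart π) {φ : ℝ → E} {t : ℝ}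
    (h : IsLocalSection π φ t) (hc : φ t ∈ c.chart.source) :
    ContDiffAt ℝ ∞ (c.chart ∘ φ) t := by
  have h1 := (c.smooth.contMDiffAt (c.chart.open_source.mem_nhds hc)).comp t h.contMDiffAt
  exact h1.contDiffAt

theorem contDiffAt_chartAt_comp [IsManifold (𝓡 (n + 1)) ∞ E] {φ : ℝ → E} {t : ℝ}
    (h : IsLocalSection π φ t) (e : E)
    (he : φ t ∈ (chartAt (EuclideanSpace ℝ (Fin (n + 1))) e).source) :
    ContDiffAt ℝ ∞ (chartAt (EuclideanSpace ℝ (Fin (n + 1))) e ∘ φ) t := by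
  have h0 : ContMDiffOn (𝓡 (n + 1)) (𝓡 (n + 1)) ∞
      (chartAt (EuclideanSpace ℝ (Fin (n + 1))) e) _ := contMDiffOn_chart
  have h1 := (h0.contMDiffAt ((chartAt _ e).open_source.mem_nhds he)).comp t h.contMDiffAt
  exact h1.contDiffAt

/-- Agreement of derivatives up to order `m` is carried from one chart to another. -/
theorem iteratedDeriv_chart_congr {W W' : Type*} [NormedAddCommGroup W] [NormedSpace ℝ W]
    [NormedAddCommGroup W'] [NormedSpace ℝ W'] {m : ℕ} {φ χ : ℝ → E} {t : ℝ}
    (A : OpenPartialHomeomorph E W) (B : E → W')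
    (hφc : ContinuousAt φ t) (hχc : ContinuousAt χ t)
    (hφ : φ t ∈ A.source) (hχ : χ t ∈ A.source)
    (hφA : ContDiffAt ℝ ∞ (A ∘ φ) t) (hχA : ContDiffAt ℝ ∞ (A ∘ χ) t)
    (hB : ContDiffAt ℝ ∞ (B ∘ A.symm) (A (φ t)))
    (h : ∀ i ≤ m, iteratedDeriv i (A ∘ φ) t = iteratedDeriv i (A ∘ χ) t) :
    ∀ i ≤ m, iteratedDeriv i (B ∘ φ) t = iteratedDeriv i (B ∘ χ) t := by
  intro i hi
  have hm : (m : ℕ∞ω) ≤ ∞ := by exact_mod_cast le_top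
  have key := iteratedDeriv_comp_congr (hφA.of_le hm) (hχA.of_le hm)
    (hB.of_le hm) h i hi
  have e1 : ∀ {f : ℝ → E}, ContinuousAt f t → f t ∈ A.source →
      (B ∘ A.symm) ∘ (A ∘ f) =ᶠ[𝓝 t] B ∘ f := by
    intro f hf hft
    filter_upwards [hf.preimage_mem_nhds (A.open_source.mem_nhds hft)] with s hs
    simp [A.left_inv hs]
  rw [(e1 hφc hφ).iteratedDeriv_eq, (e1 hχc hχ).iteratedDeriv_eq] at key
  exact key

theorem iteratedDeriv_fst_snd {V : Type*} [NormedAddCommGroup V] [NormedSpace ℝ V]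
    {f : ℝ → ℝ × V} {t : ℝ} (hf : ContDiffAt ℝ ∞ f t) (i : ℕ) :
    iteratedDeriv i f t =
      (iteratedDeriv i (fun s => (f s).1) t, iteratedDeriv i (fun s => (f s).2) t) := by
  have hi : ((i : ℕ∞) : ℕ∞ω) ≤ ∞ := by exact_mod_cast le_top
  have h1 := (ContinuousLinearMap.fst ℝ ℝ V).iteratedFDeriv_comp_left hf hi
  have h2 := (ContinuousLinearMap.snd ℝ ℝ V).iteratedFDeriv_comp_left hf hi
  simp only [iteratedDeriv_eq_iteratedFDeriv]
  refine Prod.ext ?_ ?_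
  · exact (DFunLike.congr_fun h1 (fun _ => (1 : ℝ))).symm
  · exact (DFunLike.congr_fun h2 (fun _ => (1 : ℝ))).symm

namespace AdaptedChart

open Classical in
/-- Natural coordinates `(t, φ^A(t), …, (d/dt)^m φ^A(t))` of the jet of a section (and the junk
value `0` outside the domain of the chart). -/
def repCoords (c : AdaptedChart π) (m : ℕ) (a : GermRep π) : JetModel n m :=
  if a.φ a.t ∈ c.chart.source then
    (a.t, fun i => iteratedDeriv (i : ℕ) (fun s => (c.chart (a.φ s)).2) a.t)
  else 0

variable [IsManifold (𝓡 (n + 1)) ∞ E]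

theorem contDiffAt_comp_chartAt_symm (c : AdaptedChart π) {e : E} (e' : E)
    (he' : e ∈ (chartAt (EuclideanSpace ℝ (Fin (n + 1))) e').source)
    (he : e ∈ c.chart.source) :
    ContDiffAt ℝ ∞ (c.chart ∘ (chartAt (EuclideanSpace ℝ (Fin (n + 1))) e').symm)
      (chartAt (EuclideanSpace ℝ (Fin (n + 1))) e' e) := by
  set A := chartAt (EuclideanSpace ℝ (Fin (n + 1))) e'
  have h0 : ContMDiffOn (𝓡 (n + 1)) (𝓡 (n + 1)) ∞ A.symm A.target := contMDiffOn_chart_symm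
  have h1 := h0.contMDiffAt (A.open_target.mem_nhds (A.map_source he'))
  have h2 : ContMDiffAt (𝓡 (n + 1)) 𝓘(ℝ, BaseModel n) ∞ c.chart (A.symm (A e)) := by
    rw [A.left_inv he']
    exact c.smooth.contMDiffAt (c.chart.open_source.mem_nhds he)
  exact (h2.comp (A e) h1).contDiffAt

theorem contDiffAt_chartAt_comp_symm (c : AdaptedChart π) {e : E} (e' : E)
    (he' : e ∈ (chartAt (EuclideanSpace ℝ (Fin (n + 1))) e').source)
    (he : e ∈ c.chart.source) :
    ContDiffAt ℝ ∞ (chartAt (EuclideanSpace ℝ (Fin (n + 1))) e' ∘ c.chart.symm) (c.chart e) := by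
  set A := chartAt (EuclideanSpace ℝ (Fin (n + 1))) e'
  have h0 : ContMDiffOn (𝓡 (n + 1)) (𝓡 (n + 1)) ∞ A A.source := contMDiffOn_chart
  have h1 := c.smooth_symm.contMDiffAt (c.chart.open_target.mem_nhds (c.chart.map_source he))
  have h2 : ContMDiffAt (𝓡 (n + 1)) (𝓡 (n + 1)) ∞ A (c.chart.symm (c.chart e)) := by
    rw [c.chart.left_inv he]
    exact h0.contMDiffAt (A.open_source.mem_nhds he')
  exact (h2.comp (c.chart e) h1).contDiffAt

theorem repCoords_congr (c : AdaptedChart π) (m : ℕ) {a b : GermRep π} (h : SameJet π m a b) :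
    c.repCoords m a = c.repCoords m b := by
  obtain ⟨t, φ, hφ⟩ := a
  obtain ⟨t', χ, hχ⟩ := b
  obtain ⟨h1, h2, h3⟩ := h
  dsimp only at h1 h2 h3
  subst h1
  unfold repCoords
  dsimp only
  by_cases hc : χ t ∈ c.chart.source
  · rw [if_pos hc, if_pos (h2 ▸ hc)]
    refine Prod.ext rfl (funext fun i => ?_)
    set A := chartAt (EuclideanSpace ℝ (Fin (n + 1))) (φ t) with hA
    have hφA : φ t ∈ A.source := mem_chart_source _ _
    have hχA : χ t ∈ A.source := h2 ▸ hφA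
    have := iteratedDeriv_chart_congr A c.chart hφ.contMDiffAt.continuousAt
      hχ.contMDiffAt.continuousAt hφA hχA (contDiffAt_chartAt_comp hφ _ hφA)
      (contDiffAt_chartAt_comp hχ _ hχA)
      (c.contDiffAt_comp_chartAt_symm _ hφA (h2 ▸ hc)) h3 i (by omega)
    rw [iteratedDeriv_fst_snd (c.contDiffAt_comp hφ (h2 ▸ hc)),
      iteratedDeriv_fst_snd (c.contDiffAt_comp hχ hc)] at this
    exact (Prod.ext_iff.1 this).2
  · rw [if_neg hc, if_neg (h2 ▸ hc)]

/-- Natural coordinates `(t, q_0^A, …, q_m^A)` on `J^m π` induced by an adapted chart. -/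
def coords (c : AdaptedChart π) (m : ℕ) : Jet π m → JetModel n m :=
  Quotient.lift (c.repCoords m) fun _ _ h => c.repCoords_congr m h

theorem coords_mk (c : AdaptedChart π) (m : ℕ) {φ : ℝ → E} {t : ℝ} (h : IsLocalSection π φ t)
    (hc : φ t ∈ c.chart.source) : c.coords m (Jet.mk m φ t h) =
      (t, fun i : Fin (m + 1) => iteratedDeriv (i : ℕ) (fun s => (c.chart (φ s)).2) t) :=
  if_pos hc

/-- The curve `s ↦ (s, ∑ j, q_j (s - t)^j / j!)`. -/
def taylorCurve {n m : ℕ} (x : JetModel n m) (s : ℝ) : BaseModel n :=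
  (s, ∑ j : Fin (m + 1), ((s - x.1) ^ (j : ℕ) / ((j : ℕ).factorial : ℝ)) • x.2 j)

theorem taylorCurve_self {n m : ℕ} (x : JetModel n m) : taylorCurve x x.1 = (x.1, x.2 0) := by
  refine Prod.ext rfl ?_
  have := iteratedDeriv_poly x.1 x.2 0
  simpa [taylorCurve] using this

theorem contDiff_taylorCurve (n m : ℕ) :
    ContDiff ℝ ∞ (fun p : JetModel n m × ℝ => taylorCurve p.1 p.2) := by
  unfold taylorCurve
  fun_prop

theorem isLocalSection_taylor (c : AdaptedChart π) {m : ℕ} {x : JetModel n m}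
    (hx : ((x.1, x.2 0) : BaseModel n) ∈ c.chart.target) :
    IsLocalSection π (fun s => c.chart.symm (taylorCurve x s)) x.1 := by
  have hcd : ContDiff ℝ ∞ (fun s => taylorCurve x s) := 
    (contDiff_taylorCurve n m).comp (contDiff_const.prodMk contDiff_id)
  have hmem : ∀ᶠ s in 𝓝 x.1, taylorCurve x s ∈ c.chart.target :=
    hcd.continuous.continuousAt.preimage_mem_nhds
      (c.chart.open_target.mem_nhds (by rw [taylorCurve_self]; exact hx))
  filter_upwards [hmem] with s hs
  refine ⟨?_, ?_⟩
  · rw [← c.fst_eq _ (c.chart.map_target hs), c.chart.right_inv hs]; rfl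
  · exact (c.smooth_symm.contMDiffAt (c.chart.open_target.mem_nhds hs)).comp s
      hcd.contDiffAt.contMDiffAt

theorem coords_taylor (c : AdaptedChart π) {m : ℕ} {x : JetModel n m}
    (hx : ((x.1, x.2 0) : BaseModel n) ∈ c.chart.target) :
    c.coords m (Jet.mk m _ x.1 (c.isLocalSection_taylor hx)) = x := by
  have hsrc : c.chart.symm (taylorCurve x x.1) ∈ c.chart.source := by
    rw [taylorCurve_self]; exact c.chart.map_target hx
  rw [coords_mk _ _ _ hsrc]
  refine Prod.ext rfl (funext fun i => ?_)
  have hcont : ContinuousAt (fun s => taylorCurve x s) x.1 :=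
    ((contDiff_taylorCurve n m).comp (contDiff_const.prodMk contDiff_id)).continuous.continuousAt
  have hev : (fun s => (c.chart (c.chart.symm (taylorCurve x s))).2) =ᶠ[𝓝 x.1]
      fun s => (taylorCurve x s).2 := by
    filter_upwards [hcont.preimage_mem_nhds
      (c.chart.open_target.mem_nhds (by rw [taylorCurve_self]; exact hx))] with s hs
    rw [c.chart.right_inv hs]
  dsimp only
  rw [hev.iteratedDeriv_eq]
  exact iteratedDeriv_poly x.1 x.2 i

theorem fst_coords (c : AdaptedChart π) {m : ℕ} {φ : ℝ → E} {t : ℝ} (h : IsLocalSection π φ t)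
    (hc : φ t ∈ c.chart.source) :
    (((c.coords m (Jet.mk m φ t h)).1, (c.coords m (Jet.mk m φ t h)).2 0) : BaseModel n)
      = c.chart (φ t) := by
  rw [c.coords_mk m h hc]
  refine Prod.ext ?_ ?_
  · simp [c.fst_eq _ hc, h.proj_eq]
  · simp

/-- A germ is determined up to order `m` by its natural coordinates. -/
theorem mk_eq_of_coords (c : AdaptedChart π) {m : ℕ} {φ χ : ℝ → E} {t t' : ℝ}
    (hφ : IsLocalSection π φ t) (hχ : IsLocalSection π χ t')
    (hφc : φ t ∈ c.chart.source) (hχc : χ t' ∈ c.chart.source)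
    (h : c.coords m (Jet.mk m φ t hφ) = c.coords m (Jet.mk m χ t' hχ)) :
    Jet.mk m φ t hφ = Jet.mk m χ t' hχ := by
  have h0 : c.chart (φ t) = c.chart (χ t') := by
    rw [← c.fst_coords hφ hφc (m := m), ← c.fst_coords hχ hχc (m := m), h]
  rw [c.coords_mk m hφ hφc, c.coords_mk m hχ hχc] at h
  obtain ⟨h1, h2⟩ := Prod.ext_iff.1 h
  dsimp only at h1 h2
  subst h1
  have h3 : φ t = χ t := c.chart.injOn hφc hχc h0
  refine Quotient.sound ⟨rfl, h3, ?_⟩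
  have hs : φ t ∈ (chartAt (EuclideanSpace ℝ (Fin (n + 1))) (φ t)).source := mem_chart_source _ _
  refine iteratedDeriv_chart_congr c.chart _ hφ.contMDiffAt.continuousAt
    hχ.contMDiffAt.continuousAt hφc hχc (c.contDiffAt_comp hφ hφc) (c.contDiffAt_comp hχ hχc)
    (c.contDiffAt_chartAt_comp_symm _ hs hφc) fun i hi => ?_
  rw [iteratedDeriv_fst_snd (c.contDiffAt_comp hφ hφc),
    iteratedDeriv_fst_snd (c.contDiffAt_comp hχ hχc)]
  have e1 : ∀ {f : ℝ → E}, IsLocalSection π f t → f t ∈ c.chart.source →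
      (fun s => ((c.chart ∘ f) s).1) =ᶠ[𝓝 t] fun s => s := by
    intro f hf hft
    filter_upwards [hf, hf.contMDiffAt.continuousAt.preimage_mem_nhds
      (c.chart.open_source.mem_nhds hft)] with s hs hs'
    simp [c.fst_eq _ hs', hs.1]
  refine Prod.ext ?_ ?_
  · dsimp only
    rw [(e1 hφ hφc).iteratedDeriv_eq, (e1 hχ hχc).iteratedDeriv_eq]
  · exact congrFun h2 ⟨i, by omega⟩

/-- The jet with given natural coordinates. -/
def jetOfCoords (c : AdaptedChart π) {m : ℕ} (x : JetModel n m)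
    (hx : ((x.1, x.2 0) : BaseModel n) ∈ c.chart.target) : Jet π m :=
  Jet.mk m (fun s => c.chart.symm (taylorCurve x s)) x.1 (c.isLocalSection_taylor hx)

open Classical in
/-- Extension of `jetOfCoords` by a constant junk value. -/
def ofCoords (c : AdaptedChart π) {m : ℕ} (j₀ : Jet π m) (x : JetModel n m) : Jet π m :=
  if hx : ((x.1, x.2 0) : BaseModel n) ∈ c.chart.target then
    c.jetOfCoords x hx
  else j₀

/-- The natural chart of `J^m π` induced by an adapted chart of `E`. -/
def jetChart (c : AdaptedChart π) {m : ℕ} (j₀ : Jet π m) :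
    PartialEquiv (Jet π m) (JetModel n m) where
  toFun := c.coords m
  invFun := c.ofCoords j₀
  source := {j | j.toTotal ∈ c.chart.source}
  target := {x | ((x.1, x.2 0) : BaseModel n) ∈ c.chart.target}
  map_source' := by
    intro j hj
    obtain ⟨φ, t, h, rfl⟩ := j.exists_rep
    have := c.fst_coords (m := m) h hj
    change ((c.coords m (Jet.mk m φ t h)).1, (c.coords m (Jet.mk m φ t h)).2 0) ∈ c.chart.target
    rw [this]
    exact c.chart.map_source hj
  map_target' := by
    intro x hx
    have hx' : ((x.1, x.2 0) : BaseModel n) ∈ c.chart.target := hx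
    change (c.ofCoords j₀ x).toTotal ∈ c.chart.source
    rw [ofCoords, dif_pos hx']
    change c.chart.symm (taylorCurve x x.1) ∈ c.chart.source
    rw [taylorCurve_self]; exact c.chart.map_target hx
  left_inv' := by
    intro j hj
    obtain ⟨φ, t, h, rfl⟩ := j.exists_rep
    have h1 := c.fst_coords (m := m) h hj
    have h2 : (((c.coords m (Jet.mk m φ t h)).1, (c.coords m (Jet.mk m φ t h)).2 0) : BaseModel n)
        ∈ c.chart.target := h1 ▸ c.chart.map_source hj
    rw [ofCoords, dif_pos h2]
    refine c.mk_eq_of_coords _ _ ?_ hj (c.coords_taylor h2)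
    rw [taylorCurve_self]; exact c.chart.map_target h2
  right_inv' := by
    intro x hx
    have hx' : ((x.1, x.2 0) : BaseModel n) ∈ c.chart.target := hx
    rw [ofCoords, dif_pos hx']
    exact c.coords_taylor hx'

theorem isOpen_transition (c c' : AdaptedChart π) {m : ℕ} (j₀ j₀' : Jet π m) :
    IsOpen ((c.jetChart j₀).symm.trans (c'.jetChart j₀')).source := by
  have : ((c.jetChart j₀).symm.trans (c'.jetChart j₀')).source =
      (fun x : JetModel n m => ((x.1, x.2 0) : BaseModel n)) ⁻¹'
        (c.chart.symm.trans c'.chart).source := by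
    ext x
    simp only [PartialEquiv.trans_source, PartialEquiv.symm_source, mem_inter_iff, mem_preimage,
      OpenPartialHomeomorph.trans_source, OpenPartialHomeomorph.symm_source]
    refine and_congr_right fun hx => ?_
    have hx' : ((x.1, x.2 0) : BaseModel n) ∈ c.chart.target := hx
    change (c.ofCoords j₀ x).toTotal ∈ c'.chart.source ↔ _
    rw [ofCoords, dif_pos hx']
    change c.chart.symm (taylorCurve x x.1) ∈ _ ↔ _
    rw [taylorCurve_self]
  rw [this]
  exact (c.chart.symm.trans c'.chart).open_source.preimage (by fun_prop)

theorem contDiffOn_transition (c c' : AdaptedChart π) {m : ℕ} (j₀ j₀' : Jet π m) :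
    ContDiffOn ℝ ∞ ((c.jetChart j₀).symm.trans (c'.jetChart j₀'))
      ((c.jetChart j₀).symm.trans (c'.jetChart j₀')).source := by
  set T := c.chart.symm.trans c'.chart with hT
  have hTsm : ContDiffOn ℝ ∞ T T.source := by
    have h1 : ContMDiffOn 𝓘(ℝ, BaseModel n) 𝓘(ℝ, BaseModel n) ∞ T T.source := by
      refine c'.smooth.comp (c.smooth_symm.mono ?_) ?_
      · intro x hx; simp [hT] at hx; exact hx.1
      · intro x hx; simp [hT] at hx; exact hx.2
    exact contMDiffOn_iff_contDiffOn.1 h1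
  set U : Set (JetModel n m × ℝ) := (fun p => taylorCurve p.1 p.2) ⁻¹' T.source with hU
  have hUo : IsOpen U := T.open_source.preimage (contDiff_taylorCurve n m).continuous
  have hG : ContDiffOn ℝ ∞ (fun p : JetModel n m × ℝ => (T (taylorCurve p.1 p.2)).2) U :=
    contDiff_snd.comp_contDiffOn
      (hTsm.comp (contDiff_taylorCurve n m).contDiffOn (fun p hp => hp))
  have hmain : ContDiffOn ℝ ∞ (fun x : JetModel n m => ((x.1, fun i : Fin (m + 1) =>
      iteratedDeriv (i : ℕ) (fun s => (T (taylorCurve x s)).2) x.1) : JetModel n m))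
      ((fun x : JetModel n m => (x, x.1)) ⁻¹' U) := by
    refine contDiff_fst.contDiffOn.prodMk (contDiffOn_pi.2 fun i => ?_)
    have h4 := contDiffOn_iteratedDeriv_param hUo hG (i : ℕ)
    have h5 : ContDiff ℝ ∞ (fun x : JetModel n m => ((x, x.1) : JetModel n m × ℝ)) := by fun_prop
    exact ContDiffOn.comp (f := fun x : JetModel n m => ((x, x.1) : JetModel n m × ℝ))
      (g := fun p : JetModel n m × ℝ =>
        iteratedDeriv (i : ℕ) (fun s => (T (taylorCurve p.1 s)).2) p.2)
      h4 h5.contDiffOn (fun x hx => hx)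
  have hsrc : ∀ x ∈ ((c.jetChart j₀).symm.trans (c'.jetChart j₀')).source,
      ∃ hx : ((x.1, x.2 0) : BaseModel n) ∈ c.chart.target,
        c.chart.symm (x.1, x.2 0) ∈ c'.chart.source := by
    intro x hx
    simp only [PartialEquiv.trans_source, PartialEquiv.symm_source, mem_inter_iff,
      mem_preimage] at hx
    obtain ⟨hx1, hx2⟩ := hx
    have hx' : ((x.1, x.2 0) : BaseModel n) ∈ c.chart.target := hx1
    refine ⟨hx', ?_⟩
    change (c.ofCoords j₀ x).toTotal ∈ c'.chart.source at hx2
    rw [ofCoords, dif_pos hx'] at hx2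
    change c.chart.symm (taylorCurve x x.1) ∈ _ at hx2
    rwa [taylorCurve_self] at hx2
  refine (hmain.mono fun x hx => ?_).congr fun x hx => ?_
  · obtain ⟨h1, h2⟩ := hsrc x hx
    simp [hU, hT, taylorCurve_self, h1, h2]
  · obtain ⟨h1, h2⟩ := hsrc x hx
    change c'.coords m (c.ofCoords j₀ x) = _
    rw [ofCoords, dif_pos h1, jetOfCoords, c'.coords_mk]
    · rfl
    · rw [taylorCurve_self]; exact h2

end AdaptedChart

variable (π) in
/-- A chosen adapted chart around a point. -/
def adaptedChartAt [IsManifold (𝓡 (n + 1)) ∞ E] (e : E) : AdaptedChart π :=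
  (exists_adaptedChart π e).choose

variable [IsManifold (𝓡 (n + 1)) ∞ E]

theorem mem_adaptedChartAt_source (e : E) : e ∈ (adaptedChartAt π e).chart.source :=
  (exists_adaptedChart π e).choose_spec

/-! ### The smooth manifold `J^m π` -/

variable (π) in
/-- The natural charts form an atlas of `J^m π`. -/
def jetCore (m : ℕ) : ChartedSpaceCore (JetModel n m) (Jet π m) where
  atlas := {e | ∃ (c : AdaptedChart π) (j : Jet π m), e = c.jetChart j}
  chartAt j := (adaptedChartAt π j.toTotal).jetChart j
  mem_chart_source j := mem_adaptedChartAt_source j.toTotal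
  chart_mem_atlas j := ⟨_, _, rfl⟩
  open_source := by
    rintro _ _ ⟨c, j, rfl⟩ ⟨c', j', rfl⟩
    exact c.isOpen_transition c' j j'
  continuousOn_toFun := by
    rintro _ _ ⟨c, j, rfl⟩ ⟨c', j', rfl⟩
    exact (c.contDiffOn_transition c' j j').continuousOn

instance (m : ℕ) : TopologicalSpace (Jet π m) := (jetCore π m).toTopologicalSpace

instance (m : ℕ) : ChartedSpace (JetModel n m) (Jet π m) := (jetCore π m).toChartedSpace

instance (m : ℕ) : IsManifold 𝓘(ℝ, JetModel n m) ∞ (Jet π m) := by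
  refine isManifold_of_contDiffOn _ _ _ ?_
  rintro e e' he he'
  change e ∈ ⋃ (e : PartialEquiv (Jet π m) (JetModel n m)) (he : e ∈ (jetCore π m).atlas),
    {(jetCore π m).openPartialHomeomorph e he} at he
  change e' ∈ ⋃ (e : PartialEquiv (Jet π m) (JetModel n m)) (he : e ∈ (jetCore π m).atlas),
    {(jetCore π m).openPartialHomeomorph e he} at he'
  simp only [mem_iUnion, mem_singleton_iff] at he he'
  obtain ⟨_, ⟨c, j, rfl⟩, rfl⟩ := he
  obtain ⟨_, ⟨c', j', rfl⟩, rfl⟩ := he'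
  have := c.contDiffOn_transition c' j j'
  simp only [modelWithCornersSelf_coe, modelWithCornersSelf_coe_symm, Function.id_comp,
    Function.comp_id, preimage_id, range_id, inter_univ]
  exact this

/-! ### Sections, prolongations, vector fields -/

variable (π) in
/-- A smooth global section. -/
structure GlobalSection where
  toFun : ℝ → E
  contMDiff : ContMDiff 𝓘(ℝ, ℝ) (𝓡 (n + 1)) ∞ toFun
  proj_eq : ∀ t, π.proj (toFun t) = t

theorem GlobalSection.isLocalSection (φ : GlobalSection π) (t : ℝ) :
    IsLocalSection π φ.toFun t :=
  Eventually.of_forall fun s => ⟨φ.proj_eq s, φ.contMDiff s⟩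

/-- The canonical lifting `j^m φ : ℝ → J^m π`. -/
def GlobalSection.prolong (φ : GlobalSection π) (m : ℕ) (t : ℝ) : Jet π m :=
  Jet.mk m φ.toFun t (φ.isLocalSection t)

section VectorFields

variable {m : ℕ}

/-- The canonical lifting `ψ' : ℝ → T(J^m π)` of a curve. -/
def velocity (ψ : ℝ → Jet π m) (t : ℝ) : TangentSpace 𝓘(ℝ, JetModel n m) (ψ t) :=
  mfderiv 𝓘(ℝ, ℝ) 𝓘(ℝ, JetModel n m) ψ t (1 : ℝ)

/-- `X` is a smooth vector field on `J^m π`. -/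
def IsSmoothVectorField (X : (p : Jet π m) → TangentSpace 𝓘(ℝ, JetModel n m) p) : Prop :=
  ContMDiff 𝓘(ℝ, JetModel n m) 𝓘(ℝ, JetModel n m).tangent ∞
    (fun p => (⟨p, X p⟩ : TangentBundle 𝓘(ℝ, JetModel n m) (Jet π m)))

/-- A curve in `J^m π` is holonomic (of type 1) on `s`: it is the canonical lifting `j^m φ` of its
projection `φ` to `E`. -/
def IsHolonomicOn (ψ : ℝ → Jet π m) (s : Set ℝ) : Prop :=
  ∀ t ∈ s, ∃ h : IsLocalSection π (fun u => (ψ u).toTotal) t, ψ t = Jet.mk m _ t h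

/-- `ψ` is on `s` an integral section of `X`, up to parametrization: a section of `J^m π → ℝ` whose
velocity is proportional to `X`. (If moreover `dt(X) = 1`, it is an integral curve of `X`.) -/
def IsIntegralSectionOn (X : (p : Jet π m) → TangentSpace 𝓘(ℝ, JetModel n m) p)
    (ψ : ℝ → Jet π m) (s : Set ℝ) : Prop :=
  ∀ t ∈ s, (ψ t).time = t ∧ ∃ g : ℝ, HasMFDerivAt 𝓘(ℝ, ℝ) 𝓘(ℝ, JetModel n m) ψ t
    ((1 : ℝ →L[ℝ] ℝ).smulRight (g • X (ψ t)))

/-- `X` is a semispray of type 1: all its integral sections, defined on arbitrary open intervals,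
are holonomic. -/
def IsSemispray (X : (p : Jet π m) → TangentSpace 𝓘(ℝ, JetModel n m) p) : Prop :=
  ∀ (a b : ℝ) (ψ : ℝ → Jet π m), IsIntegralSectionOn X ψ (Ioo a b) → IsHolonomicOn ψ (Ioo a b)

/-- `X` is transverse to the projection `J^m π → ℝ`: the contraction of `X` with the pull-back of
`dt` vanishes nowhere. -/
def IsTransverse (X : (p : Jet π m) → TangentSpace 𝓘(ℝ, JetModel n m) p) : Prop :=
  ∀ p : Jet π m, mfderiv 𝓘(ℝ, JetModel n m) 𝓘(ℝ, ℝ) (Jet.time : Jet π m → ℝ) p (X p) ≠ 0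

end VectorFields

/-- The interior product `i(v) β = β(v, ·)` of a vector and a 2-form on a vector space. -/
def interiorProduct {M : Type*} [AddCommGroup M] [Module ℝ M] [TopologicalSpace M]
    (v : M) (β : M [⋀^Fin 2]→L[ℝ] ℝ) : M →L[ℝ] ℝ :=
  β.toContinuousMultilinearMap.toContinuousLinearMap ![v, 0] 1

theorem interiorProduct_apply {M : Type*} [AddCommGroup M] [Module ℝ M] [TopologicalSpace M]
    (v w : M) (β : M [⋀^Fin 2]→L[ℝ] ℝ) : interiorProduct v β w = β ![v, w] := by
  have : Function.update ![v, 0] 1 w = ![v, w] := by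
    funext i; fin_cases i <;> simp
  simp [interiorProduct, this]

/-- The pull-back `ψ^* α` of a 1-form on `J^m π` by a curve, as a 1-form on `ℝ`. -/
def pullbackCurve {m : ℕ} (ψ : ℝ → Jet π m)
    (α : (p : Jet π m) → TangentSpace 𝓘(ℝ, JetModel n m) p →L[ℝ] ℝ) (t : ℝ) :
    TangentSpace 𝓘(ℝ, ℝ) t →L[ℝ] ℝ :=
  (α (ψ t)).comp (mfderiv 𝓘(ℝ, ℝ) 𝓘(ℝ, JetModel n m) ψ t)

/-! ### Differential calculus in natural coordinates -/

section Coordinates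

variable {n m : ℕ}

/-- The coordinates `q_i = (q_i^A)_A` of a point (`0` for `i > m`). -/
def coordQ (x : JetModel n m) (i : ℕ) : Fin n → ℝ :=
  if h : i < m + 1 then x.2 ⟨i, h⟩ else 0

/-- The projection `(t, q_0, …, q_m) ↦ (t, q_0, …, q_m')`, for `m' ≤ m`. -/
def truncate (m' : ℕ) (x : JetModel n m) : JetModel n m' :=
  (x.1, fun i => coordQ x i)

/-- The coordinate vector `∂/∂q_i^A`. -/
def vecQ (i : ℕ) (A : Fin n) : JetModel n m :=
  (0, fun j => if (j : ℕ) = i then Pi.single A 1 else 0)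

/-- The partial derivative `∂f/∂q_i^A`. -/
def partialQ (f : JetModel n m → ℝ) (i : ℕ) (A : Fin n) (x : JetModel n m) : ℝ :=
  fderiv ℝ f x (vecQ i A)

/-- The total time derivative `d_T f = ∂f/∂t + ∑ i, q_{i+1}^A ∂f/∂q_i^A`, a function of
`(t, q_0, …, q_{m+1})`. -/
def totalDeriv (f : JetModel n m → ℝ) (x : JetModel n (m + 1)) : ℝ :=
  fderiv ℝ f (truncate m x) (1, fun i => coordQ x (i + 1))

/-- The iterated total time derivative `d_T^i f`, a function of `(t, q_0, …, q_{m+i})`. -/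
def iterTotalDeriv (f : JetModel n m → ℝ) : (i : ℕ) → JetModel n (m + i) → ℝ
  | 0 => f
  | i + 1 => totalDeriv (iterTotalDeriv f i)

variable (n m) in
/-- The coordinate 1-form `dt`. -/
def formT : JetModel n m →L[ℝ] ℝ := ContinuousLinearMap.fst ℝ ℝ (Fin (m + 1) → Fin n → ℝ)

variable (m) in
/-- The coordinate 1-form `dq_i^A` (`0` for `i > m`). -/
def formQ (i : ℕ) (A : Fin n) : JetModel n m →L[ℝ] ℝ :=
  if h : i < m + 1 then
    ((ContinuousLinearMap.proj A : (Fin n → ℝ) →L[ℝ] ℝ).comp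
      (ContinuousLinearMap.proj (⟨i, h⟩ : Fin (m + 1)))).comp
        (ContinuousLinearMap.snd ℝ ℝ (Fin (m + 1) → Fin n → ℝ))
  else 0

/-- The momentum function
`p_A^{r-1} = ∑_{i=0}^{k-r} (-1)^i d_T^i (∂f/∂q_{r+i}^A)` of `(t, q_0, …, q_{2k-1})`. -/
def momentum {k : ℕ} (f : JetModel n k → ℝ) (r : ℕ) (A : Fin n) (x : JetModel n (2 * k - 1)) : ℝ :=
  ∑ i ∈ Finset.range (k - r + 1),
    (-1) ^ i * iterTotalDeriv (partialQ f (r + i) A) i (truncate (k + i) x)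

/-- The Poincaré-Cartan 1-form
`∑_{r=1}^k p_A^{r-1} (dq_{r-1}^A - q_r^A dt) + f dt` in natural coordinates. -/
def localPoincareCartan {k : ℕ} (f : JetModel n k → ℝ) (x : JetModel n (2 * k - 1)) :
    JetModel n (2 * k - 1) →L[ℝ] ℝ :=
  ∑ r ∈ Finset.Icc 1 k, ∑ A : Fin n,
    momentum f r A x • (formQ (2 * k - 1) (r - 1) A - coordQ x r A • formT n (2 * k - 1))
  + f (truncate k x) • formT n (2 * k - 1)

/-- The Poincaré-Cartan 2-form `Ω = -dΘ` in natural coordinates. -/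
def localPoincareCartan₂ {k : ℕ} (f : JetModel n k → ℝ) (x : JetModel n (2 * k - 1)) :
    JetModel n (2 * k - 1) [⋀^Fin 2]→L[ℝ] ℝ :=
  -extDeriv (fun y => ContinuousAlternatingMap.ofSubsingleton ℝ (JetModel n (2 * k - 1)) ℝ
    (0 : Fin 1) (localPoincareCartan f y)) x

end Coordinates

/-! ### Lagrangian dynamics -/

open Classical in
/-- The expression of a function on `J^m π` in natural coordinates. -/
def AdaptedChart.localRep (c : AdaptedChart π) {m : ℕ} (f : Jet π m → ℝ) (x : JetModel n m) : ℝ :=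
  if hx : ((x.1, x.2 0) : BaseModel n) ∈ c.chart.target then f (c.jetOfCoords x hx) else 0

/-- The Poincaré-Cartan 2-form `Ω_L` on `J^{2k-1} π` of the Lagrangian density `L dt`: around each
point it is the pull-back, by natural coordinates, of its coordinate expression (which does not
depend on the natural coordinates chosen). -/
def poincareCartan₂ {k : ℕ} (L : Jet π k → ℝ) (p : Jet π (2 * k - 1)) :
    TangentSpace 𝓘(ℝ, JetModel n (2 * k - 1)) p [⋀^Fin 2]→L[ℝ] ℝ :=
  let c := adaptedChartAt π p.toTotal
  (localPoincareCartan₂ (c.localRep L) (c.coords (2 * k - 1) p)).compContinuousLinearMap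
    (mfderiv 𝓘(ℝ, JetModel n (2 * k - 1)) 𝓘(ℝ, JetModel n (2 * k - 1)) (c.coords (2 * k - 1)) p)

/-- The `k`-th order Euler-Lagrange equations
`∑_{i=0}^k (-1)^i (d/dt)^i (∂L/∂q_i^A ∘ j^k φ) = 0`, in all natural coordinates. -/
def EulerLagrange {k : ℕ} (L : Jet π k → ℝ) (φ : GlobalSection π) : Prop :=
  ∀ (c : AdaptedChart π) (t : ℝ), φ.toFun t ∈ c.chart.source → ∀ A : Fin n,
    ∑ i ∈ Finset.range (k + 1), (-1) ^ i *
      iteratedDeriv i (fun s => partialQ (c.localRep L) i A (c.coords k (φ.prolong k s))) t = 0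

/-- Regularity of the Lagrangian: in natural coordinates the Hessian matrix
`∂²L/∂q_k^B∂q_k^A` is nonsingular at every point of `J^k π`. -/
def IsRegularLagrangian {k : ℕ} (L : Jet π k → ℝ) : Prop :=
  ∀ (c : AdaptedChart π) (p : Jet π k), p.toTotal ∈ c.chart.source →
    (Matrix.of fun A B : Fin n =>
      partialQ (partialQ (c.localRep L) k B) k A (c.coords k p)).det ≠ 0

end JetBundle

end

open JetBundle

noncomputable section

namespace JetBundle

/-! ### Calculus on the coordinate spaces of jets -/

section CoordinateCalculus

variable {n m k : ℕ}

/-! Everything reduces to a pointwise statement about vectors `v = ∂_t + ∑ q_{i+1} ∂/∂q_i + u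
∂/∂q_{2k-1}` (`sprayVec`, and without charts `IsSprayVector`): these are the velocities of
prolongations of local sections. Such a `v` differentiates functions of order below `2k-1` as `d_T`
does. Hence the momenta satisfy `p_A^{j-1} + v(p_A^j) = ∂L/∂q_j^A` for `0 < j < k`, while `p_A^{k-1}
= ∂L/∂q_k^A`. Inserted in `-dΘ`, this recursion cancels all terms except those of order zero
(`localPoincareCartan₂_sprayVec`): `Ω(v, w) = ∑_A E_A · (dq_0^A - q_1^A dt)(w)`, with `E_A =
∂L/∂q_0^A - v(p_A^0)`. Along a prolongation `E_A` is the Euler-Lagrange expression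
(`eulerLagrangeCurve_eq`), so its velocity lies in the kernel of `Ω` exactly when the equations hold
there.

The form `Ω` is read in one chosen chart at each point, whereas the equations are required in all
charts. The bridge is the covariance `eulerLagrangeCurve_of_jetRelated`: under a change of fibre
coordinates the Euler-Lagrange expressions transform linearly. It is proved by varying a curve by a
Taylor monomial and by the formal adjoint identity `sum_choose_iteratedDeriv_mul`. Together with the
contraction formula it gives `interiorProduct_eq_zero_iff`, valid in any chart, hence the
equivalence of assertions 2 and 3.

Assertions 1 and 3 are equivalent by antisymmetry of `Ω`, since every tangent vector extends to a
smooth vector field. For assertion 4, spray vectors at a point form an affine space, so a partition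
of unity yields a smooth field of spray vectors with prescribed values, the velocities of `ψ_L`,
along the closed image of `ψ_L` (`exists_isSprayVector_field`). Any smooth field of spray vectors is
a transverse semispray (`isTransverse_of_isSprayVector`, `isSemispray_of_isSprayVector`).

In the regular case `E_A` is affine in `u` with linear part the Hessian up to sign. The equations
`E_A = 0` then have one solution `u`, smooth in the point by Cramer's rule, so each point carries
exactly one spray vector in the kernel of `Ω` (`IsRegularLagrangian.exists_field`). By uniqueness
the resulting field restricts to the velocity of every solution. -/

/-- The coordinates of `m`-jets over an open set of the base. -/
def jetDomain (U : Set (BaseModel n)) (m : ℕ) : Set (JetModel n m) :=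
  {x | ((x.1, x.2 0) : BaseModel n) ∈ U}

theorem isOpen_jetDomain {U : Set (BaseModel n)} (hU : IsOpen U) (m : ℕ) :
    IsOpen (jetDomain U m) :=
  hU.preimage (f := fun x : JetModel n m => ((x.1, x.2 0) : BaseModel n)) (by fun_prop)

/-- The projection `x ↦ q_i` as a continuous linear map. -/
def coordQL (n m i : ℕ) : JetModel n m →L[ℝ] (Fin n → ℝ) :=
  if h : i < m + 1 then
    (ContinuousLinearMap.proj (⟨i, h⟩ : Fin (m + 1))).comp
      (ContinuousLinearMap.snd ℝ ℝ (Fin (m + 1) → Fin n → ℝ))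
  else 0

theorem coordQL_apply (i : ℕ) (x : JetModel n m) : coordQL n m i x = coordQ x i := by
  unfold coordQL coordQ
  split_ifs <;> simp

/-- The truncation of jets as a continuous linear map. -/
def truncateL (n m m' : ℕ) : JetModel n m →L[ℝ] JetModel n m' :=
  (ContinuousLinearMap.fst ℝ ℝ (Fin (m + 1) → Fin n → ℝ)).prod
    (ContinuousLinearMap.pi fun i => coordQL n m i)

theorem coe_truncateL (m' : ℕ) : ⇑(truncateL n m m') = truncate m' := by
  funext x
  refine Prod.ext rfl (funext fun i => coordQL_apply _ _)

theorem truncateL_apply (m' : ℕ) (x : JetModel n m) : truncateL n m m' x = truncate m' x :=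
  congrFun (coe_truncateL m') x

theorem contDiff_truncate (m' : ℕ) {r : ℕ∞ω} :
    ContDiff ℝ r (truncate m' : JetModel n m → JetModel n m') := by
  rw [← coe_truncateL]; exact (truncateL n m m').contDiff

theorem contDiff_coordQ (i : ℕ) {r : ℕ∞ω} :
    ContDiff ℝ r (fun x : JetModel n m => coordQ x i) := by
  simp_rw [← coordQL_apply]; exact (coordQL n m i).contDiff

theorem coordQ_coe (x : JetModel n m) (i : Fin (m + 1)) : coordQ x i = x.2 i := by
  simp [coordQ, i.2]

theorem coordQ_of_le (x : JetModel n m) {i : ℕ} (h : i ≤ m) :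
    coordQ x i = x.2 ⟨i, Nat.lt_succ_of_le h⟩ := by
  simp [coordQ, Nat.lt_succ_of_le h]

theorem coordQ_zero (x : JetModel n m) : coordQ x 0 = x.2 0 :=
  coordQ_of_le x (Nat.zero_le m)

theorem coordQ_of_lt (x : JetModel n m) {i : ℕ} (h : m < i) : coordQ x i = 0 := by
  simp [coordQ, show ¬ i < m + 1 by omega]

theorem coordQ_truncate {m' i : ℕ} (x : JetModel n m) (h : i ≤ m') :
    coordQ (truncate m' x) i = coordQ x i := by
  rw [coordQ_of_le _ h]; rfl

theorem truncate_truncate {m' l : ℕ} (x : JetModel n m) (h : l ≤ m') :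
    truncate l (truncate m' x) = truncate l x :=
  Prod.ext rfl (funext fun i => coordQ_truncate x (by omega))

theorem truncate_self (x : JetModel n m) : truncate m x = x :=
  Prod.ext rfl (funext fun i => coordQ_coe x i)

theorem truncate_mem_jetDomain {U : Set (BaseModel n)} {x : JetModel n m}
    (hx : x ∈ jetDomain U m) (m' : ℕ) : truncate m' x ∈ jetDomain U m' := by
  change (x.1, coordQ x ((0 : Fin (m' + 1)) : ℕ)) ∈ U
  rw [Fin.val_zero, coordQ_zero]; exact hx

theorem coordQ_vecQ (i j : ℕ) (A : Fin n) :
    coordQ (vecQ j A : JetModel n m) i = if i ≤ m ∧ i = j then Pi.single A 1 else 0 := by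
  by_cases h : i ≤ m
  · simp [coordQ_of_le _ h, vecQ, h]
  · simp [coordQ_of_lt _ (not_le.1 h), h]

theorem truncate_vecQ {m' j : ℕ} (A : Fin n) (h : m' ≤ m) :
    truncate m' (vecQ j A : JetModel n m) = vecQ j A := by
  refine Prod.ext rfl (funext fun i => ?_)
  change coordQ (vecQ j A : JetModel n m) i = _
  rw [coordQ_vecQ]
  simp [vecQ, show (i : ℕ) ≤ m by omega]

theorem vecQ_of_lt {j : ℕ} (A : Fin n) (h : m < j) : (vecQ j A : JetModel n m) = 0 :=
  Prod.ext rfl (funext fun i => by simp [vecQ, show (i : ℕ) ≠ j by omega])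

/-- The derivative `∂_t + ∑_{i<m} q_{i+1} ∂/∂q_i + u ∂/∂q_m` of the prolongation of a curve. -/
def sprayVec (x : JetModel n m) (u : Fin n → ℝ) : JetModel n m :=
  (1, fun i => if (i : ℕ) < m then coordQ x (i + 1) else u)

theorem sprayVec_fst (x : JetModel n m) (u : Fin n → ℝ) : (sprayVec x u).1 = 1 := rfl

theorem coordQ_sprayVec_of_lt (x : JetModel n m) (u : Fin n → ℝ) {i : ℕ} (h : i < m) :
    coordQ (sprayVec x u) i = coordQ x (i + 1) := by
  rw [coordQ_of_le _ h.le]; simp [sprayVec, h]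

theorem coordQ_sprayVec_self (x : JetModel n m) (u : Fin n → ℝ) :
    coordQ (sprayVec x u) m = u := by
  rw [coordQ_of_le _ le_rfl]; simp [sprayVec]

/-- Isolates the affine dependence on the highest derivative, so that the coefficient of `u` in the
Euler-Lagrange expression can be read off. -/
theorem sprayVec_eq_add_sum (x : JetModel n m) (u : Fin n → ℝ) :
    sprayVec x u = sprayVec x 0 + ∑ B, u B • (vecQ m B : JetModel n m) := by
  refine Prod.ext ?_ (funext fun i => funext fun A => ?_)
  · simp [sprayVec, vecQ, Prod.fst_sum]
  · by_cases h : (i : ℕ) < m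
    · simp [sprayVec, vecQ, Prod.snd_sum, Finset.sum_apply, h, h.ne]
    · have : (i : ℕ) = m := by omega
      simp [sprayVec, vecQ, Prod.snd_sum, Finset.sum_apply, this, Pi.single_apply]

theorem contDiff_sprayVec {r : ℕ∞ω} :
    ContDiff ℝ r (fun p : JetModel n m × (Fin n → ℝ) => sprayVec p.1 p.2) := by
  refine contDiff_const.prodMk (contDiff_pi.2 fun i => ?_)
  by_cases h : (i : ℕ) < m
  · simp only [h, if_true]
    exact (contDiff_coordQ _).comp contDiff_fst
  · simp only [h, if_false]
    exact contDiff_snd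

theorem sprayVec_add_smul (x : JetModel n m) (u v : Fin n → ℝ) {a b : ℝ} (hab : a + b = 1) :
    a • sprayVec x u + b • sprayVec x v = sprayVec x (a • u + b • v) := by
  refine Prod.ext (by simp [sprayVec, hab]) (funext fun i => ?_)
  by_cases h : (i : ℕ) < m
  · simp [sprayVec, h, ← add_smul, hab]
  · simp [sprayVec, h]

/-! #### Smoothness -/

variable {U : Set (BaseModel n)}

theorem contDiffOn_partialQ (hU : IsOpen U) {f : JetModel n m → ℝ}
    (hf : ContDiffOn ℝ ∞ f (jetDomain U m)) (i : ℕ) (A : Fin n) :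
    ContDiffOn ℝ ∞ (partialQ f i A) (jetDomain U m) :=
  (hf.fderiv_of_isOpen (m := ∞) (isOpen_jetDomain hU m) (by simp)).clm_apply contDiffOn_const

theorem contDiffOn_totalDeriv (hU : IsOpen U) {f : JetModel n m → ℝ}
    (hf : ContDiffOn ℝ ∞ f (jetDomain U m)) :
    ContDiffOn ℝ ∞ (totalDeriv f) (jetDomain U (m + 1)) := by
  have h1 := hf.fderiv_of_isOpen (m := ∞) (isOpen_jetDomain hU m) (by simp)
  refine (h1.comp (contDiff_truncate m).contDiffOn
    fun x hx => truncate_mem_jetDomain hx m).clm_apply ?_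
  exact (contDiff_const.prodMk (contDiff_pi.2 fun i => contDiff_coordQ _)).contDiffOn

theorem contDiffOn_iterTotalDeriv (hU : IsOpen U) {f : JetModel n m → ℝ}
    (hf : ContDiffOn ℝ ∞ f (jetDomain U m)) (i : ℕ) :
    ContDiffOn ℝ ∞ (iterTotalDeriv f i) (jetDomain U (m + i)) := by
  induction i with
  | zero => exact hf
  | succ i ih => exact contDiffOn_totalDeriv hU ih

theorem contDiffOn_comp_truncate {f : JetModel n k → ℝ}
    (hf : ContDiffOn ℝ ∞ f (jetDomain U k)) :
    ContDiffOn ℝ ∞ (fun x : JetModel n m => f (truncate k x)) (jetDomain U m) :=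
  hf.comp (contDiff_truncate k).contDiffOn fun _ hx => truncate_mem_jetDomain hx k

theorem contDiffOn_momentum (hU : IsOpen U) {f : JetModel n k → ℝ}
    (hf : ContDiffOn ℝ ∞ f (jetDomain U k)) (r : ℕ) (A : Fin n) :
    ContDiffOn ℝ ∞ (momentum f r A) (jetDomain U (2 * k - 1)) :=
  ContDiffOn.sum fun i _ => contDiffOn_const.mul
    (contDiffOn_comp_truncate
      (contDiffOn_iterTotalDeriv hU (contDiffOn_partialQ hU hf (r + i) A) i))

theorem differentiableAt_of_jetDomain (hU : IsOpen U) {W : Type*} [NormedAddCommGroup W]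
    [NormedSpace ℝ W] {f : JetModel n m → W}
    (hf : ContDiffOn ℝ ∞ f (jetDomain U m)) {x : JetModel n m} (hx : x ∈ jetDomain U m) :
    DifferentiableAt ℝ f x :=
  (hf.contDiffAt ((isOpen_jetDomain hU m).mem_nhds hx)).differentiableAt (by simp)

theorem fderiv_comp_truncate {f : JetModel n k → ℝ} {x : JetModel n m}
    (hf : DifferentiableAt ℝ f (truncate k x)) (v : JetModel n m) :
    fderiv ℝ (fun y : JetModel n m => f (truncate k y)) x v
      = fderiv ℝ f (truncate k x) (truncate k v) := by
  have h : HasFDerivAt (truncate k : JetModel n m → JetModel n k) (truncateL n m k) x := by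
    have := (truncateL n m k).hasFDerivAt (x := x)
    rwa [coe_truncateL] at this
  have h' : HasFDerivAt (fun y : JetModel n m => f (truncate k y)) _ x := hf.hasFDerivAt.comp x h
  rw [h'.fderiv, ContinuousLinearMap.comp_apply, truncateL_apply]

/-! #### The momenta along the Cartan distribution -/

theorem truncate_sprayVec {m' : ℕ} (x : JetModel n m) (u : Fin n → ℝ) (h : m' < m) :
    truncate m' (sprayVec x u)
      = (1, fun i : Fin (m' + 1) => coordQ (truncate (m' + 1) x) (i + 1)) := by
  refine Prod.ext rfl (funext fun i => ?_)
  change coordQ (sprayVec x u) i = coordQ (truncate (m' + 1) x) (i + 1)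
  rw [coordQ_sprayVec_of_lt _ _ (by omega), coordQ_truncate _ (by omega)]

/-- A function of order `k + i < m` does not see the last component `u`, and on the remaining
components `sprayVec` is the vector that defines `d_T`. -/
theorem fderiv_iterTotalDeriv_sprayVec (hU : IsOpen U) {g : JetModel n k → ℝ}
    (hg : ContDiffOn ℝ ∞ g (jetDomain U k)) {x : JetModel n m} (hx : x ∈ jetDomain U m)
    (u : Fin n → ℝ) {i : ℕ} (hi : k + i < m) :
    fderiv ℝ (fun y : JetModel n m => iterTotalDeriv g i (truncate (k + i) y)) x (sprayVec x u)
      = iterTotalDeriv g (i + 1) (truncate (k + (i + 1)) x) := by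
  rw [fderiv_comp_truncate (differentiableAt_of_jetDomain hU (contDiffOn_iterTotalDeriv hU hg i)
    (truncate_mem_jetDomain hx _)), truncate_sprayVec _ _ hi]
  change _ = fderiv ℝ (iterTotalDeriv g i) (truncate (k + i) (truncate (k + i + 1) x)) _
  rw [truncate_truncate _ (Nat.le_succ _)]
  rfl

theorem fderiv_momentum (hU : IsOpen U) {f : JetModel n k → ℝ}
    (hf : ContDiffOn ℝ ∞ f (jetDomain U k)) (r : ℕ) (A : Fin n) {x : JetModel n (2 * k - 1)}
    (hx : x ∈ jetDomain U (2 * k - 1)) (v : JetModel n (2 * k - 1)) :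
    fderiv ℝ (momentum f r A) x v = ∑ i ∈ Finset.range (k - r + 1), (-1) ^ i *
      fderiv ℝ (fun y : JetModel n (2 * k - 1) =>
        iterTotalDeriv (partialQ f (r + i) A) i (truncate (k + i) y)) x v := by
  have hd : ∀ i, DifferentiableAt ℝ (fun y : JetModel n (2 * k - 1) =>
        iterTotalDeriv (partialQ f (r + i) A) i (truncate (k + i) y)) x := fun i =>
    differentiableAt_of_jetDomain hU (contDiffOn_comp_truncate
      (contDiffOn_iterTotalDeriv hU (contDiffOn_partialQ hU hf (r + i) A) i)) hx
  change fderiv ℝ (fun y => ∑ i ∈ Finset.range (k - r + 1), (-1) ^ i *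
    iterTotalDeriv (partialQ f (r + i) A) i (truncate (k + i) y)) x v = _
  rw [fderiv_fun_sum fun i _ => (hd i).const_mul _]
  simp only [FunLike.coe_sum, Finset.sum_apply]
  refine Finset.sum_congr rfl fun i _ => ?_
  rw [fderiv_const_mul (hd i)]
  simp

theorem momentum_top {f : JetModel n k → ℝ} (A : Fin n) (x : JetModel n (2 * k - 1)) :
    momentum f k A x = partialQ f k A (truncate k x) := by
  simp [momentum, iterTotalDeriv]

/-- The sums telescope: the `i`-th term of the derivative cancels the `(i+1)`-st term of `momentum f
j A`, leaving the term of index zero. The condition `1 ≤ j` keeps every differentiated function of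
order below `2k-1`, so that `u` does not enter; for `j = 0` it would, which is where the equations
of motion come from. -/
theorem momentum_add_fderiv_momentum (hU : IsOpen U) {f : JetModel n k → ℝ}
    (hf : ContDiffOn ℝ ∞ f (jetDomain U k)) {j : ℕ} (hj : 1 ≤ j) (hjk : j < k) (A : Fin n)
    {x : JetModel n (2 * k - 1)} (hx : x ∈ jetDomain U (2 * k - 1)) (u : Fin n → ℝ) :
    momentum f j A x + fderiv ℝ (momentum f (j + 1) A) x (sprayVec x u)
      = partialQ f j A (truncate k x) := by
  rw [fderiv_momentum hU hf _ _ hx, momentum, show k - j + 1 = (k - (j + 1) + 1) + 1 by omega,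
    Finset.sum_range_succ', add_right_comm, ← Finset.sum_add_distrib,
    Finset.sum_eq_zero, zero_add]
  · simp [iterTotalDeriv]
  · intro i hi
    rw [Finset.mem_range] at hi
    rw [fderiv_iterTotalDeriv_sprayVec hU (contDiffOn_partialQ hU hf _ A) hx u (by omega),
      show j + 1 + i = j + (i + 1) by ring]
    ring

/-- The new variable `q_{m+1}` enters `d_T g` only linearly, through `q_{m+1}^B ∂g/∂q_m^B`. The
proof compares the derivative along the line in direction `∂/∂q_{m+1}^B` with this explicit affine
function. -/
theorem partialQ_totalDeriv_top (hU : IsOpen U) {g : JetModel n m → ℝ}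
    (hg : ContDiffOn ℝ ∞ g (jetDomain U m)) {x : JetModel n (m + 1)}
    (hx : x ∈ jetDomain U (m + 1)) (B : Fin n) :
    partialQ (totalDeriv g) (m + 1) B x = partialQ g m B (truncate m x) := by
  have hd := differentiableAt_of_jetDomain hU (contDiffOn_totalDeriv hU hg) hx
  have hline : HasDerivAt (fun s : ℝ => x + s • (vecQ (m + 1) B : JetModel n (m + 1)))
      (vecQ (m + 1) B) 0 := by
    simpa using ((hasDerivAt_id (0 : ℝ)).smul_const
      (vecQ (m + 1) B : JetModel n (m + 1))).const_add x
  have hd' : HasFDerivAt (totalDeriv g) (fderiv ℝ (totalDeriv g) x)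
      (x + (0 : ℝ) • (vecQ (m + 1) B : JetModel n (m + 1))) := by
    simpa using hd.hasFDerivAt
  have h1 := hd'.comp_hasDerivAt (0 : ℝ) hline
  have hconst : ∀ s : ℝ, truncate m (x + s • (vecQ (m + 1) B : JetModel n (m + 1)))
      = truncate m x := by
    intro s
    rw [← truncateL_apply, ← truncateL_apply, map_add, map_smul, truncateL_apply m (vecQ _ _),
      truncate_vecQ _ (Nat.le_succ m), vecQ_of_lt _ (Nat.lt_succ_self m)]
    simp
  have h2 : ∀ s : ℝ, totalDeriv g (x + s • (vecQ (m + 1) B : JetModel n (m + 1)))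
      = totalDeriv g x + s * partialQ g m B (truncate m x) := by
    intro s
    have e : ((1, fun i : Fin (m + 1) => coordQ (x + s • (vecQ (m + 1) B : JetModel n (m + 1)))
        (i + 1)) : JetModel n m) = (1, fun i : Fin (m + 1) => coordQ x (i + 1))
          + s • (vecQ m B : JetModel n m) := by
      refine Prod.ext (by simp [vecQ]) (funext fun i => ?_)
      simp only [Prod.snd_add, Pi.add_apply, Prod.smul_snd, Pi.smul_apply]
      rw [← coordQL_apply, map_add, map_smul, coordQL_apply, coordQL_apply, coordQ_vecQ]
      simp [vecQ, show (i : ℕ) ≤ m by omega]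
    rw [totalDeriv, hconst, e, map_add, map_smul]
    rfl
  have h3 : HasDerivAt (fun s : ℝ => totalDeriv g (x + s • (vecQ (m + 1) B : JetModel n (m + 1))))
      (partialQ g m B (truncate m x)) 0 := by
    simp_rw [h2]
    simpa using ((hasDerivAt_id (0 : ℝ)).mul_const (partialQ g m B (truncate m x))).const_add
      (totalDeriv g x)
  exact h1.unique h3

theorem partialQ_iterTotalDeriv_top (hU : IsOpen U) {g : JetModel n m → ℝ}
    (hg : ContDiffOn ℝ ∞ g (jetDomain U m)) (i : ℕ) {x : JetModel n (m + i)}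
    (hx : x ∈ jetDomain U (m + i)) (B : Fin n) :
    partialQ (iterTotalDeriv g i) (m + i) B x = partialQ g m B (truncate m x) := by
  induction i with
  | zero => rw [show truncate m x = x from truncate_self x]; rfl
  | succ i ih =>
    refine (partialQ_totalDeriv_top hU (contDiffOn_iterTotalDeriv hU hg i) hx B).trans ?_
    rw [ih (truncate_mem_jetDomain hx _), truncate_truncate _ (Nat.le_add_right _ _)]

/-- The Hessian in the highest derivatives governs the dependence on the acceleration. -/
theorem fderiv_momentum_one_vecQ (hU : IsOpen U) (hk : 1 ≤ k) {f : JetModel n k → ℝ}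
    (hf : ContDiffOn ℝ ∞ f (jetDomain U k)) (A B : Fin n) {x : JetModel n (2 * k - 1)}
    (hx : x ∈ jetDomain U (2 * k - 1)) :
    fderiv ℝ (momentum f 1 A) x (vecQ (2 * k - 1) B)
      = (-1) ^ (k - 1) * partialQ (partialQ f k A) k B (truncate k x) := by
  -- Only the summand `i = k - 1` reaches order `2k-1`; the others do not depend on the top
  -- coordinate.
  rw [fderiv_momentum hU hf _ _ hx, Finset.sum_range_succ, Finset.sum_eq_zero, zero_add]
  · have hg := contDiffOn_partialQ hU hf (1 + (k - 1)) A
    rw [fderiv_comp_truncate (differentiableAt_of_jetDomain hU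
      (contDiffOn_iterTotalDeriv hU hg _) (truncate_mem_jetDomain hx _)),
      truncate_vecQ _ (by omega)]
    have := partialQ_iterTotalDeriv_top hU hg (k - 1)
      (truncate_mem_jetDomain hx (k + (k - 1))) B
    rw [truncate_truncate _ (Nat.le_add_right _ _)] at this
    have e : (vecQ (2 * k - 1) B : JetModel n (k + (k - 1))) = vecQ (k + (k - 1)) B := by
      congr 1; omega
    rw [e, ← partialQ, this, show 1 + (k - 1) = k by omega]
  · intro i hi
    rw [Finset.mem_range] at hi
    rw [fderiv_comp_truncate (differentiableAt_of_jetDomain hU (contDiffOn_iterTotalDeriv hU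
      (contDiffOn_partialQ hU hf _ A) _) (truncate_mem_jetDomain hx _)),
      truncate_vecQ _ (by omega), vecQ_of_lt _ (by omega)]
    simp

end CoordinateCalculus

/-! ### Contraction of the Poincaré-Cartan form with prolonged velocities -/

section Contraction

variable {n m k : ℕ} {U : Set (BaseModel n)}

theorem formQ_apply (i : ℕ) (A : Fin n) (v : JetModel n m) : formQ m i A v = coordQ v i A := by
  unfold formQ coordQ
  split_ifs <;> simp

theorem localPoincareCartan_apply (f : JetModel n k → ℝ) (x v : JetModel n (2 * k - 1)) :
    localPoincareCartan f x v = ∑ r ∈ Finset.Icc 1 k, ∑ A : Fin n,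
      momentum f r A x * (coordQ v (r - 1) A - coordQ x r A * v.1) + f (truncate k x) * v.1 := by
  simp [localPoincareCartan, formQ_apply, formT]

theorem contDiffOn_localPoincareCartan (hU : IsOpen U) {f : JetModel n k → ℝ}
    (hf : ContDiffOn ℝ ∞ f (jetDomain U k)) :
    ContDiffOn ℝ ∞ (localPoincareCartan f) (jetDomain U (2 * k - 1)) := by
  refine ContDiffOn.add (ContDiffOn.sum fun r _ => ContDiffOn.sum fun A _ => ?_)
    ((contDiffOn_comp_truncate hf).smul contDiffOn_const)
  have h : ContDiffOn ℝ ∞ (fun x : JetModel n (2 * k - 1) => coordQ x r A)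
      (jetDomain U (2 * k - 1)) := ((contDiff_apply ℝ ℝ A).comp (contDiff_coordQ r)).contDiffOn
  exact (contDiffOn_momentum hU hf r A).smul (contDiffOn_const.sub (h.smul contDiffOn_const))

theorem extDeriv_ofSubsingleton_apply {M : Type*} [NormedAddCommGroup M] [NormedSpace ℝ M]
    {θ : M → M →L[ℝ] ℝ} {x : M} (hθ : DifferentiableAt ℝ θ x) (v w : M) :
    extDeriv (fun y => ContinuousAlternatingMap.ofSubsingleton ℝ M ℝ (0 : Fin 1) (θ y)) x ![v, w]
      = fderiv ℝ (fun y => θ y w) x v - fderiv ℝ (fun y => θ y v) x w := by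
  have h : DifferentiableAt ℝ
      (fun y => ContinuousAlternatingMap.ofSubsingleton ℝ M ℝ (0 : Fin 1) (θ y)) x :=
    (ContinuousAlternatingMap.ofSubsingletonLIE (𝕜 := ℝ) (E := M) (F := ℝ)
      (0 : Fin 1)).toContinuousLinearEquiv.differentiableAt.comp x hθ
  rw [extDeriv_apply h]
  simp [Fin.sum_univ_two, Fin.removeNth, sub_eq_add_neg]

theorem fderiv_localPoincareCartan (hU : IsOpen U) {f : JetModel n k → ℝ}
    (hf : ContDiffOn ℝ ∞ f (jetDomain U k)) {x : JetModel n (2 * k - 1)}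
    (hx : x ∈ jetDomain U (2 * k - 1)) (v w : JetModel n (2 * k - 1)) :
    fderiv ℝ (fun y => localPoincareCartan f y w) x v =
      ∑ r ∈ Finset.Icc 1 k, ∑ A : Fin n,
        (fderiv ℝ (momentum f r A) x v * (coordQ w (r - 1) A - coordQ x r A * w.1)
          - momentum f r A x * (coordQ v r A * w.1))
      + fderiv ℝ f (truncate k x) (truncate k v) * w.1 := by
  have hm : ∀ r A, HasFDerivAt (momentum f r A) (fderiv ℝ (momentum f r A) x) x := fun r A =>
    (differentiableAt_of_jetDomain hU (contDiffOn_momentum hU hf r A) hx).hasFDerivAt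
  have hq : ∀ (r : ℕ) (A : Fin n), HasFDerivAt (fun y : JetModel n (2 * k - 1) => coordQ y r A)
      ((ContinuousLinearMap.proj A).comp (coordQL n (2 * k - 1) r)) x := by
    intro r A
    simp_rw [← coordQL_apply]
    exact ((ContinuousLinearMap.proj A).comp (coordQL n (2 * k - 1) r)).hasFDerivAt
  have hft : DifferentiableAt ℝ (fun y : JetModel n (2 * k - 1) => f (truncate k y)) x :=
    differentiableAt_of_jetDomain hU (contDiffOn_comp_truncate hf) hx
  have hs : HasFDerivAt (fun y => ∑ r ∈ Finset.Icc 1 k, ∑ A : Fin n,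
      momentum f r A y * (coordQ w (r - 1) A - coordQ y r A * w.1)) _ x :=
    HasFDerivAt.fun_sum fun r _ => HasFDerivAt.fun_sum fun A _ =>
      (hm r A).fun_mul (((hq r A).mul_const w.1).const_sub (coordQ w (r - 1) A))
  have h := hs.fun_add (hft.hasFDerivAt.mul_const w.1)
  simp_rw [localPoincareCartan_apply]
  rw [h.fderiv]
  simp only [add_apply, FunLike.coe_sum, Finset.sum_apply, smul_apply, neg_apply, smul_eq_mul,
    ContinuousLinearMap.comp_apply, ContinuousLinearMap.proj_apply, coordQL_apply]
  rw [fderiv_comp_truncate (differentiableAt_of_jetDomain hU hf (truncate_mem_jetDomain hx k))]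
  congr 1
  · refine Finset.sum_congr rfl fun r _ => Finset.sum_congr rfl fun A _ => ?_
    ring
  · ring

/-- Turns the differential of a function on a vertical vector into its partial derivatives. -/
theorem eq_sum_vecQ (v : JetModel n m) (hv : v.1 = 0) :
    v = ∑ i ∈ Finset.range (m + 1), ∑ A, coordQ v i A • (vecQ i A : JetModel n m) := by
  refine Prod.ext ?_ (funext fun j => funext fun B => ?_)
  · simp [hv, vecQ, Prod.fst_sum]
  · rw [← coordQ_coe]
    simp only [Prod.snd_sum, Finset.sum_apply, Prod.smul_snd, Pi.smul_apply, vecQ]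
    rw [Finset.sum_eq_single (j : ℕ)]
    · simp [Pi.single_apply]
    · intro i _ hij
      simp [Ne.symm hij]
    · intro h
      exact absurd (Finset.mem_range.2 j.2) h

theorem truncate_sub_smul (m' : ℕ) (v w : JetModel n m) (a : ℝ) :
    truncate m' (w - a • v) = truncate m' w - a • truncate m' v := by
  simp_rw [← truncateL_apply, map_sub, map_smul]

/-- Summation by parts for the recursion satisfied by the momenta. -/
theorem sum_momentum_recursion (hk : 1 ≤ k) (a p f θ : ℕ → ℝ) (htop : p k = f k)
    (hrec : ∀ j, 1 ≤ j → j < k → p j + a (j + 1) = f j) :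
    ∑ r ∈ Finset.Icc 1 k, (a r * θ (r - 1) + p r * θ r) - ∑ i ∈ Finset.range (k + 1), f i * θ i
      = (a 1 - f 0) * θ 0 := by
  obtain ⟨l, rfl⟩ : ∃ l, k = l + 1 := ⟨k - 1, by omega⟩
  rw [Finset.sum_range_succ', ← Finset.sum_Ioc_add_eq_sum_Icc (by omega : 1 ≤ l + 1)]
  have e : ∑ r ∈ Finset.Ioc 1 (l + 1), (a r * θ (r - 1) + p r * θ r)
      = ∑ j ∈ Finset.range l, (a (j + 2) * θ (j + 1) + p (j + 2) * θ (j + 2)) := by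
    rw [← Finset.Ico_add_one_add_one_eq_Ioc, Finset.sum_Ico_eq_sum_range]
    refine Finset.sum_congr (by congr 1) fun j _ => ?_
    rw [show 1 + 1 + j = j + 2 by ring, show j + 2 - 1 = j + 1 by omega]
  have e2 : ∑ j ∈ Finset.range (l + 1), f (j + 1) * θ (j + 1)
      = ∑ j ∈ Finset.range (l + 1), p (j + 1) * θ (j + 1)
        + ∑ j ∈ Finset.range l, a (j + 2) * θ (j + 1) := by
    rw [Finset.sum_range_succ, Finset.sum_range_succ, ← htop, add_right_comm,
      ← Finset.sum_add_distrib]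
    congr 1
    refine Finset.sum_congr rfl fun j hj => ?_
    rw [← hrec (j + 1) (by omega) (by have := Finset.mem_range.1 hj; omega)]
    ring
  rw [e, e2, Finset.sum_range_succ' (fun j => p (j + 1) * θ (j + 1)), Finset.sum_add_distrib]
  simp
  ring

/-- The Euler-Lagrange expression `∂f/∂q_0^A - d/dt (p_A^0)`, as a function of the coordinates
`(t, q_0, …, q_{2k-1})` and `u = q_{2k}`. -/
def eulerLagrangeFun (f : JetModel n k → ℝ) (A : Fin n) (x : JetModel n (2 * k - 1))
    (u : Fin n → ℝ) : ℝ :=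
  partialQ f 0 A (truncate k x) - fderiv ℝ (momentum f 1 A) x (sprayVec x u)

/-- On `sprayVec` the contact forms `dq_{r-1} - q_r dt`, `r ≤ k`, vanish, so the derivatives of the
momenta in the arbitrary direction `w` drop out. What is left depends on `w` through the vertical
vector `w - w.1 • v`, and summation by parts with the recursion of the momenta removes its
components of positive order. -/
theorem localPoincareCartan₂_sprayVec (hU : IsOpen U) (hk : 1 ≤ k) {f : JetModel n k → ℝ}
    (hf : ContDiffOn ℝ ∞ f (jetDomain U k)) {x : JetModel n (2 * k - 1)}
    (hx : x ∈ jetDomain U (2 * k - 1)) (u : Fin n → ℝ) (w : JetModel n (2 * k - 1)) :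
    localPoincareCartan₂ f x ![sprayVec x u, w] =
      ∑ A, eulerLagrangeFun f A x u * (coordQ w 0 A - coordQ (sprayVec x u) 0 A * w.1) := by
  have hd := differentiableAt_of_jetDomain hU (contDiffOn_localPoincareCartan hU hf) hx
  set v := sprayVec x u with hv
  have hcart : ∀ r ∈ Finset.Icc 1 k, coordQ v (r - 1) = coordQ x r := by
    intro r hr
    rw [Finset.mem_Icc] at hr
    rw [hv, coordQ_sprayVec_of_lt _ _ (by omega), Nat.sub_add_cancel hr.1]
  -- Split `w` into `w.1 • v` and a vertical remainder, and expand the differential of `f` on the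
  -- latter.
  have hw : fderiv ℝ f (truncate k x) (truncate k w)
      = fderiv ℝ f (truncate k x) (truncate k v) * w.1 + ∑ A, ∑ i ∈ Finset.range (k + 1),
          partialQ f i A (truncate k x) * (coordQ w i A - coordQ v i A * w.1) := by
    have h1 := eq_sum_vecQ (truncate k (w - w.1 • v)) (by
      simp [truncate, hv, sprayVec])
    have h2 := congrArg (fderiv ℝ f (truncate k x)) h1
    rw [truncate_sub_smul, map_sub, map_smul, ← truncate_sub_smul] at h2
    rw [Finset.sum_comm, ← sub_eq_iff_eq_add',
      mul_comm (fderiv ℝ f (truncate k x) (truncate k v))]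
    refine h2.trans ?_
    rw [map_sum]
    refine Finset.sum_congr rfl fun i hi => ?_
    rw [map_sum]
    refine Finset.sum_congr rfl fun A _ => ?_
    have hi' : i ≤ k := by have := Finset.mem_range.1 hi; omega
    rw [map_smul, smul_eq_mul, mul_comm, coordQ_truncate _ hi', ← coordQL_apply, map_sub,
      map_smul, coordQL_apply, coordQL_apply]
    simp only [Pi.sub_apply, Pi.smul_apply, smul_eq_mul, partialQ]
    ring
  change -(extDeriv _ x ![v, w]) = _
  rw [extDeriv_ofSubsingleton_apply hd, fderiv_localPoincareCartan hU hf hx,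
    fderiv_localPoincareCartan hU hf hx, hw, hv, sprayVec_fst, ← hv, Finset.sum_comm,
    Finset.sum_comm (s := Finset.Icc 1 k)]
  have key : ∀ A, ∑ r ∈ Finset.Icc 1 k,
        (fderiv ℝ (momentum f r A) x v * (coordQ w (r - 1) A - coordQ x r A * w.1)
          - momentum f r A x * (coordQ v r A * w.1))
      - ∑ r ∈ Finset.Icc 1 k,
        (fderiv ℝ (momentum f r A) x w * (coordQ v (r - 1) A - coordQ x r A * 1)
          - momentum f r A x * (coordQ w r A * 1))
      - ∑ i ∈ Finset.range (k + 1),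
          partialQ f i A (truncate k x) * (coordQ w i A - coordQ v i A * w.1)
      = -(eulerLagrangeFun f A x u * (coordQ w 0 A - coordQ v 0 A * w.1)) := by
    intro A
    have := sum_momentum_recursion hk (fun r => fderiv ℝ (momentum f r A) x v)
      (fun r => momentum f r A x) (fun i => partialQ f i A (truncate k x))
      (fun i => coordQ w i A - coordQ v i A * w.1) (momentum_top A x)
      (fun j h1 h2 => momentum_add_fderiv_momentum hU hf h1 h2 A hx u)
    rw [← Finset.sum_sub_distrib, eulerLagrangeFun, ← neg_mul, neg_sub, ← this]
    congr 1
    refine Finset.sum_congr rfl fun r hr => ?_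
    rw [hcart r hr]
    ring
  rw [← neg_inj, neg_neg, ← Finset.sum_neg_distrib, ← Finset.sum_congr rfl fun A _ => key A]
  simp only [Finset.sum_sub_distrib]
  ring

/-- Since `u` occurs only in the vector along which the first momentum is differentiated, the
expression is affine in `u`, and its linear part is the Hessian up to sign. -/
theorem eulerLagrangeFun_eq (hU : IsOpen U) (hk : 1 ≤ k) {f : JetModel n k → ℝ}
    (hf : ContDiffOn ℝ ∞ f (jetDomain U k)) (A : Fin n) {x : JetModel n (2 * k - 1)}
    (hx : x ∈ jetDomain U (2 * k - 1)) (u : Fin n → ℝ) :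
    eulerLagrangeFun f A x u = eulerLagrangeFun f A x 0 - (-1) ^ (k - 1) *
      ∑ B, partialQ (partialQ f k A) k B (truncate k x) * u B := by
  rw [eulerLagrangeFun, sprayVec_eq_add_sum, map_add, map_sum, eulerLagrangeFun, Finset.mul_sum,
    ← sub_sub]
  congr 1
  refine Finset.sum_congr rfl fun B _ => ?_
  rw [map_smul, fderiv_momentum_one_vecQ hU hk hf A B hx, smul_eq_mul]
  ring

theorem contDiffOn_eulerLagrangeFun_zero (hU : IsOpen U) {f : JetModel n k → ℝ}
    (hf : ContDiffOn ℝ ∞ f (jetDomain U k)) (A : Fin n) :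
    ContDiffOn ℝ ∞ (fun x => eulerLagrangeFun f A x 0) (jetDomain U (2 * k - 1)) := by
  refine (contDiffOn_comp_truncate (contDiffOn_partialQ hU hf 0 A)).sub ?_
  exact ((contDiffOn_momentum hU hf 1 A).fderiv_of_isOpen (m := ∞) (isOpen_jetDomain hU _)
    (by simp)).clm_apply (contDiff_sprayVec.comp (contDiff_id.prodMk contDiff_const)).contDiffOn

/-- For a regular Lagrangian the Euler-Lagrange equations determine the highest derivative as a
smooth function of the lower ones. -/
theorem exists_contDiffOn_eulerLagrangeFun_eq_zero (hU : IsOpen U) (hk : 1 ≤ k)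
    {f : JetModel n k → ℝ} (hf : ContDiffOn ℝ ∞ f (jetDomain U k))
    (hdet : ∀ y ∈ jetDomain U k, (Matrix.of fun A B : Fin n =>
      partialQ (partialQ f k B) k A y).det ≠ 0) :
    ∃ F : JetModel n (2 * k - 1) → Fin n → ℝ, ContDiffOn ℝ ∞ F (jetDomain U (2 * k - 1)) ∧
      ∀ x ∈ jetDomain U (2 * k - 1), ∀ u, (∀ A, eulerLagrangeFun f A x u = 0) ↔ u = F x := by
  set H : JetModel n (2 * k - 1) → Matrix (Fin n) (Fin n) ℝ := fun x => Matrix.of fun A B =>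
    partialQ (partialQ f k A) k B (truncate k x) with hH
  have hHdet : ∀ x ∈ jetDomain U (2 * k - 1), (H x).det ≠ 0 := by
    intro x hx
    have := hdet _ (truncate_mem_jetDomain hx k)
    -- The Hessian in the hypothesis is indexed in the opposite order; no symmetry of second
    -- derivatives is needed.
    rwa [← Matrix.det_transpose] at this
  set b : JetModel n (2 * k - 1) → Fin n → ℝ := fun x A =>
    (-1) ^ (k - 1) * eulerLagrangeFun f A x 0 with hb
  have hHs : ∀ A B, ContDiffOn ℝ ∞ (fun x => H x A B) (jetDomain U (2 * k - 1)) := fun A B =>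
    contDiffOn_comp_truncate (contDiffOn_partialQ hU (contDiffOn_partialQ hU hf k A) k B)
  have hbs : ∀ A, ContDiffOn ℝ ∞ (fun x => b x A) (jetDomain U (2 * k - 1)) := fun A =>
    contDiffOn_const.mul (contDiffOn_eulerLagrangeFun_zero hU hf A)
  have hdets : ∀ M : JetModel n (2 * k - 1) → Matrix (Fin n) (Fin n) ℝ,
      (∀ A B, ContDiffOn ℝ ∞ (fun x => M x A B) (jetDomain U (2 * k - 1))) →
      ContDiffOn ℝ ∞ (fun x => (M x).det) (jetDomain U (2 * k - 1)) := by
    intro M hM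
    simp_rw [Matrix.det_apply']
    exact ContDiffOn.sum fun σ _ => contDiffOn_const.mul (contDiffOn_prod fun i _ => hM _ _)
  -- Cramer's rule exhibits the solution of `H u = b` as a rational function of the entries, which
  -- makes its smoothness evident.
  refine ⟨fun x => (H x).det⁻¹ • Matrix.cramer (H x) (b x), ?_, ?_⟩
  · refine ((hdets H hHs).inv hHdet).smul (contDiffOn_pi.2 fun i => ?_)
    simp_rw [Matrix.cramer_apply]
    refine hdets _ fun A B => ?_
    by_cases h : B = i
    · subst h; simpa using hbs A
    · simpa [Matrix.updateCol_ne h] using hHs A B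
  · intro x hx u
    have h1 : (∀ A, eulerLagrangeFun f A x u = 0) ↔ (H x).mulVec u = b x := by
      rw [funext_iff]
      refine forall_congr' fun A => ?_
      rw [eulerLagrangeFun_eq hU hk hf A hx, sub_eq_zero]
      have hs : ((-1 : ℝ) ^ (k - 1)) * (-1) ^ (k - 1) = 1 := by
        rw [← mul_pow]; simp
      change _ = (-1) ^ (k - 1) * ((H x).mulVec u A) ↔ (H x).mulVec u A
        = (-1) ^ (k - 1) * eulerLagrangeFun f A x 0
      constructor
      · intro h; rw [h, ← mul_assoc, hs, one_mul]
      · intro h; rw [h, ← mul_assoc, hs, one_mul]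
    have h2 : (H x).mulVec ((H x).det⁻¹ • Matrix.cramer (H x) (b x)) = b x := by
      rw [Matrix.mulVec_smul, Matrix.mulVec_cramer, smul_smul, inv_mul_cancel₀ (hHdet x hx),
        one_smul]
    rw [h1]
    constructor
    · intro h
      exact Matrix.mulVec_injective_of_isUnit
        ((Matrix.isUnit_iff_isUnit_det _).2 (hHdet x hx).isUnit) (h.trans h2.symm)
    · rintro rfl; exact h2

end Contraction

/-! ### Prolongations of curves in coordinates -/

section Curves

variable {n m k : ℕ} {U : Set (BaseModel n)}

theorem contDiffOn_iteratedDeriv {W : Type*} [NormedAddCommGroup W] [NormedSpace ℝ W]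
    {x : ℝ → W} {I : Set ℝ} (hI : IsOpen I) (hx : ContDiffOn ℝ ∞ x I) (i : ℕ) :
    ContDiffOn ℝ ∞ (iteratedDeriv i x) I := by
  induction i with
  | zero => simpa using hx
  | succ i ih => rw [iteratedDeriv_succ]; exact ih.deriv_of_isOpen (m := ∞) hI (by simp)

theorem hasDerivAt_iteratedDeriv {W : Type*} [NormedAddCommGroup W] [NormedSpace ℝ W]
    {x : ℝ → W} {I : Set ℝ} (hI : IsOpen I) (hx : ContDiffOn ℝ ∞ x I) (i : ℕ) {t : ℝ}
    (ht : t ∈ I) : HasDerivAt (iteratedDeriv i x) (iteratedDeriv (i + 1) x t) t := by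
  rw [iteratedDeriv_succ]
  exact (((contDiffOn_iteratedDeriv hI hx i).contDiffAt
    (hI.mem_nhds ht)).differentiableAt (by simp)).hasDerivAt

theorem iteratedDeriv_eqOn {W : Type*} [NormedAddCommGroup W] [NormedSpace ℝ W]
    {x y : ℝ → W} {I : Set ℝ} (hI : IsOpen I) (h : EqOn x y I) (i : ℕ) :
    EqOn (iteratedDeriv i x) (iteratedDeriv i y) I := fun _ ht =>
  (h.eventuallyEq_of_mem (hI.mem_nhds ht)).iteratedDeriv_eq i

theorem iteratedDeriv_pi_apply {x : ℝ → Fin n → ℝ} {I : Set ℝ} (hI : IsOpen I)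
    (hx : ContDiffOn ℝ ∞ x I) (i : ℕ) (A : Fin n) :
    EqOn (fun t => iteratedDeriv i x t A) (iteratedDeriv i fun s => x s A) I := by
  induction i with
  | zero => intro t _; simp
  | succ i ih =>
    intro t ht
    have h1 := (hasDerivAt_pi.1 (hasDerivAt_iteratedDeriv hI hx i ht)) A
    rw [iteratedDeriv_succ (f := fun s => x s A),
      ← (ih.eventuallyEq_of_mem (hI.mem_nhds ht)).deriv_eq]
    exact h1.deriv.symm

/-- The `m`-jet prolongation of a curve in coordinates. -/
def jetCurve (m : ℕ) (x : ℝ → Fin n → ℝ) (t : ℝ) : JetModel n m :=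
  (t, fun i => iteratedDeriv (i : ℕ) x t)

theorem coordQ_jetCurve (x : ℝ → Fin n → ℝ) (t : ℝ) {i : ℕ} (h : i ≤ m) :
    coordQ (jetCurve m x t) i = iteratedDeriv i x t := by
  rw [coordQ_of_le _ h]; rfl

theorem truncate_jetCurve {m' : ℕ} (x : ℝ → Fin n → ℝ) (t : ℝ) (h : m' ≤ m) :
    truncate m' (jetCurve m x t) = jetCurve m' x t :=
  Prod.ext rfl (funext fun i => coordQ_jetCurve x t (by omega))

theorem jetCurve_mem_jetDomain {x : ℝ → Fin n → ℝ} {t : ℝ} :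
    jetCurve m x t ∈ jetDomain U m ↔ ((t, x t) : BaseModel n) ∈ U := by
  simp [jetCurve, jetDomain]

theorem jetCurve_eqOn {x y : ℝ → Fin n → ℝ} {I : Set ℝ} (hI : IsOpen I) (h : EqOn x y I) :
    EqOn (jetCurve m x) (jetCurve m y) I := fun _ ht =>
  Prod.ext rfl (funext fun i => iteratedDeriv_eqOn hI h i ht)

variable {x : ℝ → Fin n → ℝ} {I : Set ℝ}

theorem contDiffOn_jetCurve (hI : IsOpen I) (hx : ContDiffOn ℝ ∞ x I) :
    ContDiffOn ℝ ∞ (jetCurve m x) I :=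
  contDiffOn_id.prodMk (contDiffOn_pi.2 fun i => contDiffOn_iteratedDeriv hI hx i)

theorem hasDerivAt_jetCurve (hI : IsOpen I) (hx : ContDiffOn ℝ ∞ x I) {t : ℝ} (ht : t ∈ I) :
    HasDerivAt (jetCurve m x) (sprayVec (jetCurve m x t) (iteratedDeriv (m + 1) x t)) t := by
  refine (hasDerivAt_id t).prodMk (hasDerivAt_pi.2 fun i => ?_)
  have h := hasDerivAt_iteratedDeriv hI hx i ht
  by_cases hi : (i : ℕ) < m
  · simpa [hi, coordQ_jetCurve x t (show (i : ℕ) + 1 ≤ m by omega)] using h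
  · have : (i : ℕ) = m := by omega
    simpa [this] using h

theorem contDiffOn_comp_jetCurve {g : JetModel n m → ℝ} (hg : ContDiffOn ℝ ∞ g (jetDomain U m))
    (hI : IsOpen I) (hx : ContDiffOn ℝ ∞ x I) (hxU : ∀ s ∈ I, ((s, x s) : BaseModel n) ∈ U) :
    ContDiffOn ℝ ∞ (fun s => g (jetCurve m x s)) I :=
  hg.comp (contDiffOn_jetCurve hI hx) fun s hs => jetCurve_mem_jetDomain.2 (hxU s hs)

theorem hasDerivAt_comp_jetCurve (hU : IsOpen U) {g : JetModel n m → ℝ}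
    (hg : ContDiffOn ℝ ∞ g (jetDomain U m)) (hI : IsOpen I) (hx : ContDiffOn ℝ ∞ x I)
    (hxU : ∀ s ∈ I, ((s, x s) : BaseModel n) ∈ U) {t : ℝ} (ht : t ∈ I) :
    HasDerivAt (fun s => g (jetCurve m x s)) (fderiv ℝ g (jetCurve m x t)
      (sprayVec (jetCurve m x t) (iteratedDeriv (m + 1) x t))) t :=
  (differentiableAt_of_jetDomain hU hg (jetCurve_mem_jetDomain.2
    (hxU t ht))).hasFDerivAt.comp_hasDerivAt t (hasDerivAt_jetCurve hI hx ht)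

/-- The chain rule: the velocity of the `m`-jet prolongation is the vector that defines `d_T` at the
`(m+1)`-jet. -/
theorem totalDeriv_jetCurve (hU : IsOpen U) {g : JetModel n m → ℝ}
    (hg : ContDiffOn ℝ ∞ g (jetDomain U m)) (hI : IsOpen I) (hx : ContDiffOn ℝ ∞ x I)
    (hxU : ∀ s ∈ I, ((s, x s) : BaseModel n) ∈ U) {t : ℝ} (ht : t ∈ I) :
    totalDeriv g (jetCurve (m + 1) x t) = deriv (fun s => g (jetCurve m x s)) t := by
  rw [(hasDerivAt_comp_jetCurve hU hg hI hx hxU ht).deriv, totalDeriv,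
    truncate_jetCurve _ _ (Nat.le_succ m)]
  congr 1
  refine Prod.ext rfl (funext fun i => ?_)
  dsimp only [sprayVec]
  rw [coordQ_jetCurve _ _ (by omega)]
  split_ifs with h
  · rw [coordQ_jetCurve _ _ (by omega)]
  · rw [show (i : ℕ) = m by omega]

theorem iterTotalDeriv_jetCurve (hU : IsOpen U) {g : JetModel n m → ℝ}
    (hg : ContDiffOn ℝ ∞ g (jetDomain U m)) (hI : IsOpen I) (hx : ContDiffOn ℝ ∞ x I)
    (hxU : ∀ s ∈ I, ((s, x s) : BaseModel n) ∈ U) (i : ℕ) :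
    EqOn (fun t => iterTotalDeriv g i (jetCurve (m + i) x t))
      (iteratedDeriv i fun s => g (jetCurve m x s)) I := by
  induction i with
  | zero => intro t _; simp [iterTotalDeriv]
  | succ i ih =>
    intro t ht
    rw [iteratedDeriv_succ, ← (ih.eventuallyEq_of_mem (hI.mem_nhds ht)).deriv_eq]
    exact totalDeriv_jetCurve hU (contDiffOn_iterTotalDeriv hU hg i) hI hx hxU ht

/-- The Euler-Lagrange expression along a curve. -/
def eulerLagrangeCurve (f : JetModel n k → ℝ) (x : ℝ → Fin n → ℝ) (A : Fin n) (t : ℝ) : ℝ :=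
  ∑ i ∈ Finset.range (k + 1), (-1) ^ i *
    iteratedDeriv i (fun s => partialQ f i A (jetCurve k x s)) t

/-- The term of index zero is `∂f/∂q_0`. The term of index `i + 1` is minus the time derivative of
the `i`-th summand of the first momentum, because `d_T^i` becomes `(d/dt)^i` along a prolongation.
-/
theorem eulerLagrangeCurve_eq (hU : IsOpen U) (hk : 1 ≤ k) {f : JetModel n k → ℝ}
    (hf : ContDiffOn ℝ ∞ f (jetDomain U k)) (hI : IsOpen I) (hx : ContDiffOn ℝ ∞ x I)
    (hxU : ∀ s ∈ I, ((s, x s) : BaseModel n) ∈ U) (A : Fin n) {t : ℝ} (ht : t ∈ I) :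
    eulerLagrangeCurve f x A t = eulerLagrangeFun f A (jetCurve (2 * k - 1) x t)
      (iteratedDeriv (2 * k - 1 + 1) x t) := by
  rw [eulerLagrangeFun, fderiv_momentum hU hf _ _ (jetCurve_mem_jetDomain.2 (hxU t ht)),
    Nat.sub_add_cancel hk, eulerLagrangeCurve, Finset.sum_range_succ',
    truncate_jetCurve _ _ (by omega), add_comm, sub_eq_add_neg, ← Finset.sum_neg_distrib]
  congr 1
  · simp
  · refine Finset.sum_congr rfl fun i hi => ?_
    rw [Finset.mem_range] at hi
    have hg := contDiffOn_partialQ hU hf (1 + i) A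
    have h1 := (hasDerivAt_comp_jetCurve (m := 2 * k - 1) hU (contDiffOn_comp_truncate
      (contDiffOn_iterTotalDeriv hU hg i)) hI hx hxU ht).deriv
    have h2 : EqOn (fun s => iterTotalDeriv (partialQ f (1 + i) A) i
        (truncate (k + i) (jetCurve (2 * k - 1) x s)))
        (iteratedDeriv i fun s => partialQ f (1 + i) A (jetCurve k x s)) I := by
      intro s hs
      dsimp only
      rw [truncate_jetCurve _ _ (by omega)]
      exact iterTotalDeriv_jetCurve hU hg hI hx hxU i hs
    rw [← h1, (h2.eventuallyEq_of_mem (hI.mem_nhds ht)).deriv_eq, ← iteratedDeriv_succ,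
      add_comm 1 i]
    ring

/-! #### Formal adjoints and partial derivatives -/

/-- The formal adjoint of `g ↦ (g N)^{(j)}` applied to `P`. -/
theorem sum_choose_iteratedDeriv_mul (hI : IsOpen I) {P N : ℝ → ℝ} (hP : ContDiffOn ℝ ∞ P I)
    (hN : ContDiffOn ℝ ∞ N I) (j : ℕ) {t : ℝ} (ht : t ∈ I) :
    ∑ i ∈ Finset.range (j + 1), (j.choose i : ℝ) * ((-1) ^ i *
      iteratedDeriv i (fun s => P s * iteratedDeriv (j - i) N s) t)
      = (-1) ^ j * iteratedDeriv j P t * N t := by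
  induction j generalizing N t with
  | zero => simp
  | succ j ih =>
    have hN' : ContDiffOn ℝ ∞ (deriv N) I := hN.deriv_of_isOpen (m := ∞) hI (by simp)
    have hder : ∀ i l, HasDerivAt (iteratedDeriv i fun s => P s * iteratedDeriv l N s)
        (iteratedDeriv (i + 1) (fun s => P s * iteratedDeriv l N s) t) t := fun i l =>
      hasDerivAt_iteratedDeriv hI (hP.mul (contDiffOn_iteratedDeriv hI hN l)) i ht
    -- Pascal's rule splits the sum in two: one part is the induction hypothesis for `deriv N`
    -- (`h2`), the other is minus the time derivative of the induction hypothesis for `N` (`h3`).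
    have h1 := Finset.sum_choose_succ_mul (R := ℝ) (fun i l => (-1) ^ i *
      iteratedDeriv i (fun s => P s * iteratedDeriv l N s) t) j
    have h2 : ∑ i ∈ Finset.range (j + 1), (j.choose i : ℝ) * ((-1) ^ i *
        iteratedDeriv i (fun s => P s * iteratedDeriv (j + 1 - i) N s) t)
        = (-1) ^ j * iteratedDeriv j P t * deriv N t := by
      rw [← ih hN' ht]
      refine Finset.sum_congr rfl fun i hi => ?_
      rw [show j + 1 - i = (j - i) + 1 by have := Finset.mem_range.1 hi; omega, iteratedDeriv_succ']
    have h3 : ∑ i ∈ Finset.range (j + 1), (j.choose i : ℝ) * ((-1) ^ (i + 1) *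
        iteratedDeriv (i + 1) (fun s => P s * iteratedDeriv (j - i) N s) t)
        = -((-1) ^ j * (iteratedDeriv (j + 1) P t * N t + iteratedDeriv j P t * deriv N t)) := by
      have hl : HasDerivAt (fun t => ∑ i ∈ Finset.range (j + 1), (j.choose i : ℝ) * ((-1) ^ i *
          iteratedDeriv i (fun s => P s * iteratedDeriv (j - i) N s) t)) _ t :=
        HasDerivAt.fun_sum fun i _ => ((hder i (j - i)).const_mul ((-1) ^ i)).const_mul _
      have hr : HasDerivAt (fun t => (-1) ^ j * iteratedDeriv j P t * N t) _ t :=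
        ((hasDerivAt_iteratedDeriv hI hP j ht).const_mul ((-1) ^ j)).mul
          ((hN.contDiffAt (hI.mem_nhds ht)).differentiableAt (by simp)).hasDerivAt
      have := (hl.congr_of_eventuallyEq (EventuallyEq.symm ((show EqOn _ _ I from
        fun s hs => ih hN hs).eventuallyEq_of_mem (hI.mem_nhds ht)))).unique hr
      rw [show -((-1) ^ j * (iteratedDeriv (j + 1) P t * N t + iteratedDeriv j P t * deriv N t))
        = -((-1) ^ j * iteratedDeriv (j + 1) P t * N t + (-1) ^ j * iteratedDeriv j P t * deriv N t)
        by ring, ← this, ← Finset.sum_neg_distrib]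
      refine Finset.sum_congr rfl fun i _ => ?_
      ring
    rw [h1, h2, h3]
    ring

/-- Derivatives with respect to a parameter commute with iterated derivatives. -/
theorem hasDerivAt_iteratedDeriv_param {W : Type*} [NormedAddCommGroup W] [NormedSpace ℝ W]
    {G : ℝ × ℝ → W} {V : Set (ℝ × ℝ)} (hV : IsOpen V) (hG : ContDiffOn ℝ ∞ G V) (j : ℕ)
    {p : ℝ × ℝ} (hp : p ∈ V) :
    HasDerivAt (fun ε => iteratedDeriv j (fun s => G (ε, s)) p.2)
      (iteratedDeriv j (fun s => fderiv ℝ G (p.1, s) (1, 0)) p.2) p.1 := by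
  set D : ℕ → ℝ × ℝ → W := fun j p => iteratedDeriv j (fun s => G (p.1, s)) p.2 with hD
  have hDs : ∀ j, ContDiffOn ℝ ∞ (D j) V := fun j => contDiffOn_iteratedDeriv_param hV hG j
  have hDd : ∀ j, ∀ p ∈ V, HasFDerivAt (D j) (fderiv ℝ (D j) p) p := fun j p hp =>
    (((hDs j).contDiffAt (hV.mem_nhds hp)).differentiableAt (by simp)).hasFDerivAt
  have hline : ∀ p : ℝ × ℝ, HasDerivAt (fun s : ℝ => ((p.1, s) : ℝ × ℝ)) (0, 1) p.2 := fun p =>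
    (hasDerivAt_const _ _).prodMk (hasDerivAt_id _)
  have hline' : ∀ p : ℝ × ℝ, HasDerivAt (fun ε : ℝ => ((ε, p.2) : ℝ × ℝ)) (1, 0) p.1 := fun p =>
    (hasDerivAt_id _).prodMk (hasDerivAt_const _ _)
  have key : ∀ j, ∀ p ∈ V, fderiv ℝ (D j) p (1, 0)
      = iteratedDeriv j (fun s => fderiv ℝ G (p.1, s) (1, 0)) p.2 := by
    intro j
    induction j with
    | zero =>
      intro p _
      have : D 0 = G := by funext q; simp [hD]
      rw [this]; simp
    | succ j ih =>
      intro p hp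
      have hsucc : EqOn (D (j + 1)) (fun q => fderiv ℝ (D j) q (0, 1)) V := by
        intro q hq
        change iteratedDeriv (j + 1) (fun s => G (q.1, s)) q.2 = _
        rw [iteratedDeriv_succ]
        exact (HasFDerivAt.comp_hasDerivAt q.2 (f := fun s : ℝ => ((q.1, s) : ℝ × ℝ))
          (hDd j q hq) (hline q)).deriv
      have hD2 : HasFDerivAt (fderiv ℝ (D j)) (fderiv ℝ (fderiv ℝ (D j)) p) p :=
        ((((hDs j).fderiv_of_isOpen (m := ∞) hV (by simp)).contDiffAt
          (hV.mem_nhds hp)).differentiableAt (by simp)).hasFDerivAt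
      have happ : ∀ v w, fderiv ℝ (fun q => fderiv ℝ (D j) q v) p w
          = fderiv ℝ (fderiv ℝ (D j)) p w v := by
        intro v w
        rw [(hD2.clm_apply (hasFDerivAt_const v p)).fderiv]
        simp
      -- One more `s`-derivative is `∂_s` applied to `D j`; symmetry of the second derivative
      -- exchanges it with `∂_ε`.
      have hsymm := ((hDs j).contDiffAt (hV.mem_nhds hp)).isSymmSndFDerivAt (by
        rw [minSmoothness_of_isRCLikeNormedField]; exact WithTop.coe_le_coe.2 le_top)
      rw [(hsucc.eventuallyEq_of_mem (hV.mem_nhds hp)).fderiv_eq, happ, hsymm.eq, ← happ,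
        iteratedDeriv_succ]
      have hev : (fun s => fderiv ℝ (D j) (p.1, s) (1, 0)) =ᶠ[𝓝 p.2]
          iteratedDeriv j (fun s => fderiv ℝ G (p.1, s) (1, 0)) := by
        filter_upwards [(hline p).continuousAt.preimage_mem_nhds (hV.mem_nhds hp)] with s hs
        exact ih (p.1, s) hs
      rw [← hev.deriv_eq]
      have h2 : DifferentiableAt ℝ (fun q => fderiv ℝ (D j) q (1, 0)) p :=
        hD2.differentiableAt.clm_apply (differentiableAt_const _)
      exact (HasFDerivAt.comp_hasDerivAt p.2 (f := fun s : ℝ => ((p.1, s) : ℝ × ℝ))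
        h2.hasFDerivAt (hline p)).deriv.symm
  rw [← key j p hp]
  exact HasFDerivAt.comp_hasDerivAt p.1 (f := fun ε : ℝ => ((ε, p.2) : ℝ × ℝ))
    (hDd j p hp) (hline' p)

end Curves

/-! ### Covariance of the Euler-Lagrange expressions -/

section Covariance

variable {n m k : ℕ} {U U' : Set (BaseModel n)}

theorem iteratedDeriv_monomial (t : ℝ) (i l : ℕ) :
    iteratedDeriv l (fun s : ℝ => (s - t) ^ i / (i.factorial : ℝ)) t = if l = i then 1 else 0 := by
  have e : (fun s : ℝ => (s - t) ^ i / (i.factorial : ℝ)) =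
      fun s => (i.factorial : ℝ)⁻¹ * (fun u : ℝ => u ^ i) (s - t) := by
    funext s; simp; ring
  rw [e, iteratedDeriv_const_mul_field,
    iteratedDeriv_comp_sub_const (n := l) (f := fun u : ℝ => u ^ i) (s := t)]
  simp only [sub_self, iteratedDeriv_fun_pow_zero]
  rcases eq_or_ne l i with rfl | h
  · simp [Nat.factorial_ne_zero]
  · simp [h]

theorem contDiff_monomial (t : ℝ) (i : ℕ) :
    ContDiff ℝ ∞ (fun s : ℝ => (s - t) ^ i / (i.factorial : ℝ)) := by
  fun_prop

/-- In Leibniz' rule at `t` only the term with exactly `i` derivatives on the monomial survives. For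
`j < i` the binomial coefficient vanishes, so the truncated subtraction is harmless. -/
theorem iteratedDeriv_monomial_mul {N : ℝ → ℝ} {t : ℝ} (hN : ContDiffAt ℝ ∞ N t) (i j : ℕ) :
    iteratedDeriv j (fun s => (s - t) ^ i / (i.factorial : ℝ) * N s) t
      = (j.choose i : ℝ) * iteratedDeriv (j - i) N t := by
  have hj : ((j : ℕ∞) : ℕ∞ω) ≤ ∞ := by exact_mod_cast le_top
  have h := iteratedDeriv_mul (n := j) ((contDiff_monomial t i).contDiffAt.of_le hj)
    (hN.of_le hj)
  refine h.trans ?_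
  simp_rw [iteratedDeriv_monomial]
  rcases le_or_gt i j with hij | hij
  · rw [Finset.sum_eq_single i]
    · simp
    · intro l _ hl; simp [hl]
    · intro h; exact absurd (Finset.mem_range.2 (by omega)) h
  · rw [Nat.choose_eq_zero_of_lt hij, Finset.sum_eq_zero]
    · simp
    · intro l hl
      have := Finset.mem_range.1 hl
      simp [show l ≠ i by omega]

/-- The variation of a curve in the direction of a jet coordinate. -/
theorem jetCurve_add_monomial {x : ℝ → Fin n → ℝ} {t : ℝ} (hx : ContDiffAt ℝ ∞ x t) (i : ℕ)
    (A : Fin n) (ε : ℝ) :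
    jetCurve m (fun s => x s + (ε * ((s - t) ^ i / (i.factorial : ℝ))) • Pi.single A (1 : ℝ)) t
      = jetCurve m x t + ε • vecQ i A := by
  refine Prod.ext (by simp [jetCurve, vecQ]) (funext fun j => ?_)
  have hj : (((j : ℕ) : ℕ∞) : ℕ∞ω) ≤ ∞ := by exact_mod_cast le_top
  have hm : ContDiff ℝ ∞ (fun s => ε * ((s - t) ^ i / (i.factorial : ℝ))) :=
    contDiff_const.mul (contDiff_monomial t i)
  have h := iteratedDeriv_add (n := j) (hx.of_le hj) ((hm.smul
    (contDiff_const (c := (Pi.single A (1 : ℝ) : Fin n → ℝ)))).contDiffAt.of_le hj)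
  refine h.trans ?_
  congr 1
  have h2 := iteratedDeriv_smul_const (hm.contDiffAt.of_le hj (x := t))
    (Pi.single A (1 : ℝ) : Fin n → ℝ)
  refine h2.trans ?_
  rw [iteratedDeriv_const_mul_field, iteratedDeriv_monomial]
  split_ifs with hji
  · simp [vecQ, hji]
  · simp [vecQ, hji]

/-- The functions `f` and `f'` on jets are related by the fibred transformation
`(t, q) ↦ (t, τ (t, q))`. -/
def JetRelated (U : Set (BaseModel n)) (τ : BaseModel n → Fin n → ℝ)
    (f f' : JetModel n k → ℝ) : Prop :=
  ∀ (I : Set ℝ) (x : ℝ → Fin n → ℝ), IsOpen I → ContDiffOn ℝ ∞ x I →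
    (∀ s ∈ I, ((s, x s) : BaseModel n) ∈ U) → ∀ t ∈ I,
      f (jetCurve k x t) = f' (jetCurve k (fun s => τ (s, x s)) t)

/-- The derivative of a fibred transformation in the direction `∂/∂q^A` along a curve. -/
def verticalDeriv (τ : BaseModel n → Fin n → ℝ) (x : ℝ → Fin n → ℝ) (A : Fin n) (s : ℝ) :
    Fin n → ℝ :=
  fderiv ℝ τ (s, x s) (0, Pi.single A 1)

variable {τ : BaseModel n → Fin n → ℝ} {x : ℝ → Fin n → ℝ} {I : Set ℝ}

theorem contDiffOn_graph (hx : ContDiffOn ℝ ∞ x I) :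
    ContDiffOn ℝ ∞ (fun s => ((s, x s) : BaseModel n)) I :=
  contDiffOn_id.prodMk hx

theorem contDiffOn_verticalDeriv (hU : IsOpen U) (hτ : ContDiffOn ℝ ∞ τ U)
    (hx : ContDiffOn ℝ ∞ x I) (hxU : ∀ s ∈ I, ((s, x s) : BaseModel n) ∈ U) (A : Fin n) :
    ContDiffOn ℝ ∞ (verticalDeriv τ x A) I :=
  ((hτ.fderiv_of_isOpen (m := ∞) hU (by simp)).comp (contDiffOn_graph hx) hxU).clm_apply
    contDiffOn_const

/-- Perturbing the curve by `ε (s - t)^i / i!` in direction `A` moves its jet at `t` along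
`∂/∂q_i^A`. Both sides are the derivative at `ε = 0` of the relation between `f` and `f'` along
these curves. The transformed curve varies by the monomial times `verticalDeriv`, whence the
binomial coefficients. -/
theorem partialQ_jetCurve_of_jetRelated (hU : IsOpen U) (hU' : IsOpen U')
    (hτ : ContDiffOn ℝ ∞ τ U) (hτU : ∀ y ∈ U, ((y.1, τ y) : BaseModel n) ∈ U')
    {f f' : JetModel n k → ℝ} (hf : ContDiffOn ℝ ∞ f (jetDomain U k))
    (hf' : ContDiffOn ℝ ∞ f' (jetDomain U' k)) (hff : JetRelated U τ f f')
    (hI : IsOpen I) (hx : ContDiffOn ℝ ∞ x I) (hxU : ∀ s ∈ I, ((s, x s) : BaseModel n) ∈ U)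
    (i : ℕ) (A : Fin n) {t : ℝ} (ht : t ∈ I) :
    partialQ f i A (jetCurve k x t) = ∑ j ∈ Finset.range (k + 1), ∑ B,
      (j.choose i : ℝ) * (partialQ f' j B (jetCurve k (fun s => τ (s, x s)) t) *
        iteratedDeriv (j - i) (fun s => verticalDeriv τ x A s B) t) := by
  set μ : ℝ → ℝ := fun s => (s - t) ^ i / (i.factorial : ℝ) with hμ
  set γ : ℝ × ℝ → BaseModel n := fun p => (p.2, x p.2 + (p.1 * μ p.2) • Pi.single A 1) with hγ
  have hγs : ContDiffOn ℝ ∞ γ (univ ×ˢ I) := by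
    have hx2 : ContDiffOn ℝ ∞ (fun p : ℝ × ℝ => x p.2) (univ ×ˢ I) :=
      hx.comp contDiff_snd.contDiffOn fun p hp => hp.2
    have hμ2 : ContDiff ℝ ∞ (fun p : ℝ × ℝ => p.1 * μ p.2) :=
      contDiff_fst.mul ((contDiff_monomial t i).comp contDiff_snd)
    exact contDiff_snd.contDiffOn.prodMk (hx2.add (hμ2.contDiffOn.smul contDiffOn_const))
  -- The perturbed curve may leave `U`; the slice of `V` at fixed `ε` is the open set of times on
  -- which it does not, and serves as its domain.
  set V : Set (ℝ × ℝ) := (univ ×ˢ I) ∩ γ ⁻¹' U with hV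
  have hVo : IsOpen V := hγs.continuousOn.isOpen_inter_preimage (isOpen_univ.prod hI) hU
  set G : ℝ × ℝ → Fin n → ℝ := fun p => τ (γ p) with hG
  have hGs : ContDiffOn ℝ ∞ G V := hτ.comp (hγs.mono inter_subset_left) fun p hp => hp.2
  have hγ0 : ∀ s, γ (0, s) = (s, x s) := by intro s; simp [hγ]
  have h0V : ∀ s ∈ I, ((0, s) : ℝ × ℝ) ∈ V := fun s hs =>
    ⟨⟨mem_univ _, hs⟩, by rw [mem_preimage, hγ0]; exact hxU s hs⟩
  -- the left-hand side as a derivative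
  have hline : HasDerivAt (fun ε : ℝ => jetCurve k x t + ε • (vecQ i A : JetModel n k))
      (vecQ i A) 0 := by
    simpa using ((hasDerivAt_id (0 : ℝ)).smul_const
      (vecQ i A : JetModel n k)).const_add (jetCurve k x t)
  have hfd : HasFDerivAt f (fderiv ℝ f (jetCurve k x t))
      (jetCurve k x t + (0 : ℝ) • (vecQ i A : JetModel n k)) := by
    simpa using (differentiableAt_of_jetDomain hU hf
      (jetCurve_mem_jetDomain.2 (hxU t ht))).hasFDerivAt
  have hL := hfd.comp_hasDerivAt (0 : ℝ) hline
  -- the right-hand side as a derivative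
  set c : ℝ → JetModel n k := fun ε => jetCurve k (fun s => G (ε, s)) t with hc
  have hc0 : c 0 = jetCurve k (fun s => τ (s, x s)) t := by simp [hc, hG, hγ0]
  have hcd : HasDerivAt c
      (0, fun j => iteratedDeriv (j : ℕ) (fun s => fderiv ℝ G (0, s) (1, 0)) t) 0 :=
    (hasDerivAt_const (0 : ℝ) t).prodMk (hasDerivAt_pi.2 fun j =>
      hasDerivAt_iteratedDeriv_param hVo hGs j (h0V t ht))
  have hfd' : HasFDerivAt f' (fderiv ℝ f' (c 0)) (c 0) := by
    refine (differentiableAt_of_jetDomain hU' hf' ?_).hasFDerivAt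
    rw [hc0, jetCurve_mem_jetDomain]
    exact hτU (t, x t) (hxU t ht)
  have hR := hfd'.comp_hasDerivAt (0 : ℝ) hcd
  have hev : (f ∘ fun ε : ℝ => jetCurve k x t + ε • (vecQ i A : JetModel n k))
      =ᶠ[𝓝 0] f' ∘ c := by
    have hεV : ∀ᶠ ε : ℝ in 𝓝 0, ((ε, t) : ℝ × ℝ) ∈ V :=
      (Continuous.prodMk_left t).continuousAt.preimage_mem_nhds (hVo.mem_nhds (h0V t ht))
    filter_upwards [hεV] with ε hε
    have hJ : IsOpen ((fun s : ℝ => ((ε, s) : ℝ × ℝ)) ⁻¹' V) :=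
      hVo.preimage (Continuous.prodMk_right ε)
    have := hff _ (fun s => x s + (ε * μ s) • Pi.single A 1) hJ ?_ (fun s hs => hs.2) t hε
    · rw [jetCurve_add_monomial (hx.contDiffAt (hI.mem_nhds ht))] at this
      exact this
    · exact (hx.mono fun s hs => hs.1.2).add ((contDiff_const.mul
        (contDiff_monomial t i)).contDiffOn.smul contDiffOn_const)
  have hmain := (hL.congr_of_eventuallyEq hev.symm).unique hR
  -- the variation of the transformed curve
  have hMs := contDiffOn_verticalDeriv hU hτ hx hxU A
  have hvar : EqOn (fun s => fderiv ℝ G (0, s) (1, 0)) (fun s => μ s • verticalDeriv τ x A s) I := by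
    intro s hs
    have h1 : HasDerivAt (fun ε : ℝ => γ (ε, s)) (0, μ s • Pi.single A 1) 0 := by
      refine (hasDerivAt_const _ _).prodMk ?_
      simpa using (((hasDerivAt_id (0 : ℝ)).mul_const (μ s)).smul_const
        (Pi.single A (1 : ℝ) : Fin n → ℝ)).const_add (x s)
    have h2 : HasFDerivAt τ (fderiv ℝ τ (s, x s)) (γ (0, s)) := by
      rw [hγ0]
      exact ((hτ.contDiffAt (hU.mem_nhds (hxU s hs))).differentiableAt (by simp)).hasFDerivAt
    have h3 := h2.comp_hasDerivAt (0 : ℝ) h1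
    have h4 : HasDerivAt (fun ε : ℝ => ((ε, s) : ℝ × ℝ)) (1, 0) 0 :=
      (hasDerivAt_id _).prodMk (hasDerivAt_const _ _)
    have h5 := (((hGs.contDiffAt (hVo.mem_nhds (h0V s hs))).differentiableAt
      (by simp)).hasFDerivAt).comp_hasDerivAt (0 : ℝ) (f := fun ε : ℝ => ((ε, s) : ℝ × ℝ)) h4
    have h6 := h5.unique h3
    refine h6.trans ?_
    change _ = μ s • fderiv ℝ τ (s, x s) (0, Pi.single A 1)
    rw [← map_smul]
    simp
  have hcoef : ∀ j B, iteratedDeriv j (fun s => fderiv ℝ G (0, s) (1, 0)) t B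
      = (j.choose i : ℝ) * iteratedDeriv (j - i) (fun s => verticalDeriv τ x A s B) t := by
    intro j B
    rw [iteratedDeriv_eqOn hI hvar j ht]
    have hMB : ContDiffOn ℝ ∞ (fun s => verticalDeriv τ x A s B) I :=
      (contDiff_apply ℝ ℝ B).comp_contDiffOn hMs
    rw [← iteratedDeriv_monomial_mul (hMB.contDiffAt (hI.mem_nhds ht))]
    exact iteratedDeriv_pi_apply hI ((contDiff_monomial t i).contDiffOn.smul hMs) j B ht
  rw [partialQ, hmain, eq_sum_vecQ
    ((0, fun j => iteratedDeriv (j : ℕ) (fun s => fderiv ℝ G (0, s) (1, 0)) t) : JetModel n k) rfl,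
    map_sum]
  refine Finset.sum_congr rfl fun j hj => ?_
  rw [map_sum]
  refine Finset.sum_congr rfl fun B _ => ?_
  have hj' : j ≤ k := by have := Finset.mem_range.1 hj; omega
  rw [map_smul, coordQ_of_le _ hj', hc0]
  dsimp only
  rw [hcoef, smul_eq_mul, partialQ]
  ring

/-- After inserting the transformation rule of the partial derivatives and exchanging the sums over
`i` and `j`, the inner sum is the formal adjoint of `g ↦ (g N)^{(j)}` applied to `∂f'/∂q_j^B`. By
the adjoint identity no derivative of `N = verticalDeriv` remains. -/
theorem eulerLagrangeCurve_of_jetRelated (hU : IsOpen U) (hU' : IsOpen U')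
    (hτ : ContDiffOn ℝ ∞ τ U) (hτU : ∀ y ∈ U, ((y.1, τ y) : BaseModel n) ∈ U')
    {f f' : JetModel n k → ℝ} (hf : ContDiffOn ℝ ∞ f (jetDomain U k))
    (hf' : ContDiffOn ℝ ∞ f' (jetDomain U' k)) (hff : JetRelated U τ f f')
    (hI : IsOpen I) (hx : ContDiffOn ℝ ∞ x I) (hxU : ∀ s ∈ I, ((s, x s) : BaseModel n) ∈ U)
    (A : Fin n) {t : ℝ} (ht : t ∈ I) :
    eulerLagrangeCurve f x A t =
      ∑ B, eulerLagrangeCurve f' (fun s => τ (s, x s)) B t * verticalDeriv τ x A t B := by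
  set x' : ℝ → Fin n → ℝ := fun s => τ (s, x s) with hx'
  have hx's : ContDiffOn ℝ ∞ x' I := hτ.comp (contDiffOn_graph hx) hxU
  have hP : ∀ j B, ContDiffOn ℝ ∞ (fun s => partialQ f' j B (jetCurve k x' s)) I := fun j B =>
    contDiffOn_comp_jetCurve (contDiffOn_partialQ hU' hf' j B) hI hx's
      fun s hs => hτU (s, x s) (hxU s hs)
  have hN : ∀ B, ContDiffOn ℝ ∞ (fun s => verticalDeriv τ x A s B) I := fun B =>
    (contDiff_apply ℝ ℝ B).comp_contDiffOn (contDiffOn_verticalDeriv hU hτ hx hxU A)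
  have h1 : ∀ i, iteratedDeriv i (fun s => partialQ f i A (jetCurve k x s)) t =
      ∑ j ∈ Finset.range (k + 1), ∑ B, (j.choose i : ℝ) * iteratedDeriv i (fun s =>
        partialQ f' j B (jetCurve k x' s) *
          iteratedDeriv (j - i) (fun s => verticalDeriv τ x A s B) s) t := by
    intro i
    have hi : ((i : ℕ∞) : ℕ∞ω) ≤ ∞ := by exact_mod_cast le_top
    have hsm : ∀ j B, ContDiffAt ℝ i (fun s => partialQ f' j B (jetCurve k x' s) *
          iteratedDeriv (j - i) (fun s => verticalDeriv τ x A s B) s) t := fun j B =>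
      (((hP j B).mul (contDiffOn_iteratedDeriv hI (hN B) (j - i))).contDiffAt
        (hI.mem_nhds ht)).of_le hi
    rw [iteratedDeriv_eqOn hI (fun s hs => partialQ_jetCurve_of_jetRelated hU hU' hτ hτU hf hf' hff
      hI hx hxU i A hs) i ht, iteratedDeriv_fun_sum fun j _ => ContDiffAt.sum fun B _ =>
        contDiffAt_const.mul (hsm j B)]
    refine Finset.sum_congr rfl fun j _ => ?_
    rw [iteratedDeriv_fun_sum fun B _ => contDiffAt_const.mul (hsm j B)]
    refine Finset.sum_congr rfl fun B _ => ?_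
    rw [iteratedDeriv_const_mul_field]
  simp only [eulerLagrangeCurve, h1, Finset.mul_sum, Finset.sum_mul]
  rw [Finset.sum_comm]
  simp_rw [Finset.sum_comm (s := Finset.range (k + 1)) (t := (Finset.univ : Finset (Fin n)))]
  refine Finset.sum_congr rfl fun B _ => Finset.sum_congr rfl fun j hj => ?_
  have hj' : j ≤ k := by have := Finset.mem_range.1 hj; omega
  rw [← sum_choose_iteratedDeriv_mul hI (hP j B) (hN B) j ht]
  have hsub : Finset.range (j + 1) ⊆ Finset.range (k + 1) :=
    Finset.range_mono (by omega)
  rw [← Finset.sum_subset hsub]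
  · refine Finset.sum_congr rfl fun i _ => ?_
    ring
  · intro i _ hi
    have : j < i := by rw [Finset.mem_range] at hi; omega
    simp [Nat.choose_eq_zero_of_lt this]

end Covariance

theorem eulerLagrangeCurve_congr {n k : ℕ} {f : JetModel n k → ℝ} {x y : ℝ → Fin n → ℝ}
    {I : Set ℝ} (hI : IsOpen I) (h : EqOn x y I) (A : Fin n) {t : ℝ} (ht : t ∈ I) :
    eulerLagrangeCurve f x A t = eulerLagrangeCurve f y A t := by
  refine Finset.sum_congr rfl fun i _ => ?_
  rw [iteratedDeriv_eqOn hI (fun s hs => by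
    rw [jetCurve_eqOn hI h hs]) i ht]

/-! ### Natural charts of the jet manifolds -/

section Charts

variable {n m : ℕ} {E : Type*} [TopologicalSpace E]
  [ChartedSpace (EuclideanSpace ℝ (Fin (n + 1))) E] {π : FibredManifold n E}

variable [IsManifold (𝓡 (n + 1)) ∞ E]

/-- The natural chart of the jet manifold as an open partial homeomorphism. -/
def AdaptedChart.jetHomeo (c : AdaptedChart π) (j₀ : Jet π m) :
    OpenPartialHomeomorph (Jet π m) (JetModel n m) :=
  (jetCore π m).openPartialHomeomorph (c.jetChart j₀) ⟨c, j₀, rfl⟩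

variable (c : AdaptedChart π) (j₀ : Jet π m)

theorem AdaptedChart.coe_jetHomeo : ⇑(c.jetHomeo j₀) = c.coords m := rfl

theorem AdaptedChart.coe_jetHomeo_symm : ⇑(c.jetHomeo j₀).symm = c.ofCoords j₀ := rfl

theorem AdaptedChart.jetHomeo_mem_atlas : c.jetHomeo j₀ ∈ atlas (JetModel n m) (Jet π m) := by
  change _ ∈ ⋃ (e : PartialEquiv (Jet π m) (JetModel n m)) (he : e ∈ (jetCore π m).atlas),
    {(jetCore π m).openPartialHomeomorph e he}
  simp only [mem_iUnion, mem_singleton_iff]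
  exact ⟨c.jetChart j₀, ⟨c, j₀, rfl⟩, rfl⟩

theorem AdaptedChart.jetHomeo_mem_maximalAtlas :
    c.jetHomeo j₀ ∈ IsManifold.maximalAtlas 𝓘(ℝ, JetModel n m) ∞ (Jet π m) :=
  IsManifold.subset_maximalAtlas (c.jetHomeo_mem_atlas j₀)

theorem AdaptedChart.mdifferentiable_jetHomeo :
    (c.jetHomeo j₀).MDifferentiable 𝓘(ℝ, JetModel n m) 𝓘(ℝ, JetModel n m) :=
  ⟨(contMDiffOn_of_mem_maximalAtlas (c.jetHomeo_mem_maximalAtlas j₀)).mdifferentiableOn (by simp),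
   (contMDiffOn_symm_of_mem_maximalAtlas
    (c.jetHomeo_mem_maximalAtlas j₀)).mdifferentiableOn (by simp)⟩

theorem AdaptedChart.isOpen_jetSource (m : ℕ) :
    IsOpen {p : Jet π m | p.toTotal ∈ c.chart.source} := by
  -- `jetHomeo` needs a jet as junk value of its inverse, so an empty jet space is treated apart.
  by_cases h : Nonempty (Jet π m)
  · exact (c.jetHomeo h.some).open_source
  · rw [not_nonempty_iff] at h
    exact isOpen_discrete _

theorem AdaptedChart.contMDiffAt_coords {p : Jet π m} (hp : p.toTotal ∈ c.chart.source) :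
    ContMDiffAt 𝓘(ℝ, JetModel n m) 𝓘(ℝ, JetModel n m) ∞ (c.coords m) p :=
  (contMDiffOn_of_mem_maximalAtlas (c.jetHomeo_mem_maximalAtlas p)).contMDiffAt
    ((c.jetHomeo p).open_source.mem_nhds hp)

theorem AdaptedChart.mdifferentiableAt_coords {p : Jet π m} (hp : p.toTotal ∈ c.chart.source) :
    MDifferentiableAt 𝓘(ℝ, JetModel n m) 𝓘(ℝ, JetModel n m) (c.coords m) p :=
  (c.contMDiffAt_coords hp).mdifferentiableAt (by simp)

theorem AdaptedChart.isInvertible_mfderiv_coords {p : Jet π m}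
    (hp : p.toTotal ∈ c.chart.source) :
    (mfderiv 𝓘(ℝ, JetModel n m) 𝓘(ℝ, JetModel n m) (c.coords m) p).IsInvertible :=
  ⟨(c.mdifferentiable_jetHomeo p).mfderiv (x := p) hp, rfl⟩

theorem AdaptedChart.bijective_mfderiv_coords {p : Jet π m}
    (hp : p.toTotal ∈ c.chart.source) :
    Function.Bijective (mfderiv 𝓘(ℝ, JetModel n m) 𝓘(ℝ, JetModel n m) (c.coords m) p) :=
  (c.mdifferentiable_jetHomeo p).mfderiv_bijective (x := p) hp

theorem AdaptedChart.chart_toTotal {p : Jet π m} (hp : p.toTotal ∈ c.chart.source) :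
    c.chart p.toTotal = ((c.coords m p).1, (c.coords m p).2 0) := by
  obtain ⟨φ, t, h, rfl⟩ := p.exists_rep
  exact (c.fst_coords h hp).symm

theorem AdaptedChart.coords_mem_jetDomain {p : Jet π m} (hp : p.toTotal ∈ c.chart.source) :
    c.coords m p ∈ jetDomain c.chart.target m := by
  change ((c.coords m p).1, (c.coords m p).2 0) ∈ c.chart.target
  rw [← c.chart_toTotal hp]
  exact c.chart.map_source hp

theorem AdaptedChart.fst_coords_eq_time {p : Jet π m} (hp : p.toTotal ∈ c.chart.source) :
    (c.coords m p).1 = p.time := by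
  obtain ⟨φ, t, h, rfl⟩ := p.exists_rep
  rw [c.coords_mk m h hp]; rfl

theorem AdaptedChart.eq_of_coords_eq {p q : Jet π m} (hp : p.toTotal ∈ c.chart.source)
    (hq : q.toTotal ∈ c.chart.source) (h : c.coords m p = c.coords m q) : p = q :=
  (c.jetHomeo p).injOn hp hq h

theorem Jet.continuous_toTotal : Continuous (Jet.toTotal : Jet π m → E) := by
  rw [continuous_iff_continuousAt]
  intro p
  obtain ⟨c, hc⟩ := exists_adaptedChart π p.toTotal
  have hcc : ContinuousAt (c.coords m) p := (c.contMDiffAt_coords hc).continuousAt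
  have h2 : ContinuousAt (fun q => (((c.coords m q).1, (c.coords m q).2 0) : BaseModel n)) p :=
    (by fun_prop : Continuous fun x : JetModel n m =>
      ((x.1, x.2 0) : BaseModel n)).continuousAt.comp hcc
  have h3 : ContinuousAt c.chart.symm (((c.coords m p).1, (c.coords m p).2 0) : BaseModel n) :=
    c.chart.symm.continuousAt (c.coords_mem_jetDomain hc)
  refine (ContinuousAt.comp (f := fun q =>
    (((c.coords m q).1, (c.coords m q).2 0) : BaseModel n)) h3 h2).congr ?_
  filter_upwards [(c.isOpen_jetSource m).mem_nhds hc] with q hq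
  change c.chart.symm ((c.coords m q).1, (c.coords m q).2 0) = _
  rw [← c.chart_toTotal hq, c.chart.left_inv hq]

theorem Jet.exists_toTotal_eq (e : E) : ∃ p : Jet π m, p.toTotal = e := by
  obtain ⟨c, hc⟩ := exists_adaptedChart π e
  let x : JetModel n m := ((c.chart e).1, fun _ => (c.chart e).2)
  have hx : ((x.1, x.2 0) : BaseModel n) ∈ c.chart.target := c.chart.map_source hc
  refine ⟨c.jetOfCoords x hx, ?_⟩
  change c.chart.symm (AdaptedChart.taylorCurve x x.1) = e
  rw [AdaptedChart.taylorCurve_self]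
  exact c.chart.left_inv hc

/-- Jets over the same point of `E` share a natural chart and are separated by their coordinates;
jets over different points are separated in `E`. Together with second countability this makes
partitions of unity available. -/
instance [T2Space E] : T2Space (Jet π m) := by
  refine ⟨fun p q hpq => ?_⟩
  by_cases h : p.toTotal = q.toTotal
  · obtain ⟨c, hc⟩ := exists_adaptedChart π p.toTotal
    have hc' : q.toTotal ∈ c.chart.source := h ▸ hc
    obtain ⟨u, v, hu, hv, hpu, hqv, huv⟩ :=
      t2_separation fun hcpq => hpq (c.eq_of_coords_eq hc hc' hcpq)
    refine ⟨_, _, (c.jetHomeo p).isOpen_inter_preimage hu, (c.jetHomeo p).isOpen_inter_preimage hv,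
      ⟨hc, hpu⟩, ⟨hc', hqv⟩, ?_⟩
    exact (huv.preimage _).mono inter_subset_right inter_subset_right
  · obtain ⟨u, v, hu, hv, hpu, hqv, huv⟩ := t2_separation h
    exact ⟨_, _, hu.preimage Jet.continuous_toTotal, hv.preimage Jet.continuous_toTotal,
      hpu, hqv, huv.preimage _⟩

instance [SecondCountableTopology E] : SecondCountableTopology (Jet π m) := by
  obtain ⟨s, hs, hsu⟩ := TopologicalSpace.countable_cover_nhds
    (f := fun e : E => (adaptedChartAt π e).chart.source)
    fun e => (adaptedChartAt π e).chart.open_source.mem_nhds (mem_adaptedChartAt_source e)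
  -- A jet over `e` indexes the natural chart whose domain is the full preimage of the chosen chart
  -- domain around `e`.
  choose j hj using fun e : E => Jet.exists_toTotal_eq (π := π) (m := m) e
  refine ChartedSpace.secondCountable_of_countable_cover (JetModel n m) (s := j '' s) ?_
    (hs.image j)
  rw [eq_univ_iff_forall]
  intro p
  have hp : p.toTotal ∈ ⋃ e ∈ s, (adaptedChartAt π e).chart.source := hsu ▸ mem_univ _
  simp only [mem_iUnion] at hp
  obtain ⟨e, he, hpe⟩ := hp
  simp only [mem_iUnion]
  refine ⟨j e, mem_image_of_mem j he, ?_⟩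
  change p.toTotal ∈ (adaptedChartAt π (j e).toTotal).chart.source
  rwa [hj e]

instance [SecondCountableTopology E] : SigmaCompactSpace (Jet π m) :=
  have := ChartedSpace.locallyCompactSpace (JetModel n m) (Jet π m)
  inferInstance

/-! #### Functions on jets in coordinates -/

theorem AdaptedChart.localRep_coords (L : Jet π m → ℝ) {p : Jet π m}
    (hp : p.toTotal ∈ c.chart.source) : c.localRep L (c.coords m p) = L p := by
  have h : (((c.coords m p).1, (c.coords m p).2 0) : BaseModel n) ∈ c.chart.target :=
    c.coords_mem_jetDomain hp
  rw [AdaptedChart.localRep, dif_pos h]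
  congr 1
  have := (c.jetHomeo p).left_inv hp
  rw [coe_jetHomeo_symm, coe_jetHomeo, AdaptedChart.ofCoords, dif_pos h] at this
  exact this

theorem AdaptedChart.contDiffOn_localRep {L : Jet π m → ℝ}
    (hL : ContMDiff 𝓘(ℝ, JetModel n m) 𝓘(ℝ, ℝ) ∞ L) :
    ContDiffOn ℝ ∞ (c.localRep L) (jetDomain c.chart.target m) := by
  intro x hx
  have hj : Jet π m := c.jetOfCoords x hx
  have h := contMDiffOn_symm_of_mem_maximalAtlas (c.jetHomeo_mem_maximalAtlas hj)
  have h2 : ContDiffOn ℝ ∞ (L ∘ (c.jetHomeo hj).symm) (jetDomain c.chart.target m) :=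
    (hL.comp_contMDiffOn h).contDiffOn
  refine (h2.congr fun y hy => ?_) x hx
  have hy' : ((y.1, y.2 0) : BaseModel n) ∈ c.chart.target := hy
  rw [Function.comp_apply, coe_jetHomeo_symm, AdaptedChart.ofCoords, AdaptedChart.localRep,
    dif_pos hy', dif_pos hy']

/-! #### Sections in coordinates -/

/-- The fibre coordinates of a curve in the total space. -/
def AdaptedChart.fibreCurve (c : AdaptedChart π) (χ : ℝ → E) (s : ℝ) : Fin n → ℝ :=
  (c.chart (χ s)).2

theorem AdaptedChart.mk_fibreCurve {χ : ℝ → E} {t : ℝ} (h : IsLocalSection π χ t)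
    (hc : χ t ∈ c.chart.source) : ((t, c.fibreCurve χ t) : BaseModel n) = c.chart (χ t) :=
  Prod.ext (by rw [c.fst_eq _ hc, h.proj_eq]) rfl

theorem IsLocalSection.exists_isOpen {χ : ℝ → E} {t : ℝ} (h : IsLocalSection π χ t)
    (hc : χ t ∈ c.chart.source) : ∃ I : Set ℝ, IsOpen I ∧ t ∈ I ∧
      ∀ s ∈ I, IsLocalSection π χ s ∧ χ s ∈ c.chart.source := by
  have h1 : ∀ᶠ s in 𝓝 t, IsLocalSection π χ s := eventually_eventually_nhds.2 h
  have h2 : ∀ᶠ s in 𝓝 t, χ s ∈ c.chart.source :=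
    h.contMDiffAt.continuousAt.preimage_mem_nhds (c.chart.open_source.mem_nhds hc)
  obtain ⟨I, hI, hIo, ht⟩ := mem_nhds_iff.1 (h1.and h2)
  exact ⟨I, hIo, ht, fun s hs => hI hs⟩

theorem AdaptedChart.contDiffOn_fibreCurve {χ : ℝ → E} {I : Set ℝ}
    (h : ∀ s ∈ I, IsLocalSection π χ s ∧ χ s ∈ c.chart.source) :
    ContDiffOn ℝ ∞ (c.fibreCurve χ) I := fun s hs =>
  (contDiffAt_snd.comp s (c.contDiffAt_comp (h s hs).1 (h s hs).2)).contDiffWithinAt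

theorem AdaptedChart.coords_mk_eq_jetCurve {χ : ℝ → E} {t : ℝ} (h : IsLocalSection π χ t)
    (hc : χ t ∈ c.chart.source) :
    c.coords m (Jet.mk m χ t h) = jetCurve m (c.fibreCurve χ) t :=
  c.coords_mk m h hc

/-- A curve in coordinates as a section. -/
theorem AdaptedChart.isLocalSection_symm {x : ℝ → Fin n → ℝ} {I : Set ℝ} (hI : IsOpen I)
    (hx : ContDiffOn ℝ ∞ x I) (hxc : ∀ s ∈ I, ((s, x s) : BaseModel n) ∈ c.chart.target)
    {t : ℝ} (ht : t ∈ I) : IsLocalSection π (fun s => c.chart.symm (s, x s)) t := by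
  filter_upwards [hI.mem_nhds ht] with s hs
  refine ⟨?_, ?_⟩
  · rw [← c.fst_eq _ (c.chart.map_target (hxc s hs)), c.chart.right_inv (hxc s hs)]
  · exact (c.smooth_symm.contMDiffAt (c.chart.open_target.mem_nhds (hxc s hs))).comp s
      ((contDiffOn_graph hx).contDiffAt (hI.mem_nhds hs)).contMDiffAt

theorem AdaptedChart.fibreCurve_symm {x : ℝ → Fin n → ℝ} {I : Set ℝ}
    (hxc : ∀ s ∈ I, ((s, x s) : BaseModel n) ∈ c.chart.target) :
    EqOn (c.fibreCurve fun s => c.chart.symm (s, x s)) x I := by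
  intro s hs
  rw [AdaptedChart.fibreCurve, c.chart.right_inv (hxc s hs)]

/-- The change of fibre coordinates. -/
def AdaptedChart.fibreTransition (c c' : AdaptedChart π) (y : BaseModel n) : Fin n → ℝ :=
  (c'.chart (c.chart.symm y)).2

theorem AdaptedChart.contDiffOn_fibreTransition (c c' : AdaptedChart π) :
    ContDiffOn ℝ ∞ (c.fibreTransition c') (c.chart.symm.trans c'.chart).source := by
  have h1 : ContMDiffOn 𝓘(ℝ, BaseModel n) 𝓘(ℝ, BaseModel n) ∞ (c'.chart ∘ c.chart.symm)
      (c.chart.symm.trans c'.chart).source := by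
    refine c'.smooth.comp (c.smooth_symm.mono ?_) ?_
    · intro x hx; simp at hx; exact hx.1
    · intro x hx; simp at hx; exact hx.2
  exact contDiff_snd.comp_contDiffOn (contMDiffOn_iff_contDiffOn.1 h1)

theorem AdaptedChart.mk_fibreTransition_mem (c c' : AdaptedChart π) {y : BaseModel n}
    (hy : y ∈ (c.chart.symm.trans c'.chart).source) :
    ((y.1, c.fibreTransition c' y) : BaseModel n) ∈ c'.chart.target := by
  simp only [OpenPartialHomeomorph.trans_source, OpenPartialHomeomorph.symm_source, mem_inter_iff,
    mem_preimage] at hy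
  have : ((y.1, c.fibreTransition c' y) : BaseModel n) = c'.chart (c.chart.symm y) := by
    refine Prod.ext ?_ rfl
    rw [c'.fst_eq _ hy.2, ← c.fst_eq _ (c.chart.map_target hy.1), c.chart.right_inv hy.1]
  rw [this]
  exact c'.chart.map_source hy.2

/-- Both sides are the value of `L` at one jet, read in two charts. -/
theorem AdaptedChart.jetRelated_localRep (c c' : AdaptedChart π) (L : Jet π m → ℝ) :
    JetRelated (c.chart.symm.trans c'.chart).source (c.fibreTransition c')
      (c.localRep L) (c'.localRep L) := by
  intro I x hI hx hxU t ht
  have hxU' : ∀ s ∈ I, ((s, x s) : BaseModel n) ∈ c.chart.target ∧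
      c.chart.symm (s, x s) ∈ c'.chart.source := by
    intro s hs
    simpa using hxU s hs
  have hxc := fun s hs => (hxU' s hs).1
  have h := c.isLocalSection_symm hI hx hxc ht
  have h1 := c.coords_mk_eq_jetCurve (m := m) h (c.chart.map_target (hxc t ht))
  have h2 := c'.coords_mk_eq_jetCurve (m := m) h (hxU' t ht).2
  rw [jetCurve_eqOn hI (c.fibreCurve_symm hxc) ht] at h1
  rw [← h1, c.localRep_coords L (p := Jet.mk m _ t h) (c.chart.map_target (hxc t ht)),
    ← c'.localRep_coords L (p := Jet.mk m _ t h) (hxU' t ht).2, h2]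
  rfl

/-- The Euler-Lagrange equations at a point do not depend on the natural coordinates. -/
theorem eulerLagrangeCurve_eq_zero_of_chart {L : Jet π m → ℝ}
    (hL : ContMDiff 𝓘(ℝ, JetModel n m) 𝓘(ℝ, ℝ) ∞ L) (c c' : AdaptedChart π) {χ : ℝ → E} {t : ℝ}
    (h : IsLocalSection π χ t) (hc : χ t ∈ c.chart.source) (hc' : χ t ∈ c'.chart.source)
    (hEL : ∀ A, eulerLagrangeCurve (c'.localRep L) (c'.fibreCurve χ) A t = 0) (A : Fin n) :
    eulerLagrangeCurve (c.localRep L) (c.fibreCurve χ) A t = 0 := by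
  obtain ⟨I, hI, ht, hIc⟩ := h.exists_isOpen c hc
  obtain ⟨I', hI', ht', hIc'⟩ := h.exists_isOpen c' hc'
  set J := I ∩ I' with hJ
  have hJo : IsOpen J := hI.inter hI'
  set U := (c.chart.symm.trans c'.chart).source with hU
  have hUo : IsOpen U := (c.chart.symm.trans c'.chart).open_source
  have hx : ContDiffOn ℝ ∞ (c.fibreCurve χ) J := c.contDiffOn_fibreCurve fun s hs => hIc s hs.1
  have hxs : ∀ s ∈ J, ((s, c.fibreCurve χ s) : BaseModel n) = c.chart (χ s) := fun s hs =>
    c.mk_fibreCurve (hIc s hs.1).1 (hIc s hs.1).2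
  have hxU : ∀ s ∈ J, ((s, c.fibreCurve χ s) : BaseModel n) ∈ U := by
    intro s hs
    rw [hxs s hs]
    simp [hU, c.chart.left_inv (hIc s hs.1).2, c.chart.map_source (hIc s hs.1).2,
      (hIc' s hs.2).2]
  have hf : ContDiffOn ℝ ∞ (c.localRep L) (jetDomain U m) :=
    (c.contDiffOn_localRep hL).mono fun x hx => by
      have : ((x.1, x.2 0) : BaseModel n) ∈ U := hx
      simp [hU] at this
      exact this.1
  have hcov := eulerLagrangeCurve_of_jetRelated hUo c'.chart.open_target
    (c.contDiffOn_fibreTransition c') (fun y hy => c.mk_fibreTransition_mem c' hy) hf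
    (c'.contDiffOn_localRep hL) (c.jetRelated_localRep c' L) hJo hx hxU A
    (⟨ht, ht'⟩ : t ∈ J)
  rw [hcov]
  have heq : EqOn (fun s => c.fibreTransition c' (s, c.fibreCurve χ s)) (c'.fibreCurve χ) J := by
    intro s hs
    dsimp only
    rw [hxs s hs, AdaptedChart.fibreTransition, c.chart.left_inv (hIc s hs.1).2]
    rfl
  refine Finset.sum_eq_zero fun B _ => ?_
  rw [eulerLagrangeCurve_congr hJo heq B ⟨ht, ht'⟩, hEL, zero_mul]

end Charts

/-! ### Velocities of prolongations -/

section Spray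

variable {n m k : ℕ} {E : Type*} [TopologicalSpace E]
  [ChartedSpace (EuclideanSpace ℝ (Fin (n + 1))) E] {π : FibredManifold n E}
  [IsManifold (𝓡 (n + 1)) ∞ E]

/-- The differential of natural coordinates. -/
def AdaptedChart.dcoords (c : AdaptedChart π) (p : Jet π m) :
    TangentSpace 𝓘(ℝ, JetModel n m) p →L[ℝ] JetModel n m :=
  mfderiv 𝓘(ℝ, JetModel n m) 𝓘(ℝ, JetModel n m) (c.coords m) p

theorem mdifferentiableAt_of_coords (c : AdaptedChart π) {ψ : ℝ → Jet π m} {t : ℝ}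
    (hψ : ∀ᶠ s in 𝓝 t, (ψ s).toTotal ∈ c.chart.source)
    (h : DifferentiableAt ℝ (fun s => c.coords m (ψ s)) t) :
    MDifferentiableAt 𝓘(ℝ, ℝ) 𝓘(ℝ, JetModel n m) ψ t := by
  have h1 : MDifferentiableAt 𝓘(ℝ, JetModel n m) 𝓘(ℝ, JetModel n m) (c.jetHomeo (ψ t)).symm
      (c.coords m (ψ t)) :=
    (c.mdifferentiable_jetHomeo (ψ t)).mdifferentiableAt_symm
      (c.coords_mem_jetDomain hψ.self_of_nhds)
  refine (MDifferentiableAt.comp t h1 h.mdifferentiableAt).congr_of_eventuallyEq ?_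
  filter_upwards [hψ] with s hs
  exact ((c.jetHomeo (ψ t)).left_inv hs).symm

theorem hasDerivAt_coords (c : AdaptedChart π) {ψ : ℝ → Jet π m} {t : ℝ}
    {v : TangentSpace 𝓘(ℝ, JetModel n m) (ψ t)}
    (h : HasMFDerivAt 𝓘(ℝ, ℝ) 𝓘(ℝ, JetModel n m) ψ t ((1 : ℝ →L[ℝ] ℝ).smulRight v))
    (hc : (ψ t).toTotal ∈ c.chart.source) :
    HasDerivAt (fun s => c.coords m (ψ s)) (c.dcoords (ψ t) v) t := by
  have h1 := (c.mdifferentiableAt_coords hc).hasMFDerivAt.comp t h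
  have h2 : HasFDerivAt (fun s => c.coords m (ψ s))
    ((1 : ℝ →L[ℝ] ℝ).smulRight (c.dcoords (ψ t) v)) t := by
    refine HasFDerivAt.congr_fderiv h1.hasFDerivAt (ContinuousLinearMap.ext fun r => ?_)
    exact (c.dcoords (ψ t)).map_smul r v
  simpa using h2.hasDerivAt

theorem hasMFDerivAt_velocity {ψ : ℝ → Jet π m} {t : ℝ}
    (h : MDifferentiableAt 𝓘(ℝ, ℝ) 𝓘(ℝ, JetModel n m) ψ t) :
    HasMFDerivAt 𝓘(ℝ, ℝ) 𝓘(ℝ, JetModel n m) ψ t ((1 : ℝ →L[ℝ] ℝ).smulRight (velocity ψ t)) := by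
  have e : (1 : ℝ →L[ℝ] ℝ).smulRight (velocity ψ t)
      = mfderiv 𝓘(ℝ, ℝ) 𝓘(ℝ, JetModel n m) ψ t := by
    refine ContinuousLinearMap.ext fun r => ?_
    have h1 := (mfderiv 𝓘(ℝ, ℝ) 𝓘(ℝ, JetModel n m) ψ t).map_smul (r : ℝ) (1 : ℝ)
    refine h1.symm.trans (congrArg _ ?_)
    exact mul_one (r : ℝ)
  rw [e]
  exact h.hasMFDerivAt

/-- A tangent vector of a jet manifold which is the velocity of the prolongation of a local
section. -/
def IsSprayVector (p : Jet π m) (v : TangentSpace 𝓘(ℝ, JetModel n m) p) : Prop :=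
  ∃ (χ : ℝ → E) (t : ℝ) (h : IsLocalSection π χ t), Jet.mk m χ t h = p ∧
    ∀ c : AdaptedChart π, p.toTotal ∈ c.chart.source →
      c.dcoords p v = sprayVec (c.coords m p) (iteratedDeriv (m + 1) (c.fibreCurve χ) t)

theorem hasDerivAt_coords_of_eventually (c : AdaptedChart π) {χ : ℝ → E} {t : ℝ}
    (h : IsLocalSection π χ t) (hc : χ t ∈ c.chart.source) {ψ : ℝ → Jet π m}
    (hψ : ∀ᶠ s in 𝓝 t, ∃ hs : IsLocalSection π χ s, ψ s = Jet.mk m χ s hs) :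
    HasDerivAt (fun s => c.coords m (ψ s))
      (sprayVec (c.coords m (ψ t)) (iteratedDeriv (m + 1) (c.fibreCurve χ) t)) t := by
  obtain ⟨I, hI, ht, hIc⟩ := h.exists_isOpen c hc
  have h1 := hasDerivAt_jetCurve (m := m) hI (c.contDiffOn_fibreCurve hIc) ht
  have hev : (fun s => c.coords m (ψ s)) =ᶠ[𝓝 t] jetCurve m (c.fibreCurve χ) := by
    filter_upwards [hψ, hI.mem_nhds ht] with s ⟨hs, hs'⟩ hsI
    rw [hs']
    exact c.coords_mk_eq_jetCurve hs (hIc s hsI).2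
  have h2 := hev.self_of_nhds
  dsimp only at h2
  rw [h2]
  exact h1.congr_of_eventuallyEq hev

theorem mdifferentiableAt_of_eventually {χ : ℝ → E} {t : ℝ}
    (h : IsLocalSection π χ t) {ψ : ℝ → Jet π m}
    (hψ : ∀ᶠ s in 𝓝 t, ∃ hs : IsLocalSection π χ s, ψ s = Jet.mk m χ s hs) :
    MDifferentiableAt 𝓘(ℝ, ℝ) 𝓘(ℝ, JetModel n m) ψ t := by
  obtain ⟨c, hc⟩ := exists_adaptedChart π (χ t)
  refine mdifferentiableAt_of_coords c ?_
    (hasDerivAt_coords_of_eventually c h hc hψ).differentiableAt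
  obtain ⟨I, hI, ht, hIc⟩ := h.exists_isOpen c hc
  filter_upwards [hψ, hI.mem_nhds ht] with s ⟨hs, hs'⟩ hsI
  rw [hs']
  exact (hIc s hsI).2

theorem dcoords_velocity {χ : ℝ → E} {t : ℝ}
    (h : IsLocalSection π χ t) {ψ : ℝ → Jet π m}
    (hψ : ∀ᶠ s in 𝓝 t, ∃ hs : IsLocalSection π χ s, ψ s = Jet.mk m χ s hs)
    (c : AdaptedChart π) (hc : (ψ t).toTotal ∈ c.chart.source) :
    c.dcoords (ψ t) (velocity ψ t)
      = sprayVec (c.coords m (ψ t)) (iteratedDeriv (m + 1) (c.fibreCurve χ) t) := by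
  have hχc : χ t ∈ c.chart.source := by
    obtain ⟨hs, hs'⟩ := hψ.self_of_nhds
    rw [hs'] at hc; exact hc
  exact (hasDerivAt_coords c
    (hasMFDerivAt_velocity (mdifferentiableAt_of_eventually h hψ)) hc).unique
    (hasDerivAt_coords_of_eventually c h hχc hψ)

/-- A vector of the form `∂_t + ∑ q_{i+1} ∂/∂q_i + u ∂/∂q_m` in one natural chart is the velocity
of the prolongation of a local section. -/
theorem exists_section_of_dcoords_eq (c : AdaptedChart π) {p : Jet π m}
    (hp : p.toTotal ∈ c.chart.source) {v : TangentSpace 𝓘(ℝ, JetModel n m) p} {u : Fin n → ℝ}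
    (hv : c.dcoords p v = sprayVec (c.coords m p) u) :
    IsSprayVector p v := by
  obtain ⟨χ, t, h, hpe, hu⟩ : ∃ (χ : ℝ → E) (t : ℝ) (h : IsLocalSection π χ t),
      Jet.mk m χ t h = p ∧ iteratedDeriv (m + 1) (c.fibreCurve χ) t = u := by
    -- Append `u` as the derivative of order `m + 1` and take the Taylor polynomial with these
    -- coefficients as the section.
    let x : JetModel n (m + 1) := ((c.coords m p).1,
      fun i => if hi : (i : ℕ) < m + 1 then (c.coords m p).2 ⟨i, hi⟩ else u)
    have hx : ((x.1, x.2 0) : BaseModel n) ∈ c.chart.target := by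
      have e : x.2 0 = (c.coords m p).2 0 := by simp [x]
      rw [e]
      exact c.coords_mem_jetDomain hp
    have h := c.isLocalSection_taylor hx
    have hs : c.chart.symm (AdaptedChart.taylorCurve x x.1) ∈ c.chart.source := by
      rw [AdaptedChart.taylorCurve_self]; exact c.chart.map_target hx
    have h1 := c.coords_taylor hx
    rw [c.coords_mk_eq_jetCurve h hs] at h1
    have h2 : ∀ i : Fin (m + 2), iteratedDeriv (i : ℕ) (c.fibreCurve
        fun s => c.chart.symm (AdaptedChart.taylorCurve x s)) x.1 = x.2 i := fun i =>
      congrFun (congrArg Prod.snd h1) i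
    refine ⟨_, x.1, h, c.eq_of_coords_eq hs hp ?_, ?_⟩
    · rw [c.coords_mk_eq_jetCurve h hs]
      refine Prod.ext rfl (funext fun i => ?_)
      have := h2 (Fin.castSucc i)
      simpa [x, jetCurve, show (i : ℕ) ≤ m by omega] using this
    · have := h2 (Fin.last (m + 1))
      simpa [x] using this
  subst hpe
  have hψ0 : ∃ ψ : ℝ → Jet π m, ∀ᶠ s in 𝓝 t, ∃ hs : IsLocalSection π χ s,
      ψ s = Jet.mk m χ s hs := by
    classical
    refine ⟨fun s => if hs : IsLocalSection π χ s then Jet.mk m χ s hs else Jet.mk m χ t h, ?_⟩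
    filter_upwards [eventually_eventually_nhds.2 h] with s hs
    exact ⟨hs, dif_pos hs⟩
  obtain ⟨ψ, hψ⟩ := hψ0
  have hψt : ψ t = Jet.mk m χ t h := hψ.self_of_nhds.choose_spec
  -- In the chart `c` the given vector and the velocity of the prolongation have equal coordinates,
  -- so they coincide, and every other chart reads the velocity in the required form. The point `q`
  -- is kept variable in order to substitute `ψ t` for it inside the dependent tangent space.
  have key : ∀ (q : Jet π m) (w : TangentSpace 𝓘(ℝ, JetModel n m) q), q.toTotal ∈ c.chart.source →
      c.dcoords q w = sprayVec (c.coords m q) u → ψ t = q →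
      ∀ c' : AdaptedChart π, q.toTotal ∈ c'.chart.source → c'.dcoords q w =
        sprayVec (c'.coords m q) (iteratedDeriv (m + 1) (c'.fibreCurve χ) t) := by
    rintro q w hq hw rfl c' hc'
    have h1 := dcoords_velocity h hψ c hq
    rw [hu, ← hw] at h1
    rw [← (c.bijective_mfderiv_coords hq).1 h1]
    exact dcoords_velocity h hψ c' hc'
  exact ⟨χ, t, h, rfl, key _ v hp hv hψt⟩

theorem IsSprayVector.exists_dcoords_eq {p : Jet π m} {v : TangentSpace 𝓘(ℝ, JetModel n m) p}
    (h : IsSprayVector p v) (c : AdaptedChart π) (hc : p.toTotal ∈ c.chart.source) :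
    ∃ u, c.dcoords p v = sprayVec (c.coords m p) u := by
  obtain ⟨χ, t, _, _, h⟩ := h
  exact ⟨_, h c hc⟩

/-- In one chart the spray vectors are the `sprayVec` with arbitrary `u`, an affine subspace. -/
theorem convex_isSprayVector (p : Jet π m) : Convex ℝ {v | IsSprayVector p v} := by
  intro v hv w hw a b _ _ hab
  obtain ⟨c, hc⟩ := exists_adaptedChart π p.toTotal
  obtain ⟨u, hu⟩ := hv.exists_dcoords_eq c hc
  obtain ⟨u', hu'⟩ := hw.exists_dcoords_eq c hc
  refine exists_section_of_dcoords_eq c hc (u := a • u + b • u') ?_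
  rw [map_add, map_smul, map_smul, hu, hu', sprayVec_add_smul _ _ _ hab]

/-! #### Vector fields in coordinates -/

/-- Near `p` the field `X` is the pull-back by the natural coordinates of the field `G` on the model
space. -/
theorem contMDiffAt_of_dcoords (c : AdaptedChart π) {X : (p : Jet π m) → TangentSpace 𝓘(ℝ, JetModel n m) p}
    {G : JetModel n m → JetModel n m} {p : Jet π m} (hp : p.toTotal ∈ c.chart.source)
    (hG : ContDiffAt ℝ ∞ G (c.coords m p))
    (hX : ∀ᶠ q in 𝓝 p, c.dcoords q (X q) = G (c.coords m q)) :
    ContMDiffAt 𝓘(ℝ, JetModel n m) 𝓘(ℝ, JetModel n m).tangent ∞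
      (fun q => (⟨q, X q⟩ : TangentBundle 𝓘(ℝ, JetModel n m) (Jet π m))) p := by
  have h1 : ContMDiffAt 𝓘(ℝ, JetModel n m) 𝓘(ℝ, JetModel n m).tangent ∞
      (fun x => (⟨x, G x⟩ : TangentBundle 𝓘(ℝ, JetModel n m) (JetModel n m))) (c.coords m p) :=
    contMDiffAt_vectorSpace_iff_contDiffAt.2 hG
  have h2 := ContMDiffAt.mpullback_vectorField_preimage (m := ∞) (n := ∞) h1
    (c.contMDiffAt_coords hp) (c.isInvertible_mfderiv_coords hp) (by simp)
  refine h2.congr_of_eventuallyEq ?_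
  filter_upwards [hX, (c.isOpen_jetSource m).mem_nhds hp] with q hq hqc
  refine congrArg (Bundle.TotalSpace.mk q) ?_
  obtain ⟨e, he⟩ := c.isInvertible_mfderiv_coords hqc
  have h3 : e (X q) = G (c.coords m q) := by
    rw [← hq]
    exact DFunLike.congr_fun he (X q)
  change X q = (mfderiv 𝓘(ℝ, JetModel n m) 𝓘(ℝ, JetModel n m) (c.coords m) q).inverse
    (G (c.coords m q))
  rw [← he, ContinuousLinearMap.inverse_equiv, ← h3]
  exact (e.symm_apply_apply _).symm

/-- The coordinate expression of `X` is its pull-back by the inverse chart; this lets integral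
curves be studied as solutions of an autonomous ODE. -/
theorem contDiffOn_dcoords (c : AdaptedChart π) (j₀ : Jet π m)
    {X : (p : Jet π m) → TangentSpace 𝓘(ℝ, JetModel n m) p} (hX : IsSmoothVectorField X) :
    ContDiffOn ℝ ∞ (fun x => c.dcoords (c.ofCoords j₀ x) (X (c.ofCoords j₀ x)))
      (jetDomain c.chart.target m) := by
  intro x hx
  have hx' : c.ofCoords j₀ x ∈ (c.jetHomeo j₀).source := (c.jetHomeo j₀).map_target hx
  have hs : ContMDiffAt 𝓘(ℝ, JetModel n m) 𝓘(ℝ, JetModel n m) ∞ (c.ofCoords j₀) x :=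
    (contMDiffOn_symm_of_mem_maximalAtlas (c.jetHomeo_mem_maximalAtlas j₀)).contMDiffAt
      ((c.jetHomeo j₀).open_target.mem_nhds hx)
  have hinv : ∀ y ∈ jetDomain c.chart.target m,
      (mfderiv 𝓘(ℝ, JetModel n m) 𝓘(ℝ, JetModel n m) (c.ofCoords j₀) y).inverse
        = c.dcoords (c.ofCoords j₀ y) := by
    intro y hy
    exact (ContinuousLinearMap.inverse_equiv
      ((c.mdifferentiable_jetHomeo j₀).symm.mfderiv (x := y) hy)).trans rfl
  have hinv' : (mfderiv 𝓘(ℝ, JetModel n m) 𝓘(ℝ, JetModel n m) (c.ofCoords j₀) x).IsInvertible :=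
    ⟨(c.mdifferentiable_jetHomeo j₀).symm.mfderiv (x := x) hx, rfl⟩
  have h2 := ContMDiffAt.mpullback_vectorField_preimage (m := ∞) (n := ∞)
    (hX (c.ofCoords j₀ x)) hs hinv' (by simp)
  have h3 := contMDiffAt_vectorSpace_iff_contDiffAt.1 h2
  refine (h3.congr_of_eventuallyEq ?_).contDiffWithinAt
  filter_upwards [(c.jetHomeo j₀).open_target.mem_nhds hx] with y hy
  rw [VectorField.mpullback_apply, hinv y hy]
  rfl

end Spray

section Dynamics

variable {n m k : ℕ} {E : Type*} [TopologicalSpace E]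
  [ChartedSpace (EuclideanSpace ℝ (Fin (n + 1))) E] {π : FibredManifold n E}
  [IsManifold (𝓡 (n + 1)) ∞ E]

/-! ### The Poincaré-Cartan form and the Euler-Lagrange equations -/

theorem injective_dcoords (c : AdaptedChart π) {p : Jet π m} (hp : p.toTotal ∈ c.chart.source) :
    Function.Injective (c.dcoords p) := (c.bijective_mfderiv_coords hp).1

theorem surjective_dcoords (c : AdaptedChart π) {p : Jet π m} (hp : p.toTotal ∈ c.chart.source) :
    Function.Surjective (c.dcoords p) := (c.bijective_mfderiv_coords hp).2

theorem dcoords_inverse_apply (c : AdaptedChart π) {p : Jet π m}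
    (hp : p.toTotal ∈ c.chart.source) (y : JetModel n m) :
    c.dcoords p ((c.dcoords p).inverse y) = y := by
  obtain ⟨e, he⟩ : (c.dcoords p).IsInvertible := c.isInvertible_mfderiv_coords hp
  rw [← he, ContinuousLinearMap.inverse_equiv]
  exact e.apply_symm_apply y

theorem poincareCartan₂_apply (L : Jet π k → ℝ) (p : Jet π (2 * k - 1))
    (v w : TangentSpace 𝓘(ℝ, JetModel n (2 * k - 1)) p) :
    poincareCartan₂ L p ![v, w] =
      localPoincareCartan₂ ((adaptedChartAt π p.toTotal).localRep L)
        ((adaptedChartAt π p.toTotal).coords (2 * k - 1) p)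
        ![(adaptedChartAt π p.toTotal).dcoords p v, (adaptedChartAt π p.toTotal).dcoords p w] := by
  refine congrArg (localPoincareCartan₂ ((adaptedChartAt π p.toTotal).localRep L)
    ((adaptedChartAt π p.toTotal).coords (2 * k - 1) p)) (funext fun i => ?_)
  fin_cases i <;> rfl

theorem interiorProduct_eq_neg (p : Jet π m)
    (β : TangentSpace 𝓘(ℝ, JetModel n m) p [⋀^Fin 2]→L[ℝ] ℝ)
    (v w : TangentSpace 𝓘(ℝ, JetModel n m) p) :
    interiorProduct v β w = -interiorProduct w β v := by
  rw [interiorProduct_apply, interiorProduct_apply]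
  have h := β.map_swap ![w, v] (show (0 : Fin 2) ≠ 1 by decide)
  have e : ![w, v] ∘ ⇑(Equiv.swap (0 : Fin 2) 1) = ![v, w] := by
    funext i
    fin_cases i <;> rfl
  rw [e] at h
  exact h

theorem eulerLagrangeFun_coords (hk : 1 ≤ k) {L : Jet π k → ℝ}
    (hL : ContMDiff 𝓘(ℝ, JetModel n k) 𝓘(ℝ, ℝ) ∞ L) (c : AdaptedChart π) {χ : ℝ → E} {t : ℝ}
    (h : IsLocalSection π χ t) (hc : χ t ∈ c.chart.source) (A : Fin n) :
    eulerLagrangeCurve (c.localRep L) (c.fibreCurve χ) A t =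
      eulerLagrangeFun (c.localRep L) A (c.coords (2 * k - 1) (Jet.mk _ χ t h))
        (iteratedDeriv (2 * k - 1 + 1) (c.fibreCurve χ) t) := by
  obtain ⟨I, hI, ht, hIc⟩ := h.exists_isOpen c hc
  rw [c.coords_mk_eq_jetCurve h hc]
  refine eulerLagrangeCurve_eq c.chart.open_target hk (c.contDiffOn_localRep hL) hI
    (c.contDiffOn_fibreCurve hIc) (fun s hs => ?_) A ht
  rw [c.mk_fibreCurve (hIc s hs).1 (hIc s hs).2]
  exact c.chart.map_source (hIc s hs).2

/-- The velocity of a prolongation is in the kernel of the Poincaré-Cartan form if and only if the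
Euler-Lagrange equations hold, in any natural coordinates. -/
theorem interiorProduct_eq_zero_iff (hk : 1 ≤ k) {L : Jet π k → ℝ}
    (hL : ContMDiff 𝓘(ℝ, JetModel n k) 𝓘(ℝ, ℝ) ∞ L) (c : AdaptedChart π) {p : Jet π (2 * k - 1)}
    (hp : p.toTotal ∈ c.chart.source) {v : TangentSpace 𝓘(ℝ, JetModel n (2 * k - 1)) p}
    {u : Fin n → ℝ} (hv : c.dcoords p v = sprayVec (c.coords _ p) u) :
    interiorProduct v (poincareCartan₂ L p) = 0 ↔
      ∀ A, eulerLagrangeFun (c.localRep L) A (c.coords _ p) u = 0 := by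
  -- Realizing `v` as the velocity of a prolongation turns the change from `c` to the chart `c₀` in
  -- which the form is computed into the covariance of the Euler-Lagrange equations along a curve.
  obtain ⟨χ, t, h, hpe, hχ⟩ := exists_section_of_dcoords_eq c hp hv
  set c₀ := adaptedChartAt π p.toTotal with hc₀
  have hp₀ : p.toTotal ∈ c₀.chart.source := mem_adaptedChartAt_source _
  have hu : u = iteratedDeriv (2 * k - 1 + 1) (c.fibreCurve χ) t := by
    rw [← coordQ_sprayVec_self (c.coords _ p) u, ← hv, hχ c hp, coordQ_sprayVec_self]
  have hcurve : ∀ c' : AdaptedChart π, p.toTotal ∈ c'.chart.source → ∀ A,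
      eulerLagrangeCurve (c'.localRep L) (c'.fibreCurve χ) A t =
      eulerLagrangeFun (c'.localRep L) A (c'.coords (2 * k - 1) p)
        (iteratedDeriv (2 * k - 1 + 1) (c'.fibreCurve χ) t) := by
    intro c' hc' A
    subst hpe
    exact eulerLagrangeFun_coords hk hL c' h hc' A
  have hχc : ∀ c' : AdaptedChart π, p.toTotal ∈ c'.chart.source → χ t ∈ c'.chart.source := by
    intro c' hc'
    subst hpe
    exact hc'
  have h0 : interiorProduct v (poincareCartan₂ L p) = 0 ↔
      ∀ A, eulerLagrangeCurve (c₀.localRep L) (c₀.fibreCurve χ) A t = 0 := by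
    have happ : ∀ w, interiorProduct v (poincareCartan₂ L p) w =
        ∑ A, eulerLagrangeCurve (c₀.localRep L) (c₀.fibreCurve χ) A t *
          (coordQ (c₀.dcoords p w) 0 A - coordQ (c₀.dcoords p v) 0 A * (c₀.dcoords p w).1) := by
      intro w
      rw [interiorProduct_apply, poincareCartan₂_apply, ← hc₀, hχ c₀ hp₀,
        localPoincareCartan₂_sprayVec c₀.chart.open_target hk (c₀.contDiffOn_localRep hL)
          (c₀.coords_mem_jetDomain hp₀)]
      simp_rw [hcurve c₀ hp₀]
    constructor
    · intro hz A
      -- Testing against `∂/∂q_0^A` isolates the coefficient of index `A`.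
      obtain ⟨w, hw⟩ := surjective_dcoords c₀ hp₀ (vecQ 0 A)
      have h1 : (vecQ 0 A : JetModel n (2 * k - 1)).1 = 0 := rfl
      have := happ w
      rw [hz, hw, Finset.sum_eq_single A] at this
      · simpa [coordQ_vecQ, h1] using this.symm
      · intro B _ hB
        simp [coordQ_vecQ, h1, hB]
      · simp
    · intro hz
      refine ContinuousLinearMap.ext fun w => ?_
      rw [happ w, Finset.sum_eq_zero]
      · rfl
      · intro A _; rw [hz A, zero_mul]
  rw [h0, hu]
  simp_rw [← hcurve c hp]
  exact ⟨fun hz => eulerLagrangeCurve_eq_zero_of_chart hL c c₀ h (hχc c hp) (hχc c₀ hp₀) hz,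
    fun hz => eulerLagrangeCurve_eq_zero_of_chart hL c₀ c h (hχc c₀ hp₀) (hχc c hp) hz⟩

theorem GlobalSection.eventually_prolong (φ : GlobalSection π) (m : ℕ) (t : ℝ) :
    ∀ᶠ s in 𝓝 t, ∃ hs : IsLocalSection π φ.toFun s, φ.prolong m s = Jet.mk m φ.toFun s hs :=
  Eventually.of_forall fun s => ⟨φ.isLocalSection s, rfl⟩

theorem GlobalSection.hasMFDerivAt_prolong (φ : GlobalSection π) (m : ℕ) (t : ℝ) :
    HasMFDerivAt 𝓘(ℝ, ℝ) 𝓘(ℝ, JetModel n m) (φ.prolong m) t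
      ((1 : ℝ →L[ℝ] ℝ).smulRight (velocity (φ.prolong m) t)) :=
  hasMFDerivAt_velocity
    (mdifferentiableAt_of_eventually (φ.isLocalSection t) (φ.eventually_prolong m t))

theorem GlobalSection.dcoords_velocity_prolong (φ : GlobalSection π) (m : ℕ) (t : ℝ)
    (c : AdaptedChart π) (hc : φ.toFun t ∈ c.chart.source) :
    c.dcoords (φ.prolong m t) (velocity (φ.prolong m) t) = sprayVec (c.coords m (φ.prolong m t))
      (iteratedDeriv (m + 1) (c.fibreCurve φ.toFun) t) :=
  dcoords_velocity (φ.isLocalSection t) (φ.eventually_prolong m t) c hc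

theorem GlobalSection.isSprayVector_velocity (φ : GlobalSection π) (m : ℕ) (t : ℝ) :
    IsSprayVector (φ.prolong m t) (velocity (φ.prolong m) t) :=
  ⟨φ.toFun, t, φ.isLocalSection t, rfl, fun c hc => φ.dcoords_velocity_prolong m t c hc⟩

theorem eulerLagrange_iff (L : Jet π k → ℝ) (φ : GlobalSection π) :
    EulerLagrange L φ ↔ ∀ (c : AdaptedChart π) (t : ℝ), φ.toFun t ∈ c.chart.source → ∀ A,
      eulerLagrangeCurve (c.localRep L) (c.fibreCurve φ.toFun) A t = 0 := by
  refine forall_congr' fun c => forall_congr' fun t => forall_congr' fun hc =>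
    forall_congr' fun A => ?_
  have hev : ∀ᶠ s in 𝓝 t, φ.toFun s ∈ c.chart.source :=
    φ.contMDiff.continuous.continuousAt.preimage_mem_nhds (c.chart.open_source.mem_nhds hc)
  have : ∀ i, iteratedDeriv i
        (fun s => partialQ (c.localRep L) i A (c.coords k (φ.prolong k s))) t =
      iteratedDeriv i (fun s => partialQ (c.localRep L) i A
        (jetCurve k (c.fibreCurve φ.toFun) s)) t := by
    intro i
    refine Filter.EventuallyEq.iteratedDeriv_eq i ?_
    filter_upwards [hev] with s hs
    rw [GlobalSection.prolong, c.coords_mk_eq_jetCurve _ hs]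
  rw [eulerLagrangeCurve]
  simp_rw [this]

theorem eulerLagrange_iff_interiorProduct (hk : 1 ≤ k) {L : Jet π k → ℝ}
    (hL : ContMDiff 𝓘(ℝ, JetModel n k) 𝓘(ℝ, ℝ) ∞ L) (φ : GlobalSection π) :
    EulerLagrange L φ ↔ ∀ t, interiorProduct (velocity (φ.prolong (2 * k - 1)) t)
      (poincareCartan₂ L (φ.prolong (2 * k - 1) t)) = 0 := by
  have key : ∀ (c : AdaptedChart π) (t : ℝ), φ.toFun t ∈ c.chart.source →
      (interiorProduct (velocity (φ.prolong (2 * k - 1)) t)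
        (poincareCartan₂ L (φ.prolong (2 * k - 1) t)) = 0 ↔
      ∀ A, eulerLagrangeCurve (c.localRep L) (c.fibreCurve φ.toFun) A t = 0) := by
    intro c t hc
    rw [interiorProduct_eq_zero_iff hk hL c (p := φ.prolong (2 * k - 1) t) hc
      (φ.dcoords_velocity_prolong _ t c hc)]
    exact forall_congr' fun A =>
      (eulerLagrangeFun_coords hk hL c (φ.isLocalSection t) hc A) ▸ Iff.rfl
  rw [eulerLagrange_iff]
  constructor
  · intro h t
    obtain ⟨c, hc⟩ := exists_adaptedChart π (φ.toFun t)
    exact (key c t hc).2 (h c t hc)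
  · intro h c t hc
    exact (key c t hc).1 (h t)

/-! ### Construction of vector fields -/

/-- A partition of unity glues the local fields: convexity of the constraint sets is preserved by
convex combinations, so only local smooth solutions are needed. -/
theorem exists_isSmoothVectorField_mem [T2Space E] [SecondCountableTopology E]
    (T : (p : Jet π m) → Set (TangentSpace 𝓘(ℝ, JetModel n m) p)) (hconv : ∀ p, Convex ℝ (T p))
    (hloc : ∀ p, ∃ (c : AdaptedChart π) (G : JetModel n m → JetModel n m), ∀ᶠ q in 𝓝 p,
      q.toTotal ∈ c.chart.source ∧ ContDiffAt ℝ ∞ G (c.coords m q) ∧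
        ∀ v, c.dcoords q v = G (c.coords m q) → v ∈ T q) :
    ∃ X : (p : Jet π m) → TangentSpace 𝓘(ℝ, JetModel n m) p,
      IsSmoothVectorField X ∧ ∀ p, X p ∈ T p := by
  obtain ⟨X, hX⟩ := exists_contMDiffSection_forall_mem_convex_of_local 𝓘(ℝ, JetModel n m)
    (n := ⊤) (F_fiber := JetModel n m)
    (fun p : Jet π m => TangentSpace 𝓘(ℝ, JetModel n m) p) T hconv (by
      intro p
      obtain ⟨c, G, h⟩ := hloc p
      refine ⟨_, h, fun q => (c.dcoords q).inverse (G (c.coords m q)), ?_, ?_⟩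
      · rintro q ⟨hqc, hqG, -⟩
        refine (contMDiffAt_of_dcoords c hqc hqG ?_).contMDiffWithinAt
        filter_upwards [(c.isOpen_jetSource m).mem_nhds hqc] with r hr
        exact dcoords_inverse_apply c hr _
      · rintro q ⟨hqc, -, hqT⟩
        exact hqT _ (dcoords_inverse_apply c hqc _))
  exact ⟨X, X.contMDiff, hX⟩

/-- Every tangent vector extends to a smooth vector field. -/
theorem exists_isSmoothVectorField_eq [T2Space E] [SecondCountableTopology E] (p₀ : Jet π m)
    (w : TangentSpace 𝓘(ℝ, JetModel n m) p₀) :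
    ∃ Y : (p : Jet π m) → TangentSpace 𝓘(ℝ, JetModel n m) p,
      IsSmoothVectorField Y ∧ Y p₀ = w := by
  refine Exists.imp (fun Y hY => ?_) <| exists_isSmoothVectorField_mem
    -- The constraint is `{w}` at `p₀` and the whole tangent space elsewhere; `HEq` compares vectors
    -- whose base points are not definitionally equal.
    (fun p : Jet π m => {v : TangentSpace 𝓘(ℝ, JetModel n m) p | p = p₀ → HEq v w}) ?_ ?_
  · exact ⟨hY.1, eq_of_heq (hY.2 p₀ rfl)⟩
  · intro p v hv v' hv' a b _ _ hab h
    subst h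
    rw [eq_of_heq (hv rfl), eq_of_heq (hv' rfl), ← add_smul, hab, one_smul]
  · intro p
    obtain ⟨c, hc⟩ := exists_adaptedChart π p.toTotal
    have hev := (c.isOpen_jetSource m).mem_nhds hc
    by_cases h : p = p₀
    · subst h
      refine ⟨c, fun _ => c.dcoords p w, ?_⟩
      filter_upwards [hev] with q hq
      refine ⟨hq, contDiffAt_const, fun v hv hqp => ?_⟩
      subst hqp
      exact heq_of_eq (injective_dcoords c hq hv)
    · refine ⟨c, fun _ => 0, ?_⟩
      filter_upwards [hev, isOpen_ne.mem_nhds h] with q hq hqp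
      exact ⟨hq, contDiffAt_const, fun v _ hqp' => absurd hqp' hqp⟩

theorem Jet.continuous_time : Continuous (Jet.time : Jet π m → ℝ) := by
  rw [continuous_iff_continuousAt]
  intro p
  obtain ⟨c, hc⟩ := exists_adaptedChart π p.toTotal
  refine (continuous_fst.continuousAt.comp (c.contMDiffAt_coords hc).continuousAt).congr ?_
  filter_upwards [(c.isOpen_jetSource m).mem_nhds hc] with q hq
  exact c.fst_coords_eq_time hq

/-- The prolongation of a section is an integral curve of a smooth field of spray vectors. -/
theorem exists_isSprayVector_field [T2Space E] [SecondCountableTopology E]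
    (φ : GlobalSection π) :
    ∃ X : (p : Jet π m) → TangentSpace 𝓘(ℝ, JetModel n m) p, IsSmoothVectorField X ∧
      (∀ p, IsSprayVector p (X p)) ∧ ∀ t, X (φ.prolong m t) = velocity (φ.prolong m) t := by
  refine Exists.imp (fun X hX => ?_) <| exists_isSmoothVectorField_mem
    (fun p : Jet π m => {v : TangentSpace 𝓘(ℝ, JetModel n m) p | IsSprayVector p v ∧
      ∀ t, φ.prolong m t = p → HEq v (velocity (φ.prolong m) t)}) ?_ ?_
  · exact ⟨hX.1, fun p => (hX.2 p).1, fun t => eq_of_heq ((hX.2 _).2 t rfl)⟩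
  · intro p v hv v' hv' a b ha hb hab
    refine ⟨convex_isSprayVector p hv.1 hv'.1 ha hb hab, fun t ht => ?_⟩
    subst ht
    rw [eq_of_heq (hv.2 t rfl), eq_of_heq (hv'.2 t rfl), ← add_smul, hab, one_smul]
  · intro p
    obtain ⟨c, hc⟩ := exists_adaptedChart π p.toTotal
    have hev := (c.isOpen_jetSource m).mem_nhds hc
    -- This equation characterizes the image of the prolongation, which is therefore closed. Near
    -- its points the local field takes `u` to be the derivative of order `m + 1` of the section at
    -- the time of the jet; near other points any choice, such as `u = 0`, will do.
    by_cases h : φ.prolong m p.time = p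
    · set I := φ.toFun ⁻¹' c.chart.source with hI
      have hIo : IsOpen I := c.chart.open_source.preimage φ.contMDiff.continuous
      have hfib : ContDiffOn ℝ ∞ (c.fibreCurve φ.toFun) I :=
        c.contDiffOn_fibreCurve fun s hs => ⟨φ.isLocalSection s, hs⟩
      have ht : p.time ∈ I := by
        rw [← h] at hc; exact hc
      refine ⟨c, fun x => sprayVec x (iteratedDeriv (m + 1) (c.fibreCurve φ.toFun) x.1), ?_⟩
      filter_upwards [hev, (Jet.continuous_time.continuousAt (x := p)).preimage_mem_nhds
        (hIo.mem_nhds ht)] with q hq hqt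
      refine ⟨hq, ?_, fun v hv => ⟨exists_section_of_dcoords_eq c hq hv, ?_⟩⟩
      · have h1 : ContDiffAt ℝ ∞ (iteratedDeriv (m + 1) (c.fibreCurve φ.toFun))
            (c.coords m q).1 := by
          rw [c.fst_coords_eq_time hq]
          exact (contDiffOn_iteratedDeriv hIo hfib (m + 1)).contDiffAt (hIo.mem_nhds hqt)
        have h2 : ContDiffAt ℝ ∞ (fun x : JetModel n m =>
            iteratedDeriv (m + 1) (c.fibreCurve φ.toFun) x.1) (c.coords m q) :=
          h1.comp (c.coords m q) contDiffAt_fst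
        exact contDiff_sprayVec.contDiffAt.comp (c.coords m q) (contDiffAt_id.prodMk h2)
      · intro t htq
        subst htq
        refine heq_of_eq (injective_dcoords c hq ?_)
        rw [hv, φ.dcoords_velocity_prolong m t c hq, c.fst_coords_eq_time hq]
        rfl
    · have hcont : Continuous (φ.prolong m) := continuous_iff_continuousAt.2 fun t =>
        (φ.hasMFDerivAt_prolong m t).continuousAt
      have hne : ∀ᶠ q : Jet π m in 𝓝 p, φ.prolong m q.time ≠ q :=
        (isOpen_ne_fun (hcont.comp Jet.continuous_time) continuous_id).mem_nhds h
      refine ⟨c, fun x => sprayVec x 0, ?_⟩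
      filter_upwards [hev, hne] with q hq hqp
      refine ⟨hq, (contDiff_sprayVec.comp (contDiff_id.prodMk contDiff_const)).contDiffAt,
        fun v hv => ⟨exists_section_of_dcoords_eq c hq hv, fun t ht => absurd ?_ hqp⟩⟩
      rw [← ht]; rfl

/-- For a regular Lagrangian there is a smooth field of spray vectors in the kernel of the
Poincaré-Cartan form, and at each point there is only one such vector. -/
theorem IsRegularLagrangian.exists_field [T2Space E] [SecondCountableTopology E] (hk : 1 ≤ k)
    {L : Jet π k → ℝ} (hL : ContMDiff 𝓘(ℝ, JetModel n k) 𝓘(ℝ, ℝ) ∞ L)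
    (hreg : IsRegularLagrangian L) :
    ∃ X : (p : Jet π (2 * k - 1)) → TangentSpace 𝓘(ℝ, JetModel n (2 * k - 1)) p,
      IsSmoothVectorField X ∧ (∀ p, IsSprayVector p (X p)) ∧
      (∀ p, interiorProduct (X p) (poincareCartan₂ L p) = 0) ∧
      ∀ p v, IsSprayVector p v → interiorProduct v (poincareCartan₂ L p) = 0 → v = X p := by
  have hF : ∀ c : AdaptedChart π, ∃ F : JetModel n (2 * k - 1) → Fin n → ℝ,
      ContDiffOn ℝ ∞ F (jetDomain c.chart.target (2 * k - 1)) ∧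
      ∀ x ∈ jetDomain c.chart.target (2 * k - 1), ∀ u,
        (∀ A, eulerLagrangeFun (c.localRep L) A x u = 0) ↔ u = F x := by
    intro c
    refine exists_contDiffOn_eulerLagrangeFun_eq_zero c.chart.open_target hk
      (c.contDiffOn_localRep hL) fun y hy => ?_
    have hs : (c.jetOfCoords y hy).toTotal ∈ c.chart.source := by
      change c.chart.symm (AdaptedChart.taylorCurve y y.1) ∈ c.chart.source
      rw [AdaptedChart.taylorCurve_self]; exact c.chart.map_target hy
    have := hreg c (c.jetOfCoords y hy) hs
    rwa [show c.coords k (c.jetOfCoords y hy) = y from c.coords_taylor hy] at this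
  choose F hFs hFe using hF
  -- In every chart the two conditions select one vector, with smooth coordinates. The constraint
  -- sets are then trivially convex, and the local solutions satisfy the hypotheses of the gluing
  -- lemma.
  have hiff : ∀ (c : AdaptedChart π) (p : Jet π (2 * k - 1)), p.toTotal ∈ c.chart.source →
      ∀ v, (IsSprayVector p v ∧ interiorProduct v (poincareCartan₂ L p) = 0) ↔
        c.dcoords p v = sprayVec (c.coords _ p) (F c (c.coords _ p)) := by
    intro c p hp v
    constructor
    · rintro ⟨hv, hv0⟩
      obtain ⟨u, hu⟩ := hv.exists_dcoords_eq c hp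
      rw [interiorProduct_eq_zero_iff hk hL c hp hu, hFe c _ (c.coords_mem_jetDomain hp)] at hv0
      rw [hu, hv0]
    · intro hv
      refine ⟨exists_section_of_dcoords_eq c hp hv, ?_⟩
      rw [interiorProduct_eq_zero_iff hk hL c hp hv, hFe c _ (c.coords_mem_jetDomain hp)]
  have huniq : ∀ p v w, IsSprayVector p v → interiorProduct v (poincareCartan₂ L p) = 0 →
      IsSprayVector p w → interiorProduct w (poincareCartan₂ L p) = 0 → v = w := by
    intro p v w hv hv0 hw hw0
    obtain ⟨c, hc⟩ := exists_adaptedChart π p.toTotal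
    exact injective_dcoords c hc
      (((hiff c p hc v).1 ⟨hv, hv0⟩).trans ((hiff c p hc w).1 ⟨hw, hw0⟩).symm)
  refine Exists.imp (fun X hX => ?_) <| exists_isSmoothVectorField_mem
    (fun p : Jet π (2 * k - 1) => {v : TangentSpace 𝓘(ℝ, JetModel n (2 * k - 1)) p |
      IsSprayVector p v ∧ interiorProduct v (poincareCartan₂ L p) = 0}) ?_ ?_
  · exact ⟨hX.1, fun p => (hX.2 p).1, fun p => (hX.2 p).2,
      fun p v hv hv0 => huniq p v _ hv hv0 (hX.2 p).1 (hX.2 p).2⟩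
  · intro p v hv w hw a b _ _ hab
    rw [huniq p v w hv.1 hv.2 hw.1 hw.2, ← add_smul, hab, one_smul]
    exact hw
  · intro p
    obtain ⟨c, hc⟩ := exists_adaptedChart π p.toTotal
    refine ⟨c, fun x => sprayVec x (F c x), ?_⟩
    filter_upwards [(c.isOpen_jetSource (2 * k - 1)).mem_nhds hc] with q hq
    refine ⟨hq, ?_, fun v hv => (hiff c q hq v).2 hv⟩
    exact contDiff_sprayVec.contDiffAt.comp (c.coords _ q) (contDiffAt_id.prodMk
      ((hFs c).contDiffAt ((isOpen_jetDomain c.chart.open_target _).mem_nhds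
        (c.coords_mem_jetDomain hq))))

/-! ### Fields of spray vectors are transverse semisprays -/

/-- The `t`-component of a spray vector is `1`, and `dt` reads it off. -/
theorem isTransverse_of_isSprayVector {X : (p : Jet π m) → TangentSpace 𝓘(ℝ, JetModel n m) p}
    (h : ∀ p, IsSprayVector p (X p)) : IsTransverse X := by
  intro p
  obtain ⟨c, hc⟩ := exists_adaptedChart π p.toTotal
  obtain ⟨u, hu⟩ := (h p).exists_dcoords_eq c hc
  have h1 : HasMFDerivAt 𝓘(ℝ, JetModel n m) 𝓘(ℝ, ℝ) (fun q : Jet π m => (c.coords m q).1) p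
      ((ContinuousLinearMap.fst ℝ ℝ (Fin (m + 1) → Fin n → ℝ)).comp (c.dcoords p)) :=
    HasMFDerivAt.comp p (ContinuousLinearMap.fst ℝ ℝ
      (Fin (m + 1) → Fin n → ℝ)).hasFDerivAt.hasMFDerivAt
      (c.mdifferentiableAt_coords hc).hasMFDerivAt
  have h2 : (Jet.time : Jet π m → ℝ) =ᶠ[𝓝 p] fun q => (c.coords m q).1 := by
    filter_upwards [(c.isOpen_jetSource m).mem_nhds hc] with q hq
    exact (c.fst_coords_eq_time hq).symm
  have h3 : mfderiv 𝓘(ℝ, JetModel n m) 𝓘(ℝ, ℝ) (Jet.time : Jet π m → ℝ) p (X p)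
      = (c.dcoords p (X p)).1 :=
    DFunLike.congr_fun (h1.congr_of_eventuallyEq h2).mfderiv (X p)
  rw [h3, hu]
  exact one_ne_zero (α := ℝ)

theorem IsLocalSection.congr {χ χ' : ℝ → E} {t : ℝ} (h : IsLocalSection π χ t)
    (he : χ' =ᶠ[𝓝 t] χ) : IsLocalSection π χ' t := by
  filter_upwards [h, eventually_eventually_nhds.2 he] with s hs hs'
  refine ⟨?_, hs.2.congr_of_eventuallyEq hs'⟩
  rw [hs'.self_of_nhds]; exact hs.1

/-- Solutions of an ODE inherit the smoothness of the right-hand side; the regularity result on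
compact intervals is applied around each time. -/
theorem contDiffOn_of_hasDerivAt_autonomous {M : Type*} [NormedAddCommGroup M] [NormedSpace ℝ M]
    [CompleteSpace M] {G : M → M} {D : Set M} (hG : ContDiffOn ℝ ∞ G D) {y : ℝ → M} {W : Set ℝ}
    (hW : IsOpen W) (hyD : MapsTo y W D) (hy : ∀ s ∈ W, HasDerivAt y (G (y s)) s) :
    ContDiffOn ℝ ∞ y W := by
  intro s hs
  obtain ⟨δ, hδ, hball⟩ := Metric.isOpen_iff.1 hW s hs
  have hsub : Icc (s - δ / 2) (s + δ / 2) ⊆ W := by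
    rw [← Real.closedBall_eq_Icc]
    exact (Metric.closedBall_subset_ball (by linarith)).trans hball
  have h := ODE.contDiffOn_enat_Icc_of_hasDerivWithinAt (n := ⊤) (f := fun _ => G) (u := D)
    (hG.comp contDiff_snd.contDiffOn fun p hp => hp.2)
    (fun r hr => (hy r (hsub hr)).hasDerivWithinAt) (fun r hr => hyD (hsub hr))
  exact (h.contDiffAt (Icc_mem_nhds (by linarith) (by linarith))).contDiffWithinAt

/-- Parametrization by `t` forces the proportionality factor to be `1`, so in coordinates the curve
solves a smooth autonomous ODE and is smooth. The equations below the top order read `q_i' =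
q_{i+1}`, hence the curve is the prolongation of its component `q_0`. -/
theorem isSemispray_of_isSprayVector {X : (p : Jet π m) → TangentSpace 𝓘(ℝ, JetModel n m) p}
    (hX : IsSmoothVectorField X) (h : ∀ p, IsSprayVector p (X p)) : IsSemispray X := by
  intro a b ψ hψ t ht
  obtain ⟨c, hc⟩ := exists_adaptedChart π (ψ t).toTotal
  have hcont : ContinuousOn ψ (Ioo a b) := fun s hs =>
    (hψ s hs).2.choose_spec.continuousAt.continuousWithinAt
  set W := Ioo a b ∩ ψ ⁻¹' {p | p.toTotal ∈ c.chart.source} with hW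
  have hWo : IsOpen W := hcont.isOpen_inter_preimage isOpen_Ioo (c.isOpen_jetSource m)
  have htW : t ∈ W := ⟨ht, hc⟩
  set y : ℝ → JetModel n m := fun s => c.coords m (ψ s) with hy
  have hy1 : ∀ s ∈ W, (y s).1 = s := fun s hs =>
    (c.fst_coords_eq_time hs.2).trans (hψ s hs.1).1
  have hder : ∀ s ∈ W, HasDerivAt y (c.dcoords (ψ s) (X (ψ s))) s := by
    intro s hs
    obtain ⟨g, hg⟩ := (hψ s hs.1).2
    have h1 := hasDerivAt_coords c hg hs.2
    rw [map_smul] at h1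
    obtain ⟨u, hu⟩ := (h (ψ s)).exists_dcoords_eq c hs.2
    -- The `t`-component of the curve has derivative `g` by this computation and `1` because the
    -- curve is a section.
    have h2 : HasDerivAt (fun r => (y r).1) (g • c.dcoords (ψ s) (X (ψ s))).1 s :=
      (ContinuousLinearMap.fst ℝ ℝ (Fin (m + 1) → Fin n → ℝ)).hasFDerivAt.comp_hasDerivAt s h1
    have h3 : HasDerivAt (fun r => (y r).1) 1 s :=
      (hasDerivAt_id s).congr_of_eventuallyEq (by
        filter_upwards [hWo.mem_nhds hs] with r hr using hy1 r hr)
    have h4 := h2.unique h3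
    rw [hu, Prod.smul_fst, sprayVec_fst, smul_eq_mul, mul_one] at h4
    rwa [h4, one_smul] at h1
  have hys : ContDiffOn ℝ ∞ y W := by
    refine contDiffOn_of_hasDerivAt_autonomous (contDiffOn_dcoords c (ψ t) hX) hWo
      (fun s hs => c.coords_mem_jetDomain hs.2) fun s hs => ?_
    have e : c.ofCoords (ψ t) (y s) = ψ s := (c.jetHomeo (ψ t)).left_inv hs.2
    have := hder s hs
    rwa [← e] at this
  set x : ℝ → Fin n → ℝ := fun s => (y s).2 0 with hx
  have hxs : ContDiffOn ℝ ∞ x W :=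
    (contDiff_apply ℝ (Fin n → ℝ) (0 : Fin (m + 1))).comp_contDiffOn
      (contDiff_snd.comp_contDiffOn hys)
  -- Holonomy by induction on the order; the undetermined component `u` is met only beyond order
  -- `m`.
  have hiter : ∀ i, i ≤ m → EqOn (iteratedDeriv i x) (fun s => coordQ (y s) i) W := by
    intro i
    induction i with
    | zero => intro _ s _; simp [coordQ_zero, hx]
    | succ i ih =>
      intro hi s hs
      obtain ⟨u, hu⟩ := (h (ψ s)).exists_dcoords_eq c hs.2
      rw [iteratedDeriv_succ, ((ih (by omega)).eventuallyEq_of_mem (hWo.mem_nhds hs)).deriv_eq]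
      have h1 : HasDerivAt (fun r => coordQ (y r) i)
          (coordQ (c.dcoords (ψ s) (X (ψ s))) i) s := by
        simp_rw [← coordQL_apply]
        exact (coordQL n m i).hasFDerivAt.comp_hasDerivAt s (hder s hs)
      rw [h1.deriv, hu, coordQ_sprayVec_of_lt _ _ (by omega)]
  have hjet : EqOn (jetCurve m x) y W := by
    intro s hs
    refine Prod.ext (hy1 s hs).symm (funext fun i => ?_)
    rw [← coordQ_coe (y s) i]
    exact hiter i (by omega) hs
  have hgraph : ∀ s ∈ W, ((s, x s) : BaseModel n) = c.chart (ψ s).toTotal := by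
    intro s hs
    rw [c.chart_toTotal hs.2]
    exact Prod.ext (hy1 s hs).symm rfl
  have hxc : ∀ s ∈ W, ((s, x s) : BaseModel n) ∈ c.chart.target := by
    intro s hs
    rw [hgraph s hs]
    exact c.chart.map_source hs.2
  have hsec : IsLocalSection π (fun s => (ψ s).toTotal) t := by
    refine (c.isLocalSection_symm hWo hxs hxc htW).congr ?_
    filter_upwards [hWo.mem_nhds htW] with s hs
    rw [hgraph s hs, c.chart.left_inv hs.2]
  refine ⟨hsec, c.eq_of_coords_eq hc hc ?_⟩
  rw [c.coords_mk_eq_jetCurve hsec hc]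
  have hfib : EqOn (c.fibreCurve fun s => (ψ s).toTotal) x W := by
    intro s hs
    rw [AdaptedChart.fibreCurve, ← hgraph s hs]
  rw [jetCurve_eqOn hWo hfib htW]
  exact (hjet htW).symm

theorem velocity_eq_of_isMIntegralCurve {ψ : ℝ → Jet π m}
    {X : (p : Jet π m) → TangentSpace 𝓘(ℝ, JetModel n m) p} (h : IsMIntegralCurve ψ X) (t : ℝ) :
    velocity ψ t = X (ψ t) := by
  rw [velocity, (h t).mfderiv]
  exact one_smul ℝ (X (ψ t))

end Dynamics

end JetBundle

end

/-! ### The equivalence of the assertions -/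

open JetBundle
theorem mainTheorem3 {n k : ℕ} (hk : 1 ≤ k) {E : Type*} [TopologicalSpace E] [T2Space E]
    [SecondCountableTopology E] [ChartedSpace (EuclideanSpace ℝ (Fin (n + 1))) E]
    [IsManifold (𝓡 (n + 1)) ∞ E] (π : FibredManifold n E)
    (L : Jet π k → ℝ) (hL : ContMDiff 𝓘(ℝ, JetModel n k) 𝓘(ℝ, ℝ) ∞ L) (φ : GlobalSection π) :
    List.TFAE [
      ∀ Y : (p : Jet π (2 * k - 1)) → TangentSpace 𝓘(ℝ, JetModel n (2 * k - 1)) p,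
        IsSmoothVectorField Y → ∀ t : ℝ,
          pullbackCurve (φ.prolong (2 * k - 1))
            (fun p => interiorProduct (Y p) (poincareCartan₂ L p)) t = 0,
      EulerLagrange L φ,
      ∀ t : ℝ, interiorProduct (velocity (φ.prolong (2 * k - 1)) t)
        (poincareCartan₂ L (φ.prolong (2 * k - 1) t)) = 0,
      ∃ X : (p : Jet π (2 * k - 1)) → TangentSpace 𝓘(ℝ, JetModel n (2 * k - 1)) p,
        IsSmoothVectorField X ∧ IsSemispray X ∧ IsTransverse X ∧
          IsMIntegralCurve (φ.prolong (2 * k - 1)) X ∧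
          ∀ t : ℝ, interiorProduct (X (φ.prolong (2 * k - 1) t))
            (poincareCartan₂ L (φ.prolong (2 * k - 1) t)) = 0] ∧
    (IsRegularLagrangian L →
      (EulerLagrange L φ ↔
        ∃ X : (p : Jet π (2 * k - 1)) → TangentSpace 𝓘(ℝ, JetModel n (2 * k - 1)) p,
          IsSmoothVectorField X ∧ IsSemispray X ∧ IsTransverse X ∧
            IsMIntegralCurve (φ.prolong (2 * k - 1)) X ∧
            ∀ p : Jet π (2 * k - 1), interiorProduct (X p) (poincareCartan₂ L p) = 0)) := by
  have h23 := eulerLagrange_iff_interiorProduct hk hL φ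
  refine ⟨?_, fun hreg => ⟨fun hEL => ?_, ?_⟩⟩
  · tfae_have 2 ↔ 3 := h23
    tfae_have 3 → 1 := by
      intro h Y _ t
      -- A 1-form on `ℝ` is determined by its value on `1`, here `Ω(Y, ψ')`; antisymmetry moves `ψ'`
      -- to the first slot.
      refine ContinuousLinearMap.ext_ring ?_
      have h1 := interiorProduct_eq_neg _ (poincareCartan₂ L (φ.prolong (2 * k - 1) t))
        (Y (φ.prolong (2 * k - 1) t)) (velocity (φ.prolong (2 * k - 1)) t)
      rw [h t] at h1
      exact h1.trans neg_zero
    tfae_have 1 → 3 := by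
      intro h t
      refine ContinuousLinearMap.ext fun w => ?_
      -- Assertion 1 speaks of global smooth fields only, so the test vector is extended to one.
      obtain ⟨Y, hY, hYw⟩ := exists_isSmoothVectorField_eq (φ.prolong (2 * k - 1) t) w
      have h1 := DFunLike.congr_fun (h Y hY t) (1 : ℝ)
      rw [interiorProduct_eq_neg, ← hYw]
      exact (congrArg Neg.neg h1).trans neg_zero
    tfae_have 3 → 4 := by
      intro h
      obtain ⟨X, hX, hXs, hXv⟩ := exists_isSprayVector_field (m := 2 * k - 1) φ
      refine ⟨X, hX, isSemispray_of_isSprayVector hX hXs, isTransverse_of_isSprayVector hXs,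
        fun t => ?_, fun t => ?_⟩
      · rw [hXv t]; exact φ.hasMFDerivAt_prolong _ t
      · rw [hXv t]; exact h t
    tfae_have 4 → 3 := by
      rintro ⟨X, -, -, -, hXi, hX0⟩ t
      rw [velocity_eq_of_isMIntegralCurve hXi t]
      exact hX0 t
    tfae_finish
  · obtain ⟨X, hX, hXs, hX0, hXu⟩ := hreg.exists_field hk hL
    refine ⟨X, hX, isSemispray_of_isSprayVector hX hXs, isTransverse_of_isSprayVector hXs,
      fun t => ?_, hX0⟩
    -- The velocity of the prolongation is a spray vector in the kernel of the form, hence equals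
    -- the unique such vector `X`.
    rw [← hXu _ _ (φ.isSprayVector_velocity _ t) (h23.1 hEL t)]
    exact φ.hasMFDerivAt_prolong _ t
  · rintro ⟨X, -, -, -, hXi, hX0⟩
    refine h23.2 fun t => ?_
    rw [velocity_eq_of_isMIntegralCurve hXi t]
    exact hX0 _
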